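/- Conventions. All manifolds are smooth, Hausdorff, without boundary and oriented, and carry a smooth Riemannian metric with Levi-Civita connection; $V\to M$ is a smooth real vector bundle of finite rank with a smooth fibre metric (a Riemannian vector bundle). $A$ is a smooth metric connection on $V$, with curvature the $\mathrm{End}(V)$-valued $2$-form $F(X,Y)s=\nabla_X\nabla_Ys-\nabla_Y\nabla_Xs-\nabla_{[X,Y]}s$. $\mathrm{End}(V)$ carries the induced connection and the inner product $\langle S,T\rangle=\operatorname{tr}(S^{T}T)$, and $\nabla$ on $\mathrm{End}(V)$-valued forms is the tensor product of the Levi-Civita connection and this connection. For an orthonormal frame $(e_i)$, $|\alpha|^2=\sum_i|\alpha(e_i)|^2$ for $1$-forms, $|\beta|^2=\sum_{i<j}|\beta(e_i,e_j)|^2$ for $2$-forms, and $|\nabla\beta|^2=\sum_i|\nabla_{e_i}\beta|^2$. Further, $(d\alpha)(X,Y)=\nabla_X(\alpha(Y))-\nabla_Y(\alpha(X))-\alpha([X,Y])$ for an $\mathrm{End}(V)$-valued $1$-form $\alpha$; $d\Phi=\nabla\Phi$ for a section $\Phi$ of $\mathrm{End}(V)$; $d^*\alpha=-\sum_i(\nabla_{e_i}\alpha)(e_i)$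 for $1$-forms and $(d^*\beta)(v)=-\sum_i(\nabla_{e_i}\beta)(e_i,v)$ for $2$-forms; and $*$ is the Hodge star. (i) Let $n=\dim M=4$ and let $A$ be a Yang–Mills connection, i.e. $d^*F=0$. For either sign put $F^{\pm}=\frac12(F\pm *F)$. Then $F^\pm=0$ everywhere if and only if $*F=\mp F$ everywhere (that is, $A$ is an instanton of the corresponding sign). At every point where $F^\pm\neq0$ the function $|F^\pm|$ is differentiable, and at every point where $|F^\pm|$ is differentiable $$|\nabla F^{\pm}|^{2}\ \ge\ \Bigl(1+\tfrac12\Bigr)\,\bigl|d|F^{\pm}|\bigr|^{2}.$$ (ii) Let $n=\dim M=3$ and let $(A,\Phi)$ be a Yang–Mills–Higgs pair: $\Phi$ is a smooth section of the bundle of skew-symmetric endomorphisms of $V$, $d^*F=[d\Phi,\Phi]$ and $d^*d\Phi=0$. For either sign put $\omega^{\pm}=*F\pm d\Phi$, and let $a>0$ be a constant. Then $\omega^\pm=0$ everywhere if and only if $*F=\mp d\Phi$ everywhere (that is, $(A,\Phi)$ is a monopole of the corresponding sign). At every point where $\omega^\pm\neq0$ the function $|\omega^\pm|$ is differentiable,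 and at every point where $|\omega^\pm|$ is differentiable $$|\nabla\omega^{\pm}|^{2}\ \ge\ \Bigl(1+\min\bigl\{\tfrac12,\tfrac{a}{1+a}\bigr\}\Bigr)\bigl|d|\omega^{\pm}|\bigr|^{2}-a\,|d\omega^{\pm}|^{2}.$$ Moreover, $|d\omega^{\pm}|=|[\omega^{\pm},\Phi]|$ at every point. -/

import Mathlib

open Bundle
open scoped Manifold ContDiff Topology

set_option linter.unusedSectionVars false

universe u v w

noncomputable section

namespace GaugeKato

section Connections
variable
  {E : Type*} [NormedAddCommGroup E] [NormedSpace ℝ E]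
  {H : Type*} [TopologicalSpace H] {I : ModelWithCorners ℝ E H}
  {M : Type*} [TopologicalSpace M] [ChartedSpace H M] [IsManifold I ∞ M]
  {F : Type*} [NormedAddCommGroup F] [NormedSpace ℝ F]
  {V : M → Type*} [TopologicalSpace (TotalSpace F V)]
  [∀ x, AddCommGroup (V x)] [∀ x, Module ℝ (V x)] [∀ x, TopologicalSpace (V x)]
  [∀ x, IsTopologicalAddGroup (V x)] [∀ x, ContinuousSMul ℝ (V x)]
  [FiberBundle F V] [VectorBundle ℝ F V]
  {G : Type*} [NormedAddCommGroup G] [NormedSpace ℝ G]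
  {W : M → Type*} [TopologicalSpace (TotalSpace G W)]
  [∀ x, AddCommGroup (W x)] [∀ x, Module ℝ (W x)] [∀ x, TopologicalSpace (W x)]
  [∀ x, IsTopologicalAddGroup (W x)] [∀ x, ContinuousSMul ℝ (W x)]
  [FiberBundle G W] [VectorBundle ℝ G W]

/-- The map into the total space of the bundle `Hom(V, W)` defined by a section `Ψ`. -/
abbrev homSec (F G : Type*) [NormedAddCommGroup F] [NormedSpace ℝ F]
    [NormedAddCommGroup G] [NormedSpace ℝ G]
    (Ψ : Π x, V x →L[ℝ] W x) (x : M) : TotalSpace (F →L[ℝ] G) (fun y ↦ V y →L[ℝ] W y) :=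
  ⟨x, Ψ x⟩

/-- `(∇_X Ψ)(s) = ∇_X (Ψ s) - Ψ (∇_X s)` at the point `x`. -/
def homDeriv (cV : CovariantDerivative I F V) (cW : CovariantDerivative I G W)
    (Ψ : Π x, V x →L[ℝ] W x) (x : M) (X : Π y : M, TangentSpace I y) (s : Π y, V y) : W x :=
  cW (fun y ↦ Ψ y (s y)) x (X x) - Ψ x (cV s x (X x))

theorem homDeriv_tensorial₁ (cV : CovariantDerivative I F V) (cW : CovariantDerivative I G W)
    (Ψ : Π x, V x →L[ℝ] W x) (x : M) (s : Π y, V y) :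
    TensorialAt I E (homDeriv cV cW Ψ x · s) x where
  smul hf hX := by simp [homDeriv, smul_sub]
  add hX hX' := by simp [homDeriv]; abel

theorem homDeriv_tensorial₂ (cV : CovariantDerivative I F V) (cW : CovariantDerivative I G W)
    {Ψ : Π x, V x →L[ℝ] W x} {x : M} (hΨ : MDiffAt (homSec F G Ψ) x) (X : Π y : M, TangentSpace I y) :
    TensorialAt I F (homDeriv cV cW Ψ x X) x where
  smul {f s} hf hs := by
    have h1 : MDiffAt (T% (fun y ↦ Ψ y (s y))) x := hΨ.clm_bundle_apply hs
    have h2 : (fun y ↦ Ψ y ((f • s) y)) = f • (fun y ↦ Ψ y (s y)) := by ext y; simp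
    simp only [homDeriv, h2, cW.isCovariantDerivativeOn.leibniz h1 hf,
      cV.isCovariantDerivativeOn.leibniz hs hf]
    simp
    module
  add {s t} hs ht := by
    have h1 : MDiffAt (T% (fun y ↦ Ψ y (s y))) x := hΨ.clm_bundle_apply hs
    have h1' : MDiffAt (T% (fun y ↦ Ψ y (t y))) x := hΨ.clm_bundle_apply ht
    have h2 : (fun y ↦ Ψ y ((s + t) y)) = (fun y ↦ Ψ y (s y)) + (fun y ↦ Ψ y (t y)) := by
      ext y; simp
    simp only [homDeriv, h2, cW.isCovariantDerivativeOn.add h1 h1',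
      cV.isCovariantDerivativeOn.add hs ht]
    simp
    abel

variable [FiniteDimensional ℝ E] [FiniteDimensional ℝ F]
  [ContMDiffVectorBundle ∞ F V I]

open scoped Classical in
/-- The connection on `Hom(V, W)` induced by connections on `V` and `W`. -/
def homConnection
    (cV : CovariantDerivative I F V) (cW : CovariantDerivative I G W) :
    CovariantDerivative I (F →L[ℝ] G) (fun x ↦ V x →L[ℝ] W x) where
  toFun Ψ x :=
    if hΨ : MDiffAt (homSec F G Ψ) x then
      TensorialAt.mkHom₂ (homDeriv cV cW Ψ x) x
        (fun s _ ↦ homDeriv_tensorial₁ cV cW Ψ x s) (fun X _ ↦ homDeriv_tensorial₂ cV cW hΨ X)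
    else 0
  isCovariantDerivativeOnUniv :=
    { add := by
        intro Ψ Θ x hΨ hΘ _
        have hadd : MDiffAt (homSec F G (Ψ + Θ)) x := mdifferentiableAt_add_section hΨ hΘ
        rw [dif_pos hadd, dif_pos hΨ, dif_pos hΘ]
        ext u v
        simp only [add_apply, TensorialAt.mkHom₂_apply_eq_extend, homDeriv]
        have hs := FiberBundle.mdifferentiableAt_extend I F v
        have h2 : (fun y ↦ (Ψ + Θ) y (FiberBundle.extend F v y)) =
          (fun y ↦ Ψ y (FiberBundle.extend F v y)) + (fun y ↦ Θ y (FiberBundle.extend F v y)) := by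
          ext y; simp
        rw [h2, cW.isCovariantDerivativeOn.add (hΨ.clm_bundle_apply hs) (hΘ.clm_bundle_apply hs)]
        simp
        abel
      leibniz := by
        intro Ψ f x hΨ hf _
        have hsm : MDiffAt (homSec F G (f • Ψ)) x := hf.smul_section hΨ
        rw [dif_pos hsm, dif_pos hΨ]
        ext u v
        have hs := FiberBundle.mdifferentiableAt_extend I F v
        have h2 : (fun y ↦ (f • Ψ) y (FiberBundle.extend F v y)) =
          f • (fun y ↦ Ψ y (FiberBundle.extend F v y)) := by
          ext y; simp
        simp only [add_apply, smul_apply,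
          TensorialAt.mkHom₂_apply_eq_extend, homDeriv]
        rw [h2, cW.isCovariantDerivativeOn.leibniz (hΨ.clm_bundle_apply hs) hf]
        simp
        module }

/-- `∇_X (α(Y)) - ∇_Y (α(X)) - α([X, Y])` at the point `x`. -/
def covExtDerivAux (cV : CovariantDerivative I F V) (α : Π x : M, TangentSpace I x →L[ℝ] V x)
    (x : M) (X Y : Π y : M, TangentSpace I y) : V x :=
  cV (fun y ↦ α y (Y y)) x (X x) - cV (fun y ↦ α y (X y)) x (Y x) -
    α x (VectorField.mlieBracket I X Y x)

theorem covExtDerivAux_swap (cV : CovariantDerivative I F V)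
    (α : Π x : M, TangentSpace I x →L[ℝ] V x) (x : M) (X Y : Π y : M, TangentSpace I y) :
    covExtDerivAux cV α x X Y = - covExtDerivAux cV α x Y X := by
  simp only [covExtDerivAux]
  rw [VectorField.mlieBracket_swap_apply]
  simp
  abel

theorem covExtDerivAux_tensorial (cV : CovariantDerivative I F V)
    {α : Π x : M, TangentSpace I x →L[ℝ] V x} {x : M} (hα : MDiffAt (homSec E F α) x)
    (Y : Π y : M, TangentSpace I y) :
    TensorialAt I E (covExtDerivAux cV α x · Y) x where
  smul {f X} hf hX := by
    have h1 : MDiffAt (T% (fun y ↦ α y (X y))) x := hα.clm_bundle_apply hX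
    have h2 : (fun y ↦ α y ((f • X) y)) = f • (fun y ↦ α y (X y)) := by ext y; simp
    simp only [covExtDerivAux, h2, cV.isCovariantDerivativeOn.leibniz h1 hf,
      VectorField.mlieBracket_smul_left hf hX]
    simp
    module
  add {X X'} hX hX' := by
    have h1 : MDiffAt (T% (fun y ↦ α y (X y))) x := hα.clm_bundle_apply hX
    have h1' : MDiffAt (T% (fun y ↦ α y (X' y))) x := hα.clm_bundle_apply hX'
    have h2 : (fun y ↦ α y ((X + X') y)) = (fun y ↦ α y (X y)) + (fun y ↦ α y (X' y)) := by
      ext y; simp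
    simp only [covExtDerivAux, h2, cV.isCovariantDerivativeOn.add h1 h1',
      VectorField.mlieBracket_add_left hX hX']
    simp
    abel

theorem covExtDerivAux_tensorial' (cV : CovariantDerivative I F V)
    {α : Π x : M, TangentSpace I x →L[ℝ] V x} {x : M} (hα : MDiffAt (homSec E F α) x)
    (X : Π y : M, TangentSpace I y) :
    TensorialAt I E (covExtDerivAux cV α x X) x where
  smul {f Y} hf hY := by
    rw [covExtDerivAux_swap, (covExtDerivAux_tensorial cV hα X).smul hf hY,
      covExtDerivAux_swap cV α x X Y, smul_neg]
  add {Y Y'} hY hY' := by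
    rw [covExtDerivAux_swap, (covExtDerivAux_tensorial cV hα X).add hY hY',
      covExtDerivAux_swap cV α x X Y, covExtDerivAux_swap cV α x X Y', neg_add]

open scoped Classical in
/-- The covariant exterior derivative `d^∇ α` of a `V`-valued one-form `α`: the two-form with
`(d^∇ α)(X, Y) = ∇_X (α(Y)) - ∇_Y (α(X)) - α([X, Y])` for all vector fields `X`, `Y`. -/
def covExtDeriv (cV : CovariantDerivative I F V) (α : Π x : M, TangentSpace I x →L[ℝ] V x)
    (x : M) : TangentSpace I x →L[ℝ] TangentSpace I x →L[ℝ] V x :=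
  if hα : MDiffAt (homSec E F α) x then
    TensorialAt.mkHom₂ (covExtDerivAux cV α x) x
      (fun Y _ ↦ covExtDerivAux_tensorial cV hα Y) (fun X _ ↦ covExtDerivAux_tensorial' cV hα X)
  else 0

theorem covExtDeriv_add (cV : CovariantDerivative I F V)
    {α β : Π x : M, TangentSpace I x →L[ℝ] V x} {x : M}
    (hα : MDiffAt (homSec E F α) x) (hβ : MDiffAt (homSec E F β) x) :
    covExtDeriv cV (α + β) x = covExtDeriv cV α x + covExtDeriv cV β x := by
  have hadd : MDiffAt (homSec E F (α + β)) x := mdifferentiableAt_add_section hα hβ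
  rw [covExtDeriv, covExtDeriv, covExtDeriv, dif_pos hα, dif_pos hβ, dif_pos hadd]
  ext u v
  have key (w : TangentSpace I x) := cV.isCovariantDerivativeOn.add
    (hα.clm_bundle_apply (FiberBundle.mdifferentiableAt_extend I E w))
    (hβ.clm_bundle_apply (FiberBundle.mdifferentiableAt_extend I E w))
  have h2 (w : TangentSpace I x) : (fun y ↦ (α + β) y (FiberBundle.extend E w y)) =
      (fun y ↦ α y (FiberBundle.extend E w y)) + (fun y ↦ β y (FiberBundle.extend E w y)) := by
    ext y; simp
  simp only [add_apply, TensorialAt.mkHom₂_apply_eq_extend, covExtDerivAux]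
  rw [h2, h2, key, key]
  simp
  abel

theorem covExtDeriv_smul (cV : CovariantDerivative I F V)
    {α : Π x : M, TangentSpace I x →L[ℝ] V x} {x : M}
    (hα : MDiffAt (homSec E F α) x) (c : ℝ) :
    covExtDeriv cV (c • α) x = c • covExtDeriv cV α x := by
  have hsm : MDiffAt (homSec E F (c • α)) x :=
    MDifferentiableAt.smul_section (f := fun _ ↦ c) mdifferentiableAt_const hα
  rw [covExtDeriv, covExtDeriv, dif_pos hα, dif_pos hsm]
  ext u v
  have key (w : TangentSpace I x) := cV.isCovariantDerivativeOn.smul_const c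
    (hα.clm_bundle_apply (FiberBundle.mdifferentiableAt_extend I E w))
  have h2 (w : TangentSpace I x) : (fun y ↦ (c • α) y (FiberBundle.extend E w y)) =
      c • (fun y ↦ α y (FiberBundle.extend E w y)) := by
    ext y; simp
  simp only [smul_apply, TensorialAt.mkHom₂_apply_eq_extend, covExtDerivAux]
  rw [h2, h2, key, key]
  simp [smul_sub]

theorem covExtDeriv_congr (cV : CovariantDerivative I F V)
    {α β : Π x : M, TangentSpace I x →L[ℝ] V x} {x : M}
    (hα : MDiffAt (homSec E F α) x) (hβ : MDiffAt (homSec E F β) x)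
    (h : ∀ᶠ y in 𝓝 x, α y = β y) : covExtDeriv cV α x = covExtDeriv cV β x := by
  rw [covExtDeriv, covExtDeriv, dif_pos hα, dif_pos hβ]
  ext u v
  have key (w : TangentSpace I x) := cV.isCovariantDerivativeOnUniv.congr_of_eventuallyEq
    (hα.clm_bundle_apply (FiberBundle.mdifferentiableAt_extend I E w))
    (hβ.clm_bundle_apply (FiberBundle.mdifferentiableAt_extend I E w)) Filter.univ_mem
    (h.mono fun y hy ↦ by rw [hy])
  simp only [TensorialAt.mkHom₂_apply_eq_extend, covExtDerivAux]
  rw [key, key, h.self_of_nhds]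

/-- A connection of class `C^∞` maps sections that are smooth near a point to one-forms that are
differentiable at this point. -/
theorem mdifferentiableAt_cov [T2Space M] (cV : CovariantDerivative I F V)
    [cV.ContMDiffCovariantDerivative ∞] {s : Π x, V x} {x : M} {u : Set M} (hu : u ∈ 𝓝 x)
    (hs : CMDiff[u] ∞ (T% s)) : MDiffAt (homSec E F (cV s)) x := by
  obtain ⟨t, htu, hto, hxt⟩ := mem_nhds_iff.1 hu
  obtain ⟨ψ, hψt, -⟩ := (SmoothBumpFunction.nhds_basis_support (I := I)
    (hto.mem_nhds hxt)).mem_iff.1 (hto.mem_nhds hxt)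
  have h1 : CMDiff ∞ (T% ((ψ : M → ℝ) • s)) :=
    ContMDiffOn.smul_section_of_tsupport ψ.contMDiff.contMDiffOn hto hψt (hs.mono htu)
  have h2 := (CovariantDerivative.ContMDiffCovariantDerivative.contMDiff
    (cov := cV) (k := ∞)).contMDiff (by simpa using h1.contMDiffOn)
  have h3 : MDiffAt (homSec E F (cV ((ψ : M → ℝ) • s))) x :=
    ((h2 x trivial).contMDiffAt Filter.univ_mem).mdifferentiableAt (by simp)
  refine h3.congr_of_eventuallyEq ?_
  filter_upwards [ψ.eventuallyEq_one.eventuallyEq_nhds, hto.mem_nhds hxt] with y hy hyt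
  have e : cV s y = cV ((ψ : M → ℝ) • s) y := by
    refine cV.isCovariantDerivativeOnUniv.congr_of_eventuallyEq
      (((hs.mono htu).contMDiffAt (hto.mem_nhds hyt)).mdifferentiableAt (by simp))
      ((h1 y).mdifferentiableAt (by simp)) Filter.univ_mem ?_
    filter_upwards [hy] with z hz
    simp [hz]
  simp [homSec, e]

section Curvature
variable [T2Space M]

theorem mdifferentiableAt_cov_extend (cV : CovariantDerivative I F V)
    [cV.ContMDiffCovariantDerivative ∞] {x : M} (s : V x) :
    MDiffAt (homSec E F (cV (FiberBundle.extend F s))) x := by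
  obtain ⟨u, hu, hs⟩ := FiberBundle.exists_contMDiffOn_extend (k := ∞) I F s
  exact mdifferentiableAt_cov cV hu hs

theorem eventually_mdifferentiableAt_extend {x : M} (s : V x) :
    ∀ᶠ y in 𝓝 x, MDiffAt (T% (FiberBundle.extend F s)) y := by
  obtain ⟨u, hu, hs⟩ := FiberBundle.exists_contMDiffOn_extend (k := ∞) I F s
  filter_upwards [eventually_mem_nhds_iff.2 hu] with y hy
  exact (hs.contMDiffAt hy).mdifferentiableAt (by simp)

theorem eventually_extend_add {x : M} (s t : V x) :
    ∀ᶠ y in 𝓝 x, FiberBundle.extend F (s + t) y =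
      (FiberBundle.extend F s + FiberBundle.extend F t) y := by
  have hx := FiberBundle.mem_baseSet_trivializationAt F V x
  filter_upwards [(trivializationAt F V x).open_baseSet.mem_nhds hx] with y hy
  have h := ((trivializationAt F V x).linear ℝ hx).map_add s t
  simp only [FiberBundle.extend, h, Pi.add_apply]
  simp only [← Trivialization.symmₗ_apply (R := ℝ) _ hy, map_add]

theorem eventually_extend_smul {x : M} (c : ℝ) (s : V x) :
    ∀ᶠ y in 𝓝 x, FiberBundle.extend F (c • s) y = (c • FiberBundle.extend F s) y := by
  have hx := FiberBundle.mem_baseSet_trivializationAt F V x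
  filter_upwards [(trivializationAt F V x).open_baseSet.mem_nhds hx] with y hy
  have h := ((trivializationAt F V x).linear ℝ hx).map_smul c s
  simp only [FiberBundle.extend, h, Pi.smul_apply]
  simp only [← Trivialization.symmₗ_apply (R := ℝ) _ hy, map_smul]

/-- The curvature of a smooth connection: `F(u, v) s = (d^∇ (∇ s))(u, v)`, that is,
`F(X, Y) s = ∇_X ∇_Y s - ∇_Y ∇_X s - ∇_[X, Y] s`. -/
def curvature (cV : CovariantDerivative I F V) [cV.ContMDiffCovariantDerivative ∞] (x : M) :
    TangentSpace I x →L[ℝ] TangentSpace I x →L[ℝ] V x →L[ℝ] V x :=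
  have : T2Space (V x) := FiberBundle.t2Space F V x
  have : FiniteDimensional ℝ (V x) := VectorBundle.finiteDimensional ℝ F V x
  have : FiniteDimensional ℝ (TangentSpace I x) := inferInstanceAs (FiniteDimensional ℝ E)
  have : T2Space (TangentSpace I x) := inferInstanceAs (T2Space E)
  LinearMap.toContinuousBilinearMap (LinearMap.mk₂ ℝ
    (fun u v ↦ LinearMap.toContinuousLinearMap
      { toFun s := covExtDeriv cV (cV (FiberBundle.extend F s)) x u v
        map_add' s t := by
          have hs := mdifferentiableAt_cov_extend cV s
          have ht := mdifferentiableAt_cov_extend cV t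
          rw [← add_apply, ← add_apply, ← covExtDeriv_add cV hs ht]
          rw [covExtDeriv_congr cV (mdifferentiableAt_cov_extend cV (s + t))
            (mdifferentiableAt_add_section hs ht)]
          filter_upwards [eventually_mdifferentiableAt_extend (I := I) (F := F) s,
            eventually_mdifferentiableAt_extend (I := I) (F := F) t,
            eventually_mdifferentiableAt_extend (I := I) (F := F) (s + t),
            (eventually_extend_add (F := F) s t).eventually_nhds] with y hy hy' hy'' he
          rw [cV.isCovariantDerivativeOnUniv.congr_of_eventuallyEq hy''
            (mdifferentiableAt_add_section hy hy') Filter.univ_mem he]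
          exact cV.isCovariantDerivativeOn.add hy hy'
        map_smul' c s := by
          have hs := mdifferentiableAt_cov_extend cV s
          dsimp only [RingHom.id_apply]
          rw [← smul_apply, ← smul_apply, ← covExtDeriv_smul cV hs c]
          rw [covExtDeriv_congr cV (mdifferentiableAt_cov_extend cV (c • s))
            (β := c • cV (FiberBundle.extend F s))
            (MDifferentiableAt.smul_section (f := fun _ ↦ c) mdifferentiableAt_const hs)]
          filter_upwards [eventually_mdifferentiableAt_extend (I := I) (F := F) s,
            eventually_mdifferentiableAt_extend (I := I) (F := F) (c • s),
            (eventually_extend_smul (F := F) c s).eventually_nhds] with y hy hy' he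
          rw [cV.isCovariantDerivativeOnUniv.congr_of_eventuallyEq hy'
            (MDifferentiableAt.smul_section (f := fun _ ↦ c) mdifferentiableAt_const hy)
            Filter.univ_mem he]
          exact cV.isCovariantDerivativeOn.smul_const c hy })
    (fun u u' v ↦ by ext s; simp) (fun c u v ↦ by ext s; simp)
    (fun u v v' ↦ by ext s; simp) (fun c u v ↦ by ext s; simp))
end Curvature

end Connections
section LeviCivita
variable
  {E : Type*} [NormedAddCommGroup E] [NormedSpace ℝ E] [FiniteDimensional ℝ E]
  {H : Type*} [TopologicalSpace H] (I : ModelWithCorners ℝ E H)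
  {M : Type*} [TopologicalSpace M] [ChartedSpace H M] [IsManifold I ∞ M]
  [RiemannianBundle (fun x : M ↦ TangentSpace I x)]
  [IsContMDiffRiemannianBundle I ∞ E (fun x : M ↦ TangentSpace I x)]

instance finiteDimensional_tangentSpace (x : M) : FiniteDimensional ℝ (TangentSpace I x) :=
  inferInstanceAs (FiniteDimensional ℝ E)

/-- The right-hand side of the Koszul formula for `⟨∇_X Y, Z⟩`. -/
def koszul (x : M) (Y X Z : Π y : M, TangentSpace I y) : ℝ :=
  (1 / 2) * (mvfderiv I (fun y ↦ inner ℝ (Y y) (Z y)) x (X x)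
    + mvfderiv I (fun y ↦ inner ℝ (X y) (Z y)) x (Y x)
    - mvfderiv I (fun y ↦ inner ℝ (X y) (Y y)) x (Z x)
    + inner ℝ (VectorField.mlieBracket I X Y x) (Z x)
    - inner ℝ (VectorField.mlieBracket I X Z x) (Y x)
    - inner ℝ (VectorField.mlieBracket I Y Z x) (X x))

variable {I}

theorem mdiffAt_inner {x : M} {X Y : Π y : M, TangentSpace I y}
    (hX : MDiffAt (T% X) x) (hY : MDiffAt (T% Y) x) :
    MDiffAt (fun y ↦ inner ℝ (X y) (Y y)) x :=
  MDifferentiableAt.inner_bundle (F := E) (E := fun x : M ↦ TangentSpace I x) (IB := I)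
    (b := fun y ↦ y) hX hY

theorem koszul_tensorial_X {x : M} {Y Z : Π y : M, TangentSpace I y}
    (hY : MDiffAt (T% Y) x) (hZ : MDiffAt (T% Z) x) :
    TensorialAt I E (fun X ↦ koszul I x Y X Z) x where
  smul {f X} hf hX := by
    have h1 := mvfderiv_fun_mul hf (mdiffAt_inner hX hZ)
    have h2 := mvfderiv_fun_mul hf (mdiffAt_inner hX hY)
    simp [koszul, inner_smul_left, inner_smul_right, h1, h2,
      VectorField.mlieBracket_smul_left hf hX,
      inner_add_left]
    ring
  add {X X'} hX hX' := by
    have h1 := mvfderiv_fun_add (mdiffAt_inner hX hZ) (mdiffAt_inner hX' hZ)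
    have h2 := mvfderiv_fun_add (mdiffAt_inner hX hY) (mdiffAt_inner hX' hY)
    simp [koszul, h1, h2, VectorField.mlieBracket_add_left hX hX', inner_add_left,
      inner_add_right]
    ring

theorem koszul_tensorial_Z {x : M} {Y X : Π y : M, TangentSpace I y}
    (hY : MDiffAt (T% Y) x) (hX : MDiffAt (T% X) x) :
    TensorialAt I E (koszul I x Y X) x where
  smul {f Z} hf hZ := by
    have h1 := mvfderiv_fun_mul hf (mdiffAt_inner hX hZ)
    have h2 := mvfderiv_fun_mul hf (mdiffAt_inner hY hZ)
    simp [koszul, inner_smul_left, inner_smul_right, h1, h2,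
      VectorField.mlieBracket_smul_right hf hZ, inner_add_left, real_inner_comm]
    ring
  add {Z Z'} hZ hZ' := by
    have h1 := mvfderiv_fun_add (mdiffAt_inner hX hZ) (mdiffAt_inner hX hZ')
    have h2 := mvfderiv_fun_add (mdiffAt_inner hY hZ) (mdiffAt_inner hY hZ')
    simp [koszul, h1, h2, VectorField.mlieBracket_add_right hZ hZ', inner_add_left,
      inner_add_right]
    ring

theorem koszul_add {x : M} {Y Y' X Z : Π y : M, TangentSpace I y} (hY : MDiffAt (T% Y) x)
    (hY' : MDiffAt (T% Y') x) (hX : MDiffAt (T% X) x) (hZ : MDiffAt (T% Z) x) :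
    koszul I x (Y + Y') X Z = koszul I x Y X Z + koszul I x Y' X Z := by
  have h1 := mvfderiv_fun_add (mdiffAt_inner hY hZ) (mdiffAt_inner hY' hZ)
  have h2 := mvfderiv_fun_add (mdiffAt_inner hX hY) (mdiffAt_inner hX hY')
  simp [koszul, h1, h2, VectorField.mlieBracket_add_right hY hY',
    VectorField.mlieBracket_add_left hY hY', inner_add_left, inner_add_right]
  ring

theorem koszul_smul {x : M} {f : M → ℝ} {Y X Z : Π y : M, TangentSpace I y}
    (hf : MDiffAt f x) (hY : MDiffAt (T% Y) x) (hX : MDiffAt (T% X) x) (hZ : MDiffAt (T% Z) x) :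
    koszul I x (f • Y) X Z = f x * koszul I x Y X Z
      + mvfderiv I f x (X x) * inner ℝ (Y x) (Z x) := by
  have h1 := mvfderiv_fun_mul hf (mdiffAt_inner hY hZ)
  have h2 := mvfderiv_fun_mul hf (mdiffAt_inner hX hY)
  simp [koszul, h1, h2, VectorField.mlieBracket_smul_right hf hY, inner_smul_left,
    inner_smul_right, VectorField.mlieBracket_smul_left hf hY, inner_add_left, inner_add_right]
  rw [real_inner_comm (X x) (Y x)]
  ring

open scoped Classical in
/-- The bilinear form `(u, w) ↦ ⟨∇_u Y, w⟩` given by the Koszul formula. -/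
def koszulForm (Y : Π y : M, TangentSpace I y) (x : M) :
    TangentSpace I x →L[ℝ] TangentSpace I x →L[ℝ] ℝ :=
  if hY : MDiffAt (T% Y) x then
    TensorialAt.mkHom₂ (koszul I x Y) x
      (fun _ hZ ↦ koszul_tensorial_X hY hZ) (fun _ hX ↦ koszul_tensorial_Z hY hX)
  else 0

variable (I M) in
/-- The Levi-Civita connection, defined by the Koszul formula. -/
def leviCivita : CovariantDerivative I E (fun x : M ↦ TangentSpace I x) where
  toFun Y x := ∑ i, ((ContinuousLinearMap.apply ℝ ℝ
    (stdOrthonormalBasis ℝ (TangentSpace I x) i)).comp (koszulForm Y x)).smulRight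
      (stdOrthonormalBasis ℝ (TangentSpace I x) i)
  isCovariantDerivativeOnUniv :=
    { add := by
        intro Y Y' x hY hY' _
        have h := mdifferentiableAt_add_section hY hY'
        rw [← Finset.sum_add_distrib]
        refine Finset.sum_congr rfl fun i _ ↦ ?_
        ext u
        rw [koszulForm, dif_pos h, koszulForm, dif_pos hY, koszulForm, dif_pos hY']
        simp [TensorialAt.mkHom₂_apply_eq_extend]
        rw [koszul_add hY hY' (FiberBundle.mdifferentiableAt_extend ..)
          (FiberBundle.mdifferentiableAt_extend ..), add_smul]
      leibniz := by
        intro Y f x hY hf _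
        have h := hf.smul_section hY
        have e : (mvfderiv I f x).smulRight (Y x) =
          ∑ i, (mvfderiv I f x).smulRight
            (inner ℝ (stdOrthonormalBasis ℝ (TangentSpace I x) i) (Y x) •
              stdOrthonormalBasis ℝ (TangentSpace I x) i) := by
          ext u
          simp only [ContinuousLinearMap.smulRight_apply, sum_apply]
          rw [← Finset.smul_sum, OrthonormalBasis.sum_repr']
        rw [e, Finset.smul_sum, ← Finset.sum_add_distrib]
        refine Finset.sum_congr rfl fun i _ ↦ ?_
        ext u
        rw [koszulForm, dif_pos h, koszulForm, dif_pos hY]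
        simp [TensorialAt.mkHom₂_apply_eq_extend]
        rw [koszul_smul hf hY (FiberBundle.mdifferentiableAt_extend ..)
          (FiberBundle.mdifferentiableAt_extend ..)]
        simp [real_inner_comm]
        module }

/-- The Koszul formula. -/
theorem inner_leviCivita {x : M} {X Y Z : Π y : M, TangentSpace I y} (hX : MDiffAt (T% X) x)
    (hY : MDiffAt (T% Y) x) (hZ : MDiffAt (T% Z) x) :
    inner ℝ (leviCivita I M Y x (X x)) (Z x) = koszul I x Y X Z := by
  have h : koszulForm Y x (X x) (Z x) = koszul I x Y X Z := by
    rw [koszulForm, dif_pos hY]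
    exact TensorialAt.mkHom₂_apply _ _ hX hZ
  rw [← h]
  conv_rhs => rw [← OrthonormalBasis.sum_repr' (stdOrthonormalBasis ℝ (TangentSpace I x)) (Z x)]
  simp [leviCivita, sum_inner, inner_smul_left, mul_comm]

theorem leviCivita_torsion : (leviCivita I M).torsion = 0 := by
  rw [CovariantDerivative.torsion_eq_zero_iff]
  intro X Y x hX hY
  refine ext_inner_right ℝ fun w ↦ ?_
  have hZ := FiberBundle.mdifferentiableAt_extend I E w
  rw [← FiberBundle.extend_apply_self (F := E) w, inner_sub_left, inner_leviCivita hX hY hZ,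
    inner_leviCivita hY hX hZ, koszul, koszul, VectorField.mlieBracket_swap_apply (V := Y) (W := X)]
  simp [real_inner_comm]
  ring

theorem leviCivita_isMetricCompatible :
    CovariantDerivative.IsMetricCompatible (V := fun x : M ↦ TangentSpace I x) (leviCivita I M) := by
  rw [CovariantDerivative.isMetricCompatible_iff]
  intro x X Y Z hX hY hZ
  simp only
  rw [inner_leviCivita hX hY hZ, real_inner_comm, inner_leviCivita hX hZ hY, koszul, koszul,
    VectorField.mlieBracket_swap_apply (V := Z)]
  simp [real_inner_comm]
  ring
end LeviCivita
section Gauge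

/-- The sum `∑ i, q (f e_i)` over an orthonormal basis `(e_i)`: the squared norm of a linear map
`f : T → W` when `q` is the squared norm of `W`. -/
def frobSq {T : Type*} [NormedAddCommGroup T] [InnerProductSpace ℝ T] [FiniteDimensional ℝ T]
    {W : Type*} (q : W → ℝ) (f : T → W) : ℝ :=
  ∑ i, q (f (stdOrthonormalBasis ℝ T i))

instance fact_finrank_tangentSpace {n : ℕ} {M : Type*} [TopologicalSpace M]
    [ChartedSpace (EuclideanSpace ℝ (Fin n)) M] (x : M) :
    Fact (Module.finrank ℝ (TangentSpace (𝓡 n) x) = n) :=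
  ⟨finrank_euclideanSpace_fin (𝕜 := ℝ)⟩

/-- A family of orientations of the tangent spaces is an orientation of the Riemannian manifold if
its Riemannian volume form is smooth. -/
def IsSmoothOrientation {n : ℕ} {M : Type*} [TopologicalSpace M]
    [ChartedSpace (EuclideanSpace ℝ (Fin n)) M] [IsManifold (𝓡 n) ∞ M]
    [RiemannianBundle (fun x : M ↦ TangentSpace (𝓡 n) x)]
    (o : Π x : M, Orientation ℝ (TangentSpace (𝓡 n) x) (Fin n)) : Prop :=
  ∀ (X : Fin n → Π x : M, TangentSpace (𝓡 n) x) (x : M),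
    (∀ i, ContMDiffAt (𝓡 n) (𝓡 n).tangent ∞
      (fun y ↦ (⟨y, X i y⟩ : TangentBundle (𝓡 n) M)) x) →
    ContMDiffAt (𝓡 n) 𝓘(ℝ, ℝ) ∞ (fun y ↦ (o y).volumeForm (fun i ↦ X i y)) x

section HodgeStar
variable {T : Type*} [NormedAddCommGroup T] [InnerProductSpace ℝ T] [FiniteDimensional ℝ T]
  {W : Type*} [AddCommGroup W] [Module ℝ W] [TopologicalSpace W]
  [IsTopologicalAddGroup W] [ContinuousSMul ℝ W]

/-- The Hodge star of a `W`-valued two-form in dimension three: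
`(*β)(u) = (1/2) ∑ i j, vol(e_i, e_j, u) β(e_i, e_j)` for an orthonormal basis `(e_i)`. -/
def hodgeStarThree [Fact (Module.finrank ℝ T = 3)] (o : Orientation ℝ T (Fin 3))
    (β : T →L[ℝ] T →L[ℝ] W) : T →L[ℝ] W :=
  LinearMap.toContinuousLinearMap
    { toFun u := (1 / 2 : ℝ) • ∑ i, ∑ j,
        o.volumeForm ![stdOrthonormalBasis ℝ T i, stdOrthonormalBasis ℝ T j, u] •
          β (stdOrthonormalBasis ℝ T i) (stdOrthonormalBasis ℝ T j)
      map_add' u v := by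
        have h (a b : T) : o.volumeForm ![a, b, u + v] =
            o.volumeForm ![a, b, u] + o.volumeForm ![a, b, v] :=
          congrArg (· ![]) (map_add ((o.volumeForm.curryLeft a).curryLeft b).curryLeft u v)
        simp only [h, add_smul, Finset.sum_add_distrib, smul_add]
      map_smul' c u := by
        have h (a b : T) : o.volumeForm ![a, b, c • u] = c * o.volumeForm ![a, b, u] :=
          congrArg (· ![]) (map_smul ((o.volumeForm.curryLeft a).curryLeft b).curryLeft c u)
        simp only [h, mul_smul, ← Finset.smul_sum, RingHom.id_apply]
        rw [smul_comm] }

/-- The Hodge star of a `W`-valued two-form in dimension four: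
`(*β)(u, v) = (1/2) ∑ i j, vol(e_i, e_j, u, v) β(e_i, e_j)` for an orthonormal basis `(e_i)`. -/
def hodgeStarFour [Fact (Module.finrank ℝ T = 4)] (o : Orientation ℝ T (Fin 4))
    (β : T →L[ℝ] T →L[ℝ] W) : T →L[ℝ] T →L[ℝ] W :=
  LinearMap.toContinuousBilinearMap (LinearMap.mk₂ ℝ
    (fun u v ↦ (1 / 2 : ℝ) • ∑ i, ∑ j,
      o.volumeForm ![stdOrthonormalBasis ℝ T i, stdOrthonormalBasis ℝ T j, u, v] •
        β (stdOrthonormalBasis ℝ T i) (stdOrthonormalBasis ℝ T j))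
    (fun u u' v ↦ by
      have h (a b : T) : o.volumeForm ![a, b, u + u', v] =
          o.volumeForm ![a, b, u, v] + o.volumeForm ![a, b, u', v] :=
        congrArg (· ![v]) (map_add ((o.volumeForm.curryLeft a).curryLeft b).curryLeft u u')
      simp only [h, add_smul, Finset.sum_add_distrib, smul_add])
    (fun c u v ↦ by
      have h (a b : T) : o.volumeForm ![a, b, c • u, v] = c * o.volumeForm ![a, b, u, v] :=
        congrArg (· ![v]) (map_smul ((o.volumeForm.curryLeft a).curryLeft b).curryLeft c u)
      simp only [h, mul_smul, ← Finset.smul_sum]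
      rw [smul_comm])
    (fun u v v' ↦ by
      have h (a b : T) : o.volumeForm ![a, b, u, v + v'] =
          o.volumeForm ![a, b, u, v] + o.volumeForm ![a, b, u, v'] :=
        congrArg (· ![])
          (map_add (((o.volumeForm.curryLeft a).curryLeft b).curryLeft u).curryLeft v v')
      simp only [h, add_smul, Finset.sum_add_distrib, smul_add])
    (fun c u v ↦ by
      have h (a b : T) : o.volumeForm ![a, b, u, c • v] = c * o.volumeForm ![a, b, u, v] :=
        congrArg (· ![])
          (map_smul (((o.volumeForm.curryLeft a).curryLeft b).curryLeft u).curryLeft c v)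
      simp only [h, mul_smul, ← Finset.smul_sum]
      rw [smul_comm]))

/-- `β^± = (1/2) (β ± *β)` for the sign `ε = ±1`. -/
def dualPart [Fact (Module.finrank ℝ T = 4)] (o : Orientation ℝ T (Fin 4)) (ε : ℝ)
    (β : T →L[ℝ] T →L[ℝ] W) : T →L[ℝ] T →L[ℝ] W :=
  (1 / 2 : ℝ) • (β + ε • hodgeStarFour o β)

/-- `*β ± α` for the sign `ε = ±1`. -/
def starAdd [Fact (Module.finrank ℝ T = 3)] (o : Orientation ℝ T (Fin 3)) (ε : ℝ)
    (β : T →L[ℝ] T →L[ℝ] W) (α : T →L[ℝ] W) : T →L[ℝ] W :=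
  hodgeStarThree o β + ε • α

/-- The (anti-)self-duality equation `*β = ±β` for the sign `ε = ±1`. -/
def IsDual [Fact (Module.finrank ℝ T = 4)] (o : Orientation ℝ T (Fin 4)) (ε : ℝ)
    (β : T →L[ℝ] T →L[ℝ] W) : Prop :=
  hodgeStarFour o β = ε • β

/-- The Bogomolny equation `*β = ±α` for the sign `ε = ±1`. -/
def IsBogomolny [Fact (Module.finrank ℝ T = 3)] (o : Orientation ℝ T (Fin 3)) (ε : ℝ)
    (β : T →L[ℝ] T →L[ℝ] W) (α : T →L[ℝ] W) : Prop :=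
  hodgeStarThree o β = ε • α

end HodgeStar

section Forms
variable
  {E : Type*} [NormedAddCommGroup E] [NormedSpace ℝ E] [FiniteDimensional ℝ E]
  {H : Type*} [TopologicalSpace H] {I : ModelWithCorners ℝ E H}
  {M : Type*} [TopologicalSpace M] [ChartedSpace H M] [IsManifold I ∞ M]
  [RiemannianBundle (fun x : M ↦ TangentSpace I x)]

/-- The squared norm of a `W`-valued one-form at a point, `∑ i, |α(e_i)|²`, where `q` is the
squared norm of `W`. -/
def oneFormNormSq {W : Type*} (q : W → ℝ) {x : M} (α : TangentSpace I x → W) : ℝ :=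
  frobSq q α

/-- The squared norm of a `W`-valued two-form at a point, `∑ i < j, |β(e_i, e_j)|²`, where `q` is
the squared norm of `W`. -/
def twoFormNormSq {W : Type*} (q : W → ℝ) {x : M}
    (β : TangentSpace I x → TangentSpace I x → W) : ℝ :=
  (1 / 2) * frobSq (frobSq q) β

variable [IsContMDiffRiemannianBundle I ∞ E (fun x : M ↦ TangentSpace I x)]
  {G : Type*} [NormedAddCommGroup G] [NormedSpace ℝ G]
  {W : M → Type*} [TopologicalSpace (TotalSpace G W)]
  [∀ x, AddCommGroup (W x)] [∀ x, Module ℝ (W x)] [∀ x, TopologicalSpace (W x)]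
  [∀ x, IsTopologicalAddGroup (W x)] [∀ x, ContinuousSMul ℝ (W x)]
  [FiberBundle G W] [VectorBundle ℝ G W]

/-- The tensor product of the Levi-Civita connection and of a connection on `W`, on the bundle of
`W`-valued one-forms. -/
def oneFormConnection (c : CovariantDerivative I G W) :
    CovariantDerivative I (E →L[ℝ] G) (fun x : M ↦ TangentSpace I x →L[ℝ] W x) :=
  homConnection (leviCivita I M) c

/-- The tensor product of the Levi-Civita connection and of a connection on `W`, on the bundle of
`W`-valued bilinear forms on the tangent spaces. -/
def twoFormConnection (c : CovariantDerivative I G W) :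
    CovariantDerivative I (E →L[ℝ] E →L[ℝ] G)
      (fun x : M ↦ TangentSpace I x →L[ℝ] TangentSpace I x →L[ℝ] W x) :=
  homConnection (leviCivita I M) (oneFormConnection c)

/-- The covariant codifferential of a one-form: `(d^∇)^* α = - ∑ i, (∇_{e_i} α)(e_i)`. -/
def codiffOne (c : CovariantDerivative I G W) (α : Π x : M, TangentSpace I x →L[ℝ] W x) (x : M) :
    W x :=
  -∑ i, oneFormConnection c α x (stdOrthonormalBasis ℝ (TangentSpace I x) i)
    (stdOrthonormalBasis ℝ (TangentSpace I x) i)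

/-- The covariant codifferential of a two-form: `((d^∇)^* β)(v) = - ∑ i, (∇_{e_i} β)(e_i, v)`. -/
def codiffTwo (c : CovariantDerivative I G W)
    (β : Π x : M, TangentSpace I x →L[ℝ] TangentSpace I x →L[ℝ] W x) (x : M) :
    TangentSpace I x →L[ℝ] W x :=
  -∑ i, twoFormConnection c β x (stdOrthonormalBasis ℝ (TangentSpace I x) i)
    (stdOrthonormalBasis ℝ (TangentSpace I x) i)

end Forms

section YangMills
variable
  {E : Type*} [NormedAddCommGroup E] [NormedSpace ℝ E] [FiniteDimensional ℝ E]
  {H : Type*} [TopologicalSpace H] {I : ModelWithCorners ℝ E H}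
  {M : Type*} [TopologicalSpace M] [ChartedSpace H M] [IsManifold I ∞ M]
  {F : Type*} [NormedAddCommGroup F] [NormedSpace ℝ F] [FiniteDimensional ℝ F]
  {V : M → Type*} [TopologicalSpace (TotalSpace F V)]
  [∀ x, NormedAddCommGroup (V x)] [∀ x, InnerProductSpace ℝ (V x)]
  [FiberBundle F V] [VectorBundle ℝ F V]

variable (F) in
/-- The squared norm of an endomorphism of a fibre of `V`, for the inner product
`⟨A, B⟩ = tr (Aᵀ B)`. -/
def endNormSq {x : M} (A : V x →L[ℝ] V x) : ℝ :=
  have : FiniteDimensional ℝ (V x) := VectorBundle.finiteDimensional ℝ F V x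
  frobSq (fun w ↦ ‖w‖ ^ 2) A

variable [ContMDiffVectorBundle ∞ F V I]

/-- The connection on `End(V)` induced by a connection on `V`. -/
def endConnection (A : CovariantDerivative I F V) :
    CovariantDerivative I (F →L[ℝ] F) (fun x ↦ V x →L[ℝ] V x) :=
  homConnection A A

/-- The bracket `[α, Φ]` of an `End(V)`-valued one-form and a section of `End(V)`. -/
def bracketOne {x : M} (α : TangentSpace I x →L[ℝ] V x →L[ℝ] V x) (Φ : V x →L[ℝ] V x)
    (u : TangentSpace I x) : V x →L[ℝ] V x :=
  α u ∘L Φ - Φ ∘L α u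

variable [RiemannianBundle (fun x : M ↦ TangentSpace I x)]
  [IsContMDiffRiemannianBundle I ∞ E (fun x : M ↦ TangentSpace I x)] [T2Space M]

/-- The Yang-Mills equation `(d^∇)^* F = 0`. -/
def IsYangMills (A : CovariantDerivative I F V) [A.ContMDiffCovariantDerivative ∞] : Prop :=
  ∀ x, codiffTwo (endConnection A) (curvature A) x = 0

/-- The Yang-Mills-Higgs equations `(d^∇)^* F = [∇Φ, Φ]` and `(d^∇)^* ∇Φ = 0` for a connection `A`
and a smooth section `Φ` of the bundle of skew-symmetric endomorphisms. -/
structure IsYangMillsHiggs (A : CovariantDerivative I F V) [A.ContMDiffCovariantDerivative ∞]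
    (Φ : Π x : M, V x →L[ℝ] V x) : Prop where
  smooth : ContMDiff I (I.prod 𝓘(ℝ, F →L[ℝ] F)) ∞ (homSec F F Φ)
  skew : ∀ (x : M) (s t : V x), inner ℝ (Φ x s) t = - inner ℝ s (Φ x t)
  codiff_curvature : ∀ (x : M) (u : TangentSpace I x),
    codiffTwo (endConnection A) (curvature A) x u = bracketOne (endConnection A Φ x) (Φ x) u
  codiff_higgs : ∀ x, codiffOne (endConnection A) (endConnection A Φ) x = 0

end YangMills

end Gauge

end GaugeKato

end

namespace GaugeKato

section Sections
variable
  {E : Type*} [NormedAddCommGroup E] [NormedSpace ℝ E] [FiniteDimensional ℝ E]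
  {H : Type*} [TopologicalSpace H] {I : ModelWithCorners ℝ E H}
  {M : Type*} [TopologicalSpace M] [ChartedSpace H M] [IsManifold I ∞ M]
  {F : Type*} [NormedAddCommGroup F] [NormedSpace ℝ F] [FiniteDimensional ℝ F]
  {V : M → Type*} [TopologicalSpace (TotalSpace F V)]
  [∀ x, AddCommGroup (V x)] [∀ x, Module ℝ (V x)] [∀ x, TopologicalSpace (V x)]
  [∀ x, IsTopologicalAddGroup (V x)] [∀ x, ContinuousSMul ℝ (V x)]
  [FiberBundle F V] [VectorBundle ℝ F V] [ContMDiffVectorBundle ∞ F V I]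
  {G : Type*} [NormedAddCommGroup G] [NormedSpace ℝ G]
  {W : M → Type*} [TopologicalSpace (TotalSpace G W)]
  [∀ x, AddCommGroup (W x)] [∀ x, Module ℝ (W x)] [∀ x, TopologicalSpace (W x)]
  [∀ x, IsTopologicalAddGroup (W x)] [∀ x, ContinuousSMul ℝ (W x)]
  [FiberBundle G W] [VectorBundle ℝ G W]

/-- A section that is smooth near a point agrees near this point with a smooth section. -/
theorem exists_contMDiff_section_eventuallyEq [T2Space M] {s : Π x, V x} {x : M} {u : Set M}
    (hu : u ∈ 𝓝 x) (hs : CMDiff[u] ∞ (T% s)) :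
    ∃ S : Π x, V x, CMDiff ∞ (T% S) ∧ ∀ᶠ y in 𝓝 x, S y = s y := by
  obtain ⟨t, htu, hto, hxt⟩ := mem_nhds_iff.1 hu
  obtain ⟨ψ, hψt, -⟩ := (SmoothBumpFunction.nhds_basis_support (I := I)
    (hto.mem_nhds hxt)).mem_iff.1 (hto.mem_nhds hxt)
  refine ⟨(ψ : M → ℝ) • s,
    ContMDiffOn.smul_section_of_tsupport ψ.contMDiff.contMDiffOn hto hψt (hs.mono htu), ?_⟩
  filter_upwards [ψ.eventuallyEq_one] with y hy
  simp [hy]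

theorem exists_contMDiff_extend [T2Space M] (x : M) (v : V x) :
    ∃ S : Π x, V x, CMDiff ∞ (T% S) ∧ S x = v ∧
      ∀ᶠ y in 𝓝 x, S y = FiberBundle.extend F v y := by
  obtain ⟨u, hu, hs⟩ := FiberBundle.exists_contMDiffOn_extend (k := ∞) I F v
  obtain ⟨S, hS, h⟩ := exists_contMDiff_section_eventuallyEq hu hs
  exact ⟨S, hS, by simpa using h.self_of_nhds, h⟩

/-- Differentiability of a section at a point. -/
abbrev MDiffSecAt (I : ModelWithCorners ℝ E H) (G : Type*) [NormedAddCommGroup G]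
    [NormedSpace ℝ G] {W : M → Type*} [TopologicalSpace (TotalSpace G W)]
    [∀ x, TopologicalSpace (W x)] [FiberBundle G W] (s : Π x, W x) (x : M) : Prop :=
  MDifferentiableAt I (I.prod 𝓘(ℝ, G)) (fun y ↦ (⟨y, s y⟩ : TotalSpace G W)) x

theorem mdifferentiableAt_congr_section {s t : Π x, W x} {x : M} (hs : MDiffAt (T% s) x)
    (h : ∀ᶠ y in 𝓝 x, t y = s y) : MDiffAt (T% t) x :=
  hs.congr_of_eventuallyEq (h.mono fun y hy ↦ by simp [hy])

/-- A section of `Hom(V, W)` is differentiable at a point if its values on smooth sections are. -/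
theorem mdifferentiableAt_homSec [T2Space M] {Ψ : Π x, V x →L[ℝ] W x} {x : M}
    (h : ∀ s : Π x, V x, CMDiff ∞ (T% s) → MDiffAt (T% (fun y ↦ Ψ y (s y))) x) :
    MDiffAt (homSec F G Ψ) x := by
  rw [mdifferentiableAt_hom_bundle]
  refine ⟨mdifferentiableAt_id, ?_⟩
  simp only
  set eV := trivializationAt F V x
  have hxV : x ∈ eV.baseSet := FiberBundle.mem_baseSet_trivializationAt F V x
  set eW := trivializationAt G W x
  have hxW : x ∈ eW.baseSet := FiberBundle.mem_baseSet_trivializationAt G W x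
  set b := Module.finBasis ℝ F
  have key (v : F) : MDiffAt (fun y ↦ ContinuousLinearMap.inCoordinates F V G W x y x y (Ψ y) v) x := by
    obtain ⟨S, hS, -, hSe⟩ := exists_contMDiff_extend (I := I) (F := F) x (eV.symm x v)
    have h1 := (mdifferentiableAt_section I _).1 (h S hS)
    refine h1.congr_of_eventuallyEq ?_
    filter_upwards [eV.open_baseSet.mem_nhds hxV, eW.open_baseSet.mem_nhds hxW, hSe] with y hy hy' he
    rw [ContinuousLinearMap.inCoordinates_eq hy hy']
    simp [he, FiberBundle.extend, hxV, eV, eW]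
  have e (y : M) : ContinuousLinearMap.inCoordinates F V G W x y x y (Ψ y) =
      ∑ i, ContinuousLinearMap.smulRightL ℝ F G (LinearMap.toContinuousLinearMap (b.coord i))
        (ContinuousLinearMap.inCoordinates F V G W x y x y (Ψ y) (b i)) := by
    ext v
    conv_lhs => rw [← b.sum_repr v]
    simp only [map_sum, map_smul]
    simp
  rw [funext e]
  have hsum := MDifferentiableAt.sum (t := Finset.univ) fun i _ ↦
    (ContinuousLinearMap.mdifferentiable (ContinuousLinearMap.smulRightL ℝ F G
      (LinearMap.toContinuousLinearMap (b.coord i)))).mdifferentiableAt.comp x (key (b i))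
  exact hsum.congr_of_eventuallyEq (.of_forall fun y ↦ by simp)

theorem homConnection_apply (cV : CovariantDerivative I F V) (cW : CovariantDerivative I G W)
    {Ψ : Π x, V x →L[ℝ] W x} {x : M} (hΨ : MDiffAt (homSec F G Ψ) x) {s : Π x, V x}
    (hs : MDiffAt (T% s) x) (u : TangentSpace I x) :
    homConnection cV cW Ψ x u (s x) = cW (fun y ↦ Ψ y (s y)) x u - Ψ x (cV s x u) := by
  have h := TensorialAt.mkHom₂_apply (fun s _ ↦ homDeriv_tensorial₁ cV cW Ψ x s)
    (fun X _ ↦ homDeriv_tensorial₂ cV cW hΨ X)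
    (FiberBundle.mdifferentiableAt_extend I E u) hs
  rw [FiberBundle.extend_apply_self] at h
  simp only [homConnection, dif_pos hΨ]
  rw [h]
  simp [homDeriv]

theorem cov_sum (c : CovariantDerivative I G W) {x : M} {ι : Type*} (t : Finset ι)
    (s : ι → Π x, W x) (hs : ∀ i ∈ t, MDiffAt (T% (s i)) x) :
    c (fun y ↦ ∑ i ∈ t, s i y) x = ∑ i ∈ t, c (s i) x := by
  classical
  induction t using Finset.induction_on with
  | empty =>
    simp only [Finset.sum_empty]
    exact congrFun c.zero x
  | insert a t ha ih =>
    have hs' : ∀ i ∈ t, MDiffAt (T% (s i)) x := fun i hi ↦ hs i (Finset.mem_insert_of_mem hi)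
    simp only [Finset.sum_insert ha]
    rw [← ih hs']
    exact c.isCovariantDerivativeOn.add (hs a (Finset.mem_insert_self a t)) (.sum_section hs')

theorem cov_smul_eq (c : CovariantDerivative I G W) {x : M} {f : M → ℝ} {s : Π x, W x}
    (hf : MDiffAt f x) (hs : MDiffAt (T% s) x) (u : TangentSpace I x) :
    c (fun y ↦ f y • s y) x u = f x • c s x u + mvfderiv I f x u • s x := by
  have h : c (f • s) x = _ := c.isCovariantDerivativeOn.leibniz hs hf
  change c (f • s) x u = _
  rw [h]
  rfl

theorem exists_function_mvfderiv_eq (x : M) (φ : TangentSpace I x →L[ℝ] ℝ) :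
    ∃ f : M → ℝ, CMDiffAt ∞ f x ∧ f x = 0 ∧ mvfderiv I f x = φ := by
  let φ' : E →L[ℝ] ℝ := φ
  have h1 : CMDiffAt ∞ (extChartAt I x) x := contMDiffAt_extChartAt
  refine ⟨fun y ↦ φ' (extChartAt I x y - extChartAt I x x), ?_, by simp, ?_⟩
  · exact φ'.contMDiff.contMDiffAt.comp x (h1.sub contMDiffAt_const)
  · have h2 : (fun y ↦ φ' (extChartAt I x y - extChartAt I x x)) =
        fun y ↦ φ' (extChartAt I x y) - φ' (extChartAt I x x) := by ext; simp
    have h3 := h1.mdifferentiableAt (by simp)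
    have h4 : MDiffAt (fun y ↦ φ' (extChartAt I x y)) x :=
      (ContinuousLinearMap.mdifferentiable φ').mdifferentiableAt.comp x h3
    have h5 := mvfderiv_sub h4 (mdifferentiableAt_const (c := φ' (extChartAt I x x)))
    rw [h2]
    refine (h5.trans ?_)
    rw [mvfderiv_const, sub_zero]
    have h6 := mfderiv_comp x (ContinuousLinearMap.mdifferentiable φ').mdifferentiableAt h3
    ext u
    have h7 := congr($h6 u)
    rw [mfderiv_extChartAt_self, ContinuousLinearMap.mfderiv_eq] at h7
    exact h7

theorem exists_parallel_section (c : CovariantDerivative I F V) (x : M) (v : V x) :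
    ∃ s : Π x, V x, CMDiffAt ∞ (T% s) x ∧ s x = v ∧ c s x = 0 := by
  have : T2Space (V x) := FiberBundle.t2Space F V x
  have : FiniteDimensional ℝ (V x) := VectorBundle.finiteDimensional ℝ F V x
  set b := Module.finBasis ℝ (V x)
  set B := c (FiberBundle.extend F v) x
  choose f hf hf0 hfd using fun i ↦ exists_function_mvfderiv_eq x
    ((LinearMap.toContinuousLinearMap (b.coord i)).comp B)
  have hs := FiberBundle.contMDiffAt_extend (k := ∞) I F v
  have hb (i) := FiberBundle.contMDiffAt_extend (k := ∞) I F (b i)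
  have hfb (i) : CMDiffAt ∞ (T% (fun y ↦ f i y • FiberBundle.extend F (b i) y)) x :=
    (hf i).smul_section (hb i)
  have hsum : CMDiffAt ∞ (T% (fun y ↦ ∑ i, f i y • FiberBundle.extend F (b i) y)) x :=
    ContMDiffAt.sum_section fun i _ ↦ hfb i
  refine ⟨FiberBundle.extend F v + fun y ↦ ∑ i, (-1 : ℝ) • f i y • FiberBundle.extend F (b i) y,
    ?_, ?_, ?_⟩
  · exact hs.add_section (ContMDiffAt.sum_section fun i _ ↦ (hfb i).const_smul_section)
  · simp [hf0]
  · have hm (i) : MDiffAt (T% (fun y ↦ f i y • FiberBundle.extend F (b i) y)) x :=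
      (hfb i).mdifferentiableAt (by simp)
    have hm' (i) : MDiffAt (T% (fun y ↦ (-1 : ℝ) • f i y • FiberBundle.extend F (b i) y)) x :=
      (hm i).smul_const_section
    refine (c.isCovariantDerivativeOn.add (hs.mdifferentiableAt (by simp))
      (.sum_section fun i _ ↦ hm' i)).trans ?_
    rw [cov_sum c _ _ fun i _ ↦ hm' i]
    have h1 (i) : c (fun y ↦ (-1 : ℝ) • f i y • FiberBundle.extend F (b i) y) x =
        - (((LinearMap.toContinuousLinearMap (b.coord i)).comp B)).smulRight (b i) := by
      refine (c.isCovariantDerivativeOn.smul_const (-1) (hm i)).trans ?_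
      ext u
      have := cov_smul_eq c ((hf i).mdifferentiableAt (by simp))
        ((hb i).mdifferentiableAt (by simp)) u
      simp [this, hf0, hfd]
    simp only [h1]
    ext u
    simp only [add_apply, sum_apply, neg_apply, ContinuousLinearMap.smulRight_apply,
      Finset.sum_neg_distrib]
    have := b.sum_repr (B u)
    simp only [ContinuousLinearMap.comp_apply, LinearMap.coe_toContinuousLinearMap',
      Module.Basis.coord_apply]
    rw [this]
    simp [B]

end Sections
end GaugeKato

namespace GaugeKato

section Frames
variable
  {E : Type*} [NormedAddCommGroup E] [NormedSpace ℝ E] [FiniteDimensional ℝ E]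
  {H : Type*} [TopologicalSpace H] {I : ModelWithCorners ℝ E H}
  {M : Type*} [TopologicalSpace M] [ChartedSpace H M] [IsManifold I ∞ M]
  {F : Type*} [NormedAddCommGroup F] [NormedSpace ℝ F] [FiniteDimensional ℝ F]
  {V : M → Type*} [TopologicalSpace (TotalSpace F V)]
  [∀ x, NormedAddCommGroup (V x)] [∀ x, InnerProductSpace ℝ (V x)]
  [FiberBundle F V] [VectorBundle ℝ F V] [ContMDiffVectorBundle ∞ F V I]
  [IsContMDiffRiemannianBundle I ∞ F V]

theorem mvfderiv_inner_eq {c : CovariantDerivative I F V} (hc : c.IsMetricCompatible) {x : M}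
    {s t : Π x, V x} (hs : MDiffAt (T% s) x) (ht : MDiffAt (T% t) x) (u : TangentSpace I x) :
    mvfderiv I (fun y ↦ inner ℝ (s y) (t y)) x u =
      inner ℝ (c s x u) (t x) + inner ℝ (s x) (c t x u) := by
  simpa using hc.mvfderiv_inner_eq (FiberBundle.extend E u) hs ht

theorem mvfderiv_comp_eq_zero {f : M → ℝ} {g : ℝ → ℝ} {x : M} (hg : DifferentiableAt ℝ g (f x))
    (hf : MDiffAt f x) (h : mvfderiv I f x = 0) : mvfderiv I (fun y ↦ g (f y)) x = 0 := by
  have h1 : mvfderiv I (g ∘ f) x = _ := mvfderiv_comp x hg.mdifferentiableAt hf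
  change mvfderiv I (g ∘ f) x = 0
  rw [h1]
  ext u
  have h2 : mfderiv I 𝓘(ℝ, ℝ) f x u = 0 := congr($h u)
  simp [h2]

/-- A section that is parallel and of norm one at a point can be normalized to a section that is
parallel at this point. -/
theorem exists_normalized_section {c : CovariantDerivative I F V} (hc : c.IsMetricCompatible)
    {x : M} {r : Π x, V x} (hr : CMDiffAt ∞ (T% r) x) (hrx : inner ℝ (r x) (r x) = 1)
    (hcr : c r x = 0) :
    ∃ f : M → ℝ, CMDiffAt ∞ (T% (f • r)) x ∧ f x = 1 ∧ c (f • r) x = 0 ∧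
      ∀ᶠ y in 𝓝 x, inner ℝ (f y • r y) (f y • r y) = 1 := by
  have hr1 := hr.mdifferentiableAt (n := ∞) (by simp)
  have hN : CMDiffAt ∞ (fun y ↦ inner ℝ (r y) (r y)) x :=
    ContMDiffAt.inner_bundle (F := F) (E := V) (IB := I) (b := fun y ↦ y) hr hr
  have hg : ContDiffAt ℝ ∞ (fun t : ℝ ↦ (√t)⁻¹) (inner ℝ (r x) (r x)) := by
    rw [hrx]
    exact (Real.contDiffAt_sqrt one_ne_zero).inv (by simp)
  have hf : CMDiffAt ∞ (fun y ↦ (√(inner ℝ (r y) (r y)))⁻¹) x :=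
    ContMDiffAt.comp (g := fun t : ℝ ↦ (√t)⁻¹) x hg.contMDiffAt hN
  have hN0 : mvfderiv I (fun y ↦ inner ℝ (r y) (r y)) x = 0 := by
    ext u
    rw [mvfderiv_inner_eq hc hr1 hr1 u, hcr]
    simp
  have hf0 := mvfderiv_comp_eq_zero (f := fun y ↦ (inner ℝ (r y) (r y) : ℝ)) (hg.differentiableAt (by simp))
    (hN.mdifferentiableAt (by simp)) hN0
  refine ⟨fun y ↦ (√(inner ℝ (r y) (r y)))⁻¹, hf.smul_section hr, by beta_reduce; rw [hrx]; simp, ?_, ?_⟩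
  · rw [c.isCovariantDerivativeOn.leibniz hr1 (hf.mdifferentiableAt (by simp)), hcr, hf0]
    ext u
    simp
  · have h0 : ∀ᶠ y in 𝓝 x, (0 : ℝ) < inner ℝ (r y) (r y) :=
      hN.continuousAt.eventually (lt_mem_nhds (by beta_reduce; rw [hrx]; simp))
    filter_upwards [h0] with y hy
    rw [inner_smul_left, inner_smul_right, ← mul_assoc]
    simp only [conj_trivial]
    rw [← mul_inv, Real.mul_self_sqrt hy.le, inv_mul_cancel₀ hy.ne']

/-- A metric connection has near every point an orthonormal frame that is parallel at the point and
has prescribed values there. -/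
theorem exists_orthonormal_frame {n : ℕ} {c : CovariantDerivative I F V}
    (hc : c.IsMetricCompatible) {x : M} {b : Fin n → V x} (hb : Orthonormal ℝ b) :
    ∃ e : Fin n → Π y, V y, (∀ i, CMDiffAt ∞ (T% (e i)) x) ∧ (∀ i, e i x = b i) ∧
      (∀ i, c (e i) x = 0) ∧ ∀ᶠ y in 𝓝 x, Orthonormal ℝ (fun i ↦ e i y) := by
  classical
  have key (k : ℕ) : ∃ e : Fin n → Π y, V y, (∀ i, CMDiffAt ∞ (T% (e i)) x) ∧
      (∀ i, e i x = b i) ∧ (∀ i, c (e i) x = 0) ∧ ∀ᶠ y in 𝓝 x, ∀ i j : Fin n,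
        i.1 < k → j.1 < k → inner ℝ (e i y) (e j y) = if i = j then (1 : ℝ) else 0 := by
    induction k with
    | zero =>
      choose e he hex hec using fun i ↦ exists_parallel_section c x (b i)
      exact ⟨e, he, hex, hec, by simp⟩
    | succ k ih =>
      obtain ⟨e, he, hex, hec, heo⟩ := ih
      by_cases hk : k < n
      swap
      · refine ⟨e, he, hex, hec, heo.mono fun y hy i j _ _ ↦ hy i j (by omega) (by omega)⟩
      set K : Fin n := ⟨k, hk⟩
      set S : Finset (Fin n) := Finset.univ.filter (fun i ↦ i.1 < k)
      have hbo := orthonormal_iff_ite.1 hb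
      have hin (j : Fin n) : CMDiffAt ∞ (fun y ↦ inner ℝ (e j y) (e K y)) x :=
        ContMDiffAt.inner_bundle (F := F) (E := V) (IB := I) (b := fun y ↦ y) (he j) (he K)
      have hmd (j) : MDiffAt (T% (e j)) x := (he j).mdifferentiableAt (by simp)
      have hin0 (j : Fin n) : mvfderiv I (fun y ↦ inner ℝ (e j y) (e K y)) x = 0 := by
        ext u
        simp [mvfderiv_inner_eq hc (hmd j) (hmd K) u, hec]
      have ht (j : Fin n) :
          CMDiffAt ∞ (T% (fun y ↦ -(inner ℝ (e j y) (e K y) : ℝ) • e j y)) x :=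
        (hin j).neg.smul_section (he j)
      have hct (j : Fin n) (hj : j ∈ S) :
          c (fun y ↦ -(inner ℝ (e j y) (e K y) : ℝ) • e j y) x = 0 := by
        ext u
        have h1 := cov_smul_eq c ((hin j).neg.mdifferentiableAt (by simp)) (hmd j) u
        rw [hec] at h1
        have h2 := (mvfderiv_neg (g := fun y ↦ (inner ℝ (e j y) (e K y) : ℝ)) (I := I) (x := x))
        have h3 : mvfderiv I (fun y ↦ -(inner ℝ (e j y) (e K y) : ℝ)) x = 0 := by
          refine h2.trans ?_
          rw [hin0, neg_zero]
        rw [h3] at h1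
        simpa using h1
      set r : Π y, V y := e K + fun y ↦ ∑ j ∈ S, -(inner ℝ (e j y) (e K y) : ℝ) • e j y with hr
      have hrs : CMDiffAt ∞ (T% r) x :=
        (he K).add_section (ContMDiffAt.sum_section fun j _ ↦ ht j)
      have hrx : r x = b K := by
        have : ∑ j ∈ S, -(inner ℝ (e j x) (e K x) : ℝ) • e j x = 0 := by
          refine Finset.sum_eq_zero fun j hj ↦ ?_
          have hjK : j ≠ K := by
            rintro rfl
            simp [S, K] at hj
          rw [hex, hex, hbo, if_neg hjK]
          simp
        rw [hr, Pi.add_apply, this, hex, add_zero]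
      have hrc : c r x = 0 := by
        refine (c.isCovariantDerivativeOn.add (hmd K)
          (.sum_section fun j _ ↦ (ht j).mdifferentiableAt (by simp))).trans ?_
        rw [cov_sum c _ _ fun j _ ↦ (ht j).mdifferentiableAt (by simp), hec,
          Finset.sum_eq_zero hct, add_zero]
      obtain ⟨f, hfs, hfx, hfc, hfo⟩ := exists_normalized_section hc hrs
        (by rw [hrx, hbo, if_pos rfl]) hrc
      refine ⟨Function.update e K (f • r), fun i ↦ ?_, fun i ↦ ?_, fun i ↦ ?_, ?_⟩
      · rcases eq_or_ne i K with rfl | h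
        · rwa [Function.update_self]
        · rw [Function.update_of_ne h]
          exact he i
      · rcases eq_or_ne i K with rfl | h
        · simp [hfx, hrx]
        · rw [Function.update_of_ne h]
          exact hex i
      · rcases eq_or_ne i K with rfl | h
        · rwa [Function.update_self]
        · rw [Function.update_of_ne h]
          exact hec i
      · filter_upwards [heo, hfo] with y hy hfy i j hi hj
        have hlt (i : Fin n) (hi : i.1 < k + 1) (h : i ≠ K) : i.1 < k := by
          have : i.1 ≠ k := fun h' ↦ h (Fin.ext h')
          omega
        have horth (i : Fin n) (hi : i.1 < k) : inner ℝ (e i y) (f y • r y) = (0 : ℝ) := by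
          rw [inner_smul_right, hr]
          simp only [Pi.add_apply, inner_add_right, inner_sum, inner_smul_right]
          rw [Finset.sum_eq_single i]
          · rw [hy i i hi hi]
            simp
          · intro j hj hji
            rw [hy i j hi (by simpa [S] using hj), if_neg hji.symm, mul_zero]
          · simp [S, hi]
        rcases eq_or_ne i K with rfl | hiK <;> rcases eq_or_ne j K with rfl | hjK
        · simpa using hfy
        · rw [Function.update_self, Function.update_of_ne hjK, if_neg hjK.symm, real_inner_comm]
          exact horth j (hlt j hj hjK)
        · rw [Function.update_self, Function.update_of_ne hiK, if_neg hiK]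
          exact horth i (hlt i hi hiK)
        · rw [Function.update_of_ne hiK, Function.update_of_ne hjK]
          exact hy i j (hlt i hi hiK) (hlt j hj hjK)
  obtain ⟨e, he, hex, hec, heo⟩ := key n
  exact ⟨e, he, hex, hec, heo.mono fun y hy ↦ orthonormal_iff_ite.2 fun i j ↦ hy i j i.2 j.2⟩

end Frames
end GaugeKato

namespace GaugeKato

section LinearAlgebra
variable {T : Type*} [NormedAddCommGroup T] [InnerProductSpace ℝ T]
  {W : Type*} [AddCommGroup W] [Module ℝ W]

theorem sum_bilin_orthonormalBasis {ι κ : Type*} [Fintype ι] [Fintype κ]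
    (b : OrthonormalBasis ι ℝ T) (b' : OrthonormalBasis κ ℝ T) (B : T →ₗ[ℝ] T →ₗ[ℝ] W) :
    ∑ i, B (b i) (b i) = ∑ j, B (b' j) (b' j) := by
  have h1 (i : ι) : B (b i) (b i) = ∑ j, inner ℝ (b' j) (b i) • B (b' j) (b i) := by
    conv_lhs => arg 1; rw [← b'.sum_repr' (b i)]
    simp only [map_sum, map_smul, LinearMap.sum_apply, LinearMap.smul_apply]
  have h2 (j : κ) : B (b' j) (b' j) = ∑ i, inner ℝ (b' j) (b i) • B (b' j) (b i) := by
    conv_lhs => arg 2; rw [← b.sum_repr' (b' j)]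
    simp only [map_sum, map_smul, real_inner_comm]
  simp only [h1, h2]
  exact Finset.sum_comm

variable [FiniteDimensional ℝ T] [TopologicalSpace W] [IsTopologicalAddGroup W]
  [ContinuousSMul ℝ W]

variable (T) in
/-- The bilinear form `∑ i, g (Ψ e_i, Θ e_i)` on `Hom(T, W)` induced by a bilinear form `g` on `W`
and by the inner product of `T`. -/
noncomputable def homForm (g : W →ₗ[ℝ] W →ₗ[ℝ] ℝ) : (T →L[ℝ] W) →ₗ[ℝ] (T →L[ℝ] W) →ₗ[ℝ] ℝ :=
  LinearMap.mk₂ ℝ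
    (fun Ψ Θ ↦ ∑ i, g (Ψ (stdOrthonormalBasis ℝ T i)) (Θ (stdOrthonormalBasis ℝ T i)))
    (fun _ _ _ ↦ by simp [Finset.sum_add_distrib]) (fun _ _ _ ↦ by simp [Finset.mul_sum])
    (fun _ _ _ ↦ by simp [Finset.sum_add_distrib]) (fun _ _ _ ↦ by simp [Finset.mul_sum])

theorem homForm_apply {ι : Type*} [Fintype ι] (b : OrthonormalBasis ι ℝ T)
    (g : W →ₗ[ℝ] W →ₗ[ℝ] ℝ) (Ψ Θ : T →L[ℝ] W) :
    homForm T g Ψ Θ = ∑ i, g (Ψ (b i)) (Θ (b i)) :=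
  sum_bilin_orthonormalBasis (stdOrthonormalBasis ℝ T) b
    (g.compl₁₂ (Ψ : T →ₗ[ℝ] W) (Θ : T →ₗ[ℝ] W))

theorem frobSq_eq_homForm (g : W →ₗ[ℝ] W →ₗ[ℝ] ℝ) (Ψ : T →L[ℝ] W) :
    frobSq (fun w ↦ g w w) Ψ = homForm T g Ψ Ψ :=
  rfl

theorem homForm_symm {g : W →ₗ[ℝ] W →ₗ[ℝ] ℝ} (hg : ∀ s t, g s t = g t s) (Ψ Θ : T →L[ℝ] W) :
    homForm T g Ψ Θ = homForm T g Θ Ψ :=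
  by simp [homForm, hg (Ψ _)]

theorem homForm_pos {g : W →ₗ[ℝ] W →ₗ[ℝ] ℝ} (hg : ∀ s, s ≠ 0 → 0 < g s s) {Ψ : T →L[ℝ] W}
    (hΨ : Ψ ≠ 0) : 0 < homForm T g Ψ Ψ := by
  have h0 (s : W) : 0 ≤ g s s := by
    rcases eq_or_ne s 0 with rfl | h
    · simp
    · exact (hg s h).le
  by_contra! h
  have h1 : ∑ i, g (Ψ (stdOrthonormalBasis ℝ T i)) (Ψ (stdOrthonormalBasis ℝ T i)) = 0 :=
    le_antisymm h (Finset.sum_nonneg fun i _ ↦ h0 _)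
  rw [Finset.sum_eq_zero_iff_of_nonneg fun i _ ↦ h0 _] at h1
  refine hΨ (ContinuousLinearMap.coe_injective ((stdOrthonormalBasis ℝ T).toBasis.ext fun i ↦ ?_))
  by_contra h2
  exact (hg _ h2).ne' (by simpa using h1 i (Finset.mem_univ i))

end LinearAlgebra

section ParallelMetric
variable
  {E : Type*} [NormedAddCommGroup E] [NormedSpace ℝ E] [FiniteDimensional ℝ E]
  {H : Type*} [TopologicalSpace H] {I : ModelWithCorners ℝ E H}
  {M : Type*} [TopologicalSpace M] [ChartedSpace H M] [IsManifold I ∞ M]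
  {G : Type*} [NormedAddCommGroup G] [NormedSpace ℝ G]
  {W : M → Type*} [TopologicalSpace (TotalSpace G W)]
  [∀ x, AddCommGroup (W x)] [∀ x, Module ℝ (W x)] [∀ x, TopologicalSpace (W x)]
  [∀ x, IsTopologicalAddGroup (W x)] [∀ x, ContinuousSMul ℝ (W x)]
  [FiberBundle G W] [VectorBundle ℝ G W]

/-- A fibre metric `g` on the bundle `W` that is parallel for the connection `c`. -/
structure IsParallelMetric (c : CovariantDerivative I G W)
    (g : Π x, W x →ₗ[ℝ] W x →ₗ[ℝ] ℝ) : Prop where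
  symm : ∀ (x : M) (s t : W x), g x s t = g x t s
  pos : ∀ (x : M) (s : W x), s ≠ 0 → 0 < g x s s
  mdifferentiableAt : ∀ {x : M} {s t : Π x, W x}, MDiffAt (T% s) x → MDiffAt (T% t) x →
    MDiffAt (fun y ↦ g y (s y) (t y)) x
  mvfderiv_eq : ∀ {x : M} {s t : Π x, W x}, MDiffAt (T% s) x → MDiffAt (T% t) x →
    ∀ u : TangentSpace I x, mvfderiv I (fun y ↦ g y (s y) (t y)) x u =
      g x (c s x u) (t x) + g x (s x) (c t x u)

theorem mvfderiv_congr {f g : M → ℝ} {x : M} (h : f =ᶠ[𝓝 x] g) :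
    mvfderiv I f x = mvfderiv I g x := by
  ext u
  exact congr($(h.mfderiv_eq (I := I) (I' := 𝓘(ℝ, ℝ))) u)

theorem mdifferentiableAt_fun_sum {ι : Type*} (t : Finset ι) {f : ι → M → ℝ} {x : M}
    (hf : ∀ i ∈ t, MDiffAt (f i) x) : MDiffAt (fun y ↦ ∑ i ∈ t, f i y) x := by
  classical
  induction t using Finset.induction_on with
  | empty => simpa using mdifferentiableAt_const
  | insert a t ha ih =>
    simp only [Finset.sum_insert ha]
    exact (hf a (Finset.mem_insert_self a t)).add
      (ih fun i hi ↦ hf i (Finset.mem_insert_of_mem hi))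

theorem mvfderiv_fun_sum {ι : Type*} (t : Finset ι) {f : ι → M → ℝ} {x : M}
    (hf : ∀ i ∈ t, MDiffAt (f i) x) :
    mvfderiv I (fun y ↦ ∑ i ∈ t, f i y) x = ∑ i ∈ t, mvfderiv I (f i) x := by
  classical
  induction t using Finset.induction_on with
  | empty => simp [mvfderiv_const]
  | insert a t ha ih =>
    have hf' : ∀ i ∈ t, MDiffAt (f i) x := fun i hi ↦ hf i (Finset.mem_insert_of_mem hi)
    simp only [Finset.sum_insert ha]
    rw [← ih hf']
    exact mvfderiv_fun_add (hf a (Finset.mem_insert_self a t)) (mdifferentiableAt_fun_sum t hf')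

section Hom
variable
  {F : Type*} [NormedAddCommGroup F] [NormedSpace ℝ F] [FiniteDimensional ℝ F]
  {V : M → Type*} [TopologicalSpace (TotalSpace F V)]
  [∀ x, NormedAddCommGroup (V x)] [∀ x, InnerProductSpace ℝ (V x)]
  [FiberBundle F V] [VectorBundle ℝ F V] [ContMDiffVectorBundle ∞ F V I]
  [IsContMDiffRiemannianBundle I ∞ F V]

theorem isParallelMetric_inner {c : CovariantDerivative I F V} (hc : c.IsMetricCompatible) :
    IsParallelMetric c (fun x ↦ innerₗ (V x)) where
  symm _ s t := real_inner_comm t s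
  pos _ _ hs := real_inner_self_pos.2 hs
  mdifferentiableAt hs ht :=
    MDifferentiableAt.inner_bundle (F := F) (E := V) (IB := I) (b := fun y ↦ y) hs ht
  mvfderiv_eq hs ht u := mvfderiv_inner_eq hc hs ht u

/-- An orthonormal family at a point that consists of as many vectors as the rank of the bundle is
an orthonormal basis. -/
theorem exists_orthonormalBasis_of_orthonormal (F : Type*) [NormedAddCommGroup F] [NormedSpace ℝ F]
    [FiniteDimensional ℝ F] [TopologicalSpace (TotalSpace F V)] [FiberBundle F V] [VectorBundle ℝ F V] {n : ℕ}
    (hn : n = Module.finrank ℝ F) {y : M} {e : Fin n → V y} (he : Orthonormal ℝ e) :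
    ∃ b : OrthonormalBasis (Fin n) ℝ (V y), ⇑b = e := by
  have h : Fintype.card (Fin n) = Module.finrank ℝ (V y) := by
    rw [Fintype.card_fin, hn]
    exact (VectorBundle.continuousLinearEquivAt ℝ F V y).toLinearEquiv.finrank_eq.symm
  have hsp : (⊤ : Submodule ℝ (V y)) ≤ Submodule.span ℝ (Set.range e) := by
    have : FiniteDimensional ℝ (V y) := VectorBundle.finiteDimensional ℝ F V y
    exact (he.linearIndependent.span_eq_top_of_card_eq_finrank' h).ge
  exact ⟨OrthonormalBasis.mk he hsp, OrthonormalBasis.coe_mk he hsp⟩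

variable [∀ x, FiniteDimensional ℝ (V x)]

theorem IsParallelMetric.homConnection {cV : CovariantDerivative I F V}
    (hV : cV.IsMetricCompatible) {cW : CovariantDerivative I G W}
    {g : Π x, W x →ₗ[ℝ] W x →ₗ[ℝ] ℝ} (hg : IsParallelMetric cW g) :
    IsParallelMetric (homConnection cV cW) (fun x ↦ homForm (V x) (g x)) := by
  have key {x : M} {Ψ Θ : Π x, V x →L[ℝ] W x} (hΨ : MDiffAt (homSec F G Ψ) x)
      (hΘ : MDiffAt (homSec F G Θ) x) :
      MDiffAt (fun y ↦ homForm (V y) (g y) (Ψ y) (Θ y)) x ∧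
      ∀ u : TangentSpace I x, mvfderiv I (fun y ↦ homForm (V y) (g y) (Ψ y) (Θ y)) x u =
        homForm (V x) (g x) (GaugeKato.homConnection cV cW Ψ x u) (Θ x) +
          homForm (V x) (g x) (Ψ x) (GaugeKato.homConnection cV cW Θ x u) := by
    set b := stdOrthonormalBasis ℝ (V x)
    obtain ⟨e, he, hex, hec, heo⟩ := exists_orthonormal_frame hV b.orthonormal
    have he1 (i) : MDiffAt (T% (e i)) x := (he i).mdifferentiableAt (by simp)
    have h1 : (fun y ↦ homForm (V y) (g y) (Ψ y) (Θ y)) =ᶠ[𝓝 x]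
        fun y ↦ ∑ i, g y (Ψ y (e i y)) (Θ y (e i y)) := by
      filter_upwards [heo] with y hy
      obtain ⟨b', hb'⟩ := exists_orthonormalBasis_of_orthonormal F
        (VectorBundle.continuousLinearEquivAt ℝ F V x).toLinearEquiv.finrank_eq hy
      rw [homForm_apply b', hb']
    have h2 (i) := hg.mdifferentiableAt (hΨ.clm_bundle_apply (he1 i)) (hΘ.clm_bundle_apply (he1 i))
    refine ⟨(mdifferentiableAt_fun_sum _ fun i _ ↦ h2 i).congr_of_eventuallyEq h1, fun u ↦ ?_⟩
    rw [mvfderiv_congr h1, mvfderiv_fun_sum _ fun i _ ↦ h2 i, homForm_apply b, homForm_apply b,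
      ← Finset.sum_add_distrib]
    simp only [sum_apply]
    refine Finset.sum_congr rfl fun i _ ↦ ?_
    rw [hg.mvfderiv_eq (hΨ.clm_bundle_apply (he1 i)) (hΘ.clm_bundle_apply (he1 i)), ← hex i,
      homConnection_apply cV cW hΨ (he1 i), homConnection_apply cV cW hΘ (he1 i), hec]
    simp
  exact
    { symm := fun x ↦ homForm_symm (hg.symm x)
      pos := fun x _ ↦ homForm_pos (hg.pos x)
      mdifferentiableAt := fun hΨ hΘ ↦ (key hΨ hΘ).1
      mvfderiv_eq := fun hΨ hΘ ↦ (key hΨ hΘ).2 }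

end Hom
end ParallelMetric
end GaugeKato

namespace GaugeKato

section HodgeStarBasis
variable {T : Type*} [NormedAddCommGroup T] [InnerProductSpace ℝ T] [FiniteDimensional ℝ T]
  {W : Type*} [AddCommGroup W] [Module ℝ W] [TopologicalSpace W]
  [IsTopologicalAddGroup W] [ContinuousSMul ℝ W]

theorem sum_sum_bilin_orthonormalBasis {ι : Type*} [Fintype ι] (b : OrthonormalBasis ι ℝ T)
    (φ : T →ₗ[ℝ] T →ₗ[ℝ] ℝ) (β : T →L[ℝ] T →L[ℝ] W) :
    ∑ i, ∑ j, φ (stdOrthonormalBasis ℝ T i) (stdOrthonormalBasis ℝ T j) •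
        β (stdOrthonormalBasis ℝ T i) (stdOrthonormalBasis ℝ T j) =
      ∑ i, ∑ j, φ (b i) (b j) • β (b i) (b j) := by
  have h1 (u : T) := sum_bilin_orthonormalBasis (stdOrthonormalBasis ℝ T) b
    (LinearMap.mk₂ ℝ (fun v w ↦ φ u v • β u w) (fun _ _ _ ↦ by simp [add_smul])
      (fun _ _ _ ↦ by simp [mul_smul]) (fun _ _ _ ↦ by simp)
      (fun _ _ _ ↦ by simp only [map_smul]; rw [smul_comm]))
  have h2 (u : T) := sum_bilin_orthonormalBasis (stdOrthonormalBasis ℝ T) b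
    (LinearMap.mk₂ ℝ (fun v w ↦ φ v u • β w u) (fun _ _ _ ↦ by simp [add_smul])
      (fun _ _ _ ↦ by simp [mul_smul]) (fun _ _ _ ↦ by simp)
      (fun _ _ _ ↦ by simp only [map_smul, smul_apply]; rw [smul_comm]))
  simp only [LinearMap.mk₂_apply] at h1 h2
  simp only [h1]
  rw [Finset.sum_comm]
  refine Eq.trans ?_ Finset.sum_comm
  exact Finset.sum_congr rfl fun j _ ↦ h2 (b j)

theorem volumeForm_perm {n : ℕ} [Fact (Module.finrank ℝ T = n)] (o : Orientation ℝ T (Fin n))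
    (b : Fin n → T) (τ : Equiv.Perm (Fin n)) :
    o.volumeForm (fun i ↦ b (τ i)) = (Equiv.Perm.sign τ : ℤ) • o.volumeForm b := by
  have h := o.volumeForm.map_perm b τ
  simpa [Function.comp_def, Units.smul_def] using h

section Four
variable [Fact (Module.finrank ℝ T = 4)] (o : Orientation ℝ T (Fin 4))

theorem hodgeStarFour_apply (b : OrthonormalBasis (Fin 4) ℝ T) (β : T →L[ℝ] T →L[ℝ] W) (u v : T) :
    hodgeStarFour o β u v =
      (1 / 2 : ℝ) • ∑ i, ∑ j, o.volumeForm ![b i, b j, u, v] • β (b i) (b j) := by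
  have h := sum_sum_bilin_orthonormalBasis b
    (LinearMap.mk₂ ℝ (fun x y ↦ o.volumeForm ![x, y, u, v])
      (fun x x' y ↦ congrArg (· ![y, u, v]) (map_add o.volumeForm.curryLeft x x'))
      (fun c x y ↦ congrArg (· ![y, u, v]) (map_smul o.volumeForm.curryLeft c x))
      (fun x y y' ↦ congrArg (· ![u, v]) (map_add (o.volumeForm.curryLeft x).curryLeft y y'))
      (fun c x y ↦ congrArg (· ![u, v]) (map_smul (o.volumeForm.curryLeft x).curryLeft c y))) β
  exact congrArg ((1 / 2 : ℝ) • ·) h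

theorem hodgeStarFour_two_three (b : OrthonormalBasis (Fin 4) ℝ T) {β : T →L[ℝ] T →L[ℝ] W}
    (hβ : ∀ u v, β u v = - β v u) :
    hodgeStarFour o β (b 2) (b 3) = o.volumeForm b • β (b 0) (b 1) := by
  have e (x y z w : T) (h : x = y ∨ x = z ∨ x = w ∨ y = z ∨ y = w) :
      o.volumeForm ![x, y, z, w] = 0 := by
    rcases h with h | h | h | h | h
    · exact o.volumeForm.map_eq_zero_of_eq ![x, y, z, w] (i := 0) (j := 1) h (by decide)
    · exact o.volumeForm.map_eq_zero_of_eq ![x, y, z, w] (i := 0) (j := 2) h (by decide)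
    · exact o.volumeForm.map_eq_zero_of_eq ![x, y, z, w] (i := 0) (j := 3) h (by decide)
    · exact o.volumeForm.map_eq_zero_of_eq ![x, y, z, w] (i := 1) (j := 2) h (by decide)
    · exact o.volumeForm.map_eq_zero_of_eq ![x, y, z, w] (i := 1) (j := 3) h (by decide)
  have h0 : ![b 0, b 1, b 2, b 3] = b := by
    ext i; fin_cases i <;> rfl
  have h1 : o.volumeForm ![b 1, b 0, b 2, b 3] = - o.volumeForm b := by
    have h := o.volumeForm.map_swap b (i := 0) (j := 1) (by decide)
    rw [← h]
    congr 1
    ext i; fin_cases i <;> rfl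
  rw [hodgeStarFour_apply o b]
  simp only [Fin.sum_univ_four]
  simp only [e, h0, h1, true_or, or_true]
  rw [hβ (b 1) (b 0)]
  simp only [zero_smul, smul_neg, neg_smul, neg_neg, add_zero, zero_add]
  module

theorem hodgeStarFour_perm (b : OrthonormalBasis (Fin 4) ℝ T) {β : T →L[ℝ] T →L[ℝ] W}
    (hβ : ∀ u v, β u v = - β v u) (τ : Equiv.Perm (Fin 4)) :
    hodgeStarFour o β (b (τ 2)) (b (τ 3)) =
      ((Equiv.Perm.sign τ : ℤ) : ℝ) • o.volumeForm b • β (b (τ 0)) (b (τ 1)) := by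
  have h := hodgeStarFour_two_three o (b.reindex τ.symm) hβ
  have h' := volumeForm_perm o b τ
  have e : ⇑(b.reindex τ.symm) = fun i ↦ b (τ i) := by ext i; simp
  rw [e, h'] at h
  simpa [smul_smul] using h

end Four

section Three
variable [Fact (Module.finrank ℝ T = 3)] (o : Orientation ℝ T (Fin 3))

theorem hodgeStarThree_apply (b : OrthonormalBasis (Fin 3) ℝ T) (β : T →L[ℝ] T →L[ℝ] W) (u : T) :
    hodgeStarThree o β u =
      (1 / 2 : ℝ) • ∑ i, ∑ j, o.volumeForm ![b i, b j, u] • β (b i) (b j) := by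
  have h := sum_sum_bilin_orthonormalBasis b
    (LinearMap.mk₂ ℝ (fun x y ↦ o.volumeForm ![x, y, u])
      (fun x x' y ↦ congrArg (· ![y, u]) (map_add o.volumeForm.curryLeft x x'))
      (fun c x y ↦ congrArg (· ![y, u]) (map_smul o.volumeForm.curryLeft c x))
      (fun x y y' ↦ congrArg (· ![u]) (map_add (o.volumeForm.curryLeft x).curryLeft y y'))
      (fun c x y ↦ congrArg (· ![u]) (map_smul (o.volumeForm.curryLeft x).curryLeft c y))) β
  exact congrArg ((1 / 2 : ℝ) • ·) h

theorem hodgeStarThree_two (b : OrthonormalBasis (Fin 3) ℝ T) {β : T →L[ℝ] T →L[ℝ] W}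
    (hβ : ∀ u v, β u v = - β v u) :
    hodgeStarThree o β (b 2) = o.volumeForm b • β (b 0) (b 1) := by
  have e (x y z : T) (h : x = y ∨ x = z ∨ y = z) : o.volumeForm ![x, y, z] = 0 := by
    rcases h with h | h | h
    · exact o.volumeForm.map_eq_zero_of_eq ![x, y, z] (i := 0) (j := 1) h (by decide)
    · exact o.volumeForm.map_eq_zero_of_eq ![x, y, z] (i := 0) (j := 2) h (by decide)
    · exact o.volumeForm.map_eq_zero_of_eq ![x, y, z] (i := 1) (j := 2) h (by decide)
  have h0 : ![b 0, b 1, b 2] = b := by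
    ext i; fin_cases i <;> rfl
  have h1 : o.volumeForm ![b 1, b 0, b 2] = - o.volumeForm b := by
    have h := o.volumeForm.map_swap b (i := 0) (j := 1) (by decide)
    rw [← h]
    congr 1
    ext i; fin_cases i <;> rfl
  rw [hodgeStarThree_apply o b]
  simp only [Fin.sum_univ_three]
  simp only [e, h0, h1, true_or, or_true]
  rw [hβ (b 1) (b 0)]
  simp only [zero_smul, smul_neg, neg_smul, neg_neg, add_zero, zero_add]
  module

theorem hodgeStarThree_perm (b : OrthonormalBasis (Fin 3) ℝ T) {β : T →L[ℝ] T →L[ℝ] W}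
    (hβ : ∀ u v, β u v = - β v u) (τ : Equiv.Perm (Fin 3)) :
    hodgeStarThree o β (b (τ 2)) =
      ((Equiv.Perm.sign τ : ℤ) : ℝ) • o.volumeForm b • β (b (τ 0)) (b (τ 1)) := by
  have h := hodgeStarThree_two o (b.reindex τ.symm) hβ
  have h' := volumeForm_perm o b τ
  have e : ⇑(b.reindex τ.symm) = fun i ↦ b (τ i) := by ext i; simp
  rw [e, h'] at h
  simpa [smul_smul] using h

end Three
end HodgeStarBasis

section Parallel
variable
  {E : Type*} [NormedAddCommGroup E] [NormedSpace ℝ E] [FiniteDimensional ℝ E]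
  {H : Type*} [TopologicalSpace H] {I : ModelWithCorners ℝ E H}
  {M : Type*} [TopologicalSpace M] [ChartedSpace H M] [IsManifold I ∞ M]
  [RiemannianBundle (fun x : M ↦ TangentSpace I x)]
  [IsContMDiffRiemannianBundle I ∞ E (fun x : M ↦ TangentSpace I x)]
  {G : Type*} [NormedAddCommGroup G] [NormedSpace ℝ G]
  {W : M → Type*} [TopologicalSpace (TotalSpace G W)]
  [∀ x, AddCommGroup (W x)] [∀ x, Module ℝ (W x)] [∀ x, TopologicalSpace (W x)]
  [∀ x, IsTopologicalAddGroup (W x)] [∀ x, ContinuousSMul ℝ (W x)]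
  [FiberBundle G W] [VectorBundle ℝ G W]

theorem exists_orthonormal_tangent_frame {n : ℕ} {x : M} {b : Fin n → TangentSpace I x}
    (hb : Orthonormal ℝ b) :
    ∃ e : Fin n → Π y : M, TangentSpace I y, (∀ i, CMDiffAt ∞ (T% (e i)) x) ∧
      (∀ i, e i x = b i) ∧ (∀ i, leviCivita I M (e i) x = 0) ∧
      ∀ᶠ y in 𝓝 x, Orthonormal ℝ (fun i ↦ e i y) :=
  exists_orthonormal_frame (V := fun x : M ↦ TangentSpace I x) leviCivita_isMetricCompatible hb

theorem oneFormConnection_apply (c : CovariantDerivative I G W)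
    {α : Π x : M, TangentSpace I x →L[ℝ] W x} {x : M} (hα : MDiffAt (homSec E G α) x)
    {X : Π x : M, TangentSpace I x} (hX : MDiffAt (T% X) x) (u : TangentSpace I x) :
    oneFormConnection c α x u (X x) =
      c (fun y ↦ α y (X y)) x u - α x (leviCivita I M X x u) :=
  homConnection_apply (leviCivita I M) c hα hX u

theorem twoFormConnection_apply (c : CovariantDerivative I G W)
    {β : Π x : M, TangentSpace I x →L[ℝ] TangentSpace I x →L[ℝ] W x} {x : M}
    (hβ : MDiffAt (homSec E (E →L[ℝ] G) β) x)
    {X Y : Π x : M, TangentSpace I x} (hX : MDiffAt (T% X) x) (hY : MDiffAt (T% Y) x)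
    (u : TangentSpace I x) :
    twoFormConnection c β x u (X x) (Y x) =
      c (fun y ↦ β y (X y) (Y y)) x u - β x (X x) (leviCivita I M Y x u) -
        β x (leviCivita I M X x u) (Y x) := by
  have h1 := homConnection_apply (leviCivita I M) (oneFormConnection c) hβ hX u
  have h2 : MDiffAt (homSec E G (fun y ↦ β y (X y))) x := hβ.clm_bundle_apply hX
  rw [twoFormConnection, h1, sub_apply, oneFormConnection_apply c h2 hY u]

end Parallel

section Volume
variable {n : ℕ} {M : Type*} [TopologicalSpace M]
  [ChartedSpace (EuclideanSpace ℝ (Fin n)) M] [IsManifold (𝓡 n) ∞ M]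
  [RiemannianBundle (fun x : M ↦ TangentSpace (𝓡 n) x)]
  [IsContMDiffRiemannianBundle (𝓡 n) ∞ (EuclideanSpace ℝ (Fin n))
    (fun x : M ↦ TangentSpace (𝓡 n) x)]
  {o : Π x : M, Orientation ℝ (TangentSpace (𝓡 n) x) (Fin n)}

theorem volumeForm_eventually_eq (ho : IsSmoothOrientation o) {x : M}
    {e : Fin n → Π y : M, TangentSpace (𝓡 n) y} (he : ∀ i, ContMDiffAt (𝓡 n) (𝓡 n).tangent ∞
      (fun y ↦ (⟨y, e i y⟩ : TangentBundle (𝓡 n) M)) x)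
    (heo : ∀ᶠ y in 𝓝 x, Orthonormal ℝ (fun i ↦ e i y)) (f : Fin n → Fin n) :
    ∀ᶠ y in 𝓝 x, (o y).volumeForm (fun i ↦ e (f i) y) =
      (o x).volumeForm (fun i ↦ e (f i) x) := by
  by_cases hf : Function.Injective f
  · have hc := (ho (fun i ↦ e (f i)) x fun i ↦ he (f i)).continuousAt
    have h1 {y : M} (hy : Orthonormal ℝ (fun i ↦ e i y)) :
        |(o y).volumeForm (fun i ↦ e (f i) y)| = 1 := by
      obtain ⟨b, hb⟩ := exists_orthonormalBasis_of_orthonormal (EuclideanSpace ℝ (Fin n))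
        (V := fun x : M ↦ TangentSpace (𝓡 n) x) (by simp) (hy.comp f hf)
      have := (o y).abs_volumeForm_apply_of_orthonormal b
      rw [hb] at this
      exact this
    have h2 := hc.eventually (Metric.ball_mem_nhds _ one_pos)
    filter_upwards [heo, h2] with y hy' hyd
    have hx1 := h1 heo.self_of_nhds
    have hy1 := h1 hy'
    rw [Real.dist_eq] at hyd
    rcases abs_eq one_pos.le |>.1 hx1 with hx | hx <;>
      rcases abs_eq one_pos.le |>.1 hy1 with hy | hy <;> rw [hx, hy] at hyd ⊢ <;> norm_num at hyd
  · obtain ⟨i, j, hij, hne⟩ : ∃ i j, f i = f j ∧ i ≠ j := by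
      simpa [Function.Injective] using hf
    refine .of_forall fun y ↦ ?_
    rw [(o y).volumeForm.map_eq_zero_of_eq _ (by rw [hij]) hne,
      (o x).volumeForm.map_eq_zero_of_eq _ (by rw [hij]) hne]
end Volume
end GaugeKato

namespace GaugeKato

section StarParallel
variable {G : Type*} [NormedAddCommGroup G] [NormedSpace ℝ G]

section General
variable {n : ℕ} {M : Type*} [TopologicalSpace M]
  [ChartedSpace (EuclideanSpace ℝ (Fin n)) M] [IsManifold (𝓡 n) ∞ M]
  {W : M → Type*} [TopologicalSpace (TotalSpace G W)]
  [∀ x, AddCommGroup (W x)] [∀ x, Module ℝ (W x)] [∀ x, TopologicalSpace (W x)]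
  [∀ x, IsTopologicalAddGroup (W x)] [∀ x, ContinuousSMul ℝ (W x)]
  [FiberBundle G W] [VectorBundle ℝ G W]

theorem mdifferentiableAt_half_sum_sum {x : M} {f : Fin n → Fin n → M → ℝ}
    {t : Fin n → Fin n → Π y, W y} (hf : ∀ i j, MDifferentiableAt (𝓡 n) 𝓘(ℝ, ℝ) (f i j) x)
    (ht : ∀ i j, MDiffSecAt (𝓡 n) G (t i j) x) :
    MDiffSecAt (𝓡 n) G (fun y ↦ (1 / 2 : ℝ) • ∑ i, ∑ j, f i j y • t i j y) x :=
  MDifferentiableAt.smul_const_section (.sum_section fun i _ ↦ .sum_section fun j _ ↦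
    (hf i j).smul_section (ht i j))

theorem cov_half_sum_sum (c : CovariantDerivative (𝓡 n) G W) {x : M} (a : Fin n → Fin n → ℝ)
    {t : Fin n → Fin n → Π y, W y} (ht : ∀ i j, MDiffSecAt (𝓡 n) G (t i j) x) :
    c (fun y ↦ (1 / 2 : ℝ) • ∑ i, ∑ j, a i j • t i j y) x =
      (1 / 2 : ℝ) • ∑ i, ∑ j, a i j • c (t i j) x := by
  have h1 (i j) : MDiffSecAt (𝓡 n) G (fun y ↦ a i j • t i j y) x := (ht i j).smul_const_section
  have h2 (i) : MDiffSecAt (𝓡 n) G (fun y ↦ ∑ j, a i j • t i j y) x := .sum_section fun j _ ↦ h1 i j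
  refine (c.isCovariantDerivativeOn.smul_const _ (.sum_section fun i _ ↦ h2 i)).trans ?_
  rw [cov_sum c _ _ fun i _ ↦ h2 i]
  congr 1
  refine Finset.sum_congr rfl fun i _ ↦ ?_
  rw [cov_sum c _ _ fun j _ ↦ h1 i j]
  exact Finset.sum_congr rfl fun j _ ↦ c.isCovariantDerivativeOn.smul_const (a i j) (ht i j)

end General

section Four
variable {M : Type*} [TopologicalSpace M] [T2Space M]
  [ChartedSpace (EuclideanSpace ℝ (Fin 4)) M] [IsManifold (𝓡 4) ∞ M]
  [RiemannianBundle (fun x : M ↦ TangentSpace (𝓡 4) x)]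
  [IsContMDiffRiemannianBundle (𝓡 4) ∞ (EuclideanSpace ℝ (Fin 4))
    (fun x : M ↦ TangentSpace (𝓡 4) x)]
  {o : Π x : M, Orientation ℝ (TangentSpace (𝓡 4) x) (Fin 4)}
  {W : M → Type*} [TopologicalSpace (TotalSpace G W)]
  [∀ x, AddCommGroup (W x)] [∀ x, Module ℝ (W x)] [∀ x, TopologicalSpace (W x)]
  [∀ x, IsTopologicalAddGroup (W x)] [∀ x, ContinuousSMul ℝ (W x)]
  [FiberBundle G W] [VectorBundle ℝ G W]

/-- The Hodge star of two-forms in dimension four is parallel. -/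
theorem hodgeStarFour_parallel (ho : IsSmoothOrientation o) (c : CovariantDerivative (𝓡 4) G W)
    {β : Π x : M, TangentSpace (𝓡 4) x →L[ℝ] TangentSpace (𝓡 4) x →L[ℝ] W x} {x : M}
    (hβ : MDiffSecAt (𝓡 4) (EuclideanSpace ℝ (Fin 4) →L[ℝ] EuclideanSpace ℝ (Fin 4) →L[ℝ] G) β x) :
    MDiffSecAt (𝓡 4) (EuclideanSpace ℝ (Fin 4) →L[ℝ] EuclideanSpace ℝ (Fin 4) →L[ℝ] G)
      (fun y ↦ hodgeStarFour (o y) (β y)) x ∧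
    ∀ u, twoFormConnection c (fun y ↦ hodgeStarFour (o y) (β y)) x u =
      hodgeStarFour (o x) (twoFormConnection c β x u) := by
  obtain ⟨b, -⟩ := exists_orthonormalBasis_of_orthonormal (EuclideanSpace ℝ (Fin 4))
    (V := fun x : M ↦ TangentSpace (𝓡 4) x) (y := x) (by simp)
    (((stdOrthonormalBasis ℝ (TangentSpace (𝓡 4) x)).reindex
      (finCongr (fact_finrank_tangentSpace (n := 4) x).out)).orthonormal)
  obtain ⟨e, he, hex, hec, heo⟩ := exists_orthonormal_tangent_frame b.orthonormal
  have he1 (i) : MDiffSecAt (𝓡 4) (EuclideanSpace ℝ (Fin 4)) (e i) x := (he i).mdifferentiableAt (by simp)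
  have hβe (i j) : MDiffSecAt (𝓡 4) G (fun y ↦ β y (e i y) (e j y)) x :=
    (hβ.clm_bundle_apply (he1 i)).clm_bundle_apply (he1 j)
  have hloc (X Y : Π y : M, TangentSpace (𝓡 4) y) : ∀ᶠ y in 𝓝 x,
      hodgeStarFour (o y) (β y) (X y) (Y y) = (1 / 2 : ℝ) • ∑ i, ∑ j,
        (o y).volumeForm ![e i y, e j y, X y, Y y] • β y (e i y) (e j y) := by
    filter_upwards [heo] with y hy
    obtain ⟨b', hb'⟩ := exists_orthonormalBasis_of_orthonormal (EuclideanSpace ℝ (Fin 4))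
      (V := fun x : M ↦ TangentSpace (𝓡 4) x) (by simp) hy
    rw [hodgeStarFour_apply (o y) b', hb']
  have hmd : MDiffSecAt (𝓡 4) (EuclideanSpace ℝ (Fin 4) →L[ℝ] EuclideanSpace ℝ (Fin 4) →L[ℝ] G)
      (fun y ↦ hodgeStarFour (o y) (β y)) x := by
    refine mdifferentiableAt_homSec fun X hX ↦ mdifferentiableAt_homSec fun Y hY ↦ ?_
    refine mdifferentiableAt_congr_section ?_ (hloc X Y)
    refine mdifferentiableAt_half_sum_sum (fun i j ↦ ?_) hβe
    have h := ho ![e i, e j, X, Y] x fun k ↦ by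
      fin_cases k
      exacts [he i, he j, hX x, hY x]
    refine (h.mdifferentiableAt (by simp)).congr_of_eventuallyEq (.of_forall fun y ↦ ?_)
    simp only
    congr 1
    ext k
    fin_cases k <;> rfl
  refine ⟨hmd, fun u ↦ ?_⟩
  refine ContinuousLinearMap.coe_injective (b.toBasis.ext fun k ↦
    ContinuousLinearMap.coe_injective (b.toBasis.ext fun l ↦ ?_))
  simp only [OrthonormalBasis.coe_toBasis, ContinuousLinearMap.coe_coe]
  rw [hodgeStarFour_apply (o x) b]
  simp only [← hex]
  rw [twoFormConnection_apply c hmd (he1 k) (he1 l)]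
  simp only [twoFormConnection_apply c hβ (he1 _) (he1 _), hec]
  simp only [zero_apply, map_zero, sub_zero]
  have hloc' : ∀ᶠ y in 𝓝 x, hodgeStarFour (o y) (β y) (e k y) (e l y) = (1 / 2 : ℝ) • ∑ i, ∑ j,
      (o x).volumeForm ![e i x, e j x, e k x, e l x] • β y (e i y) (e j y) := by
    have h (i j : Fin 4) := volumeForm_eventually_eq ho he heo ![i, j, k, l]
    filter_upwards [hloc (e k) (e l), Filter.eventually_all.2 fun i ↦ Filter.eventually_all.2
      fun j ↦ h i j] with y hy hy'
    rw [hy]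
    congr 1
    refine Finset.sum_congr rfl fun i _ ↦ Finset.sum_congr rfl fun j _ ↦ ?_
    congr 1
    have e1 (z : M) : ![e i z, e j z, e k z, e l z] = fun m ↦ e (![i, j, k, l] m) z := by
      ext m
      fin_cases m <;> rfl
    rw [e1, e1]
    exact hy' i j
  rw [c.isCovariantDerivativeOnUniv.congr_of_eventuallyEq
    ((hmd.clm_bundle_apply (he1 k)).clm_bundle_apply (he1 l))
    (mdifferentiableAt_half_sum_sum (fun i j ↦ mdifferentiableAt_const) hβe)
    Filter.univ_mem hloc', cov_half_sum_sum c _ hβe]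
  simp

end Four

section Three
variable {M : Type*} [TopologicalSpace M] [T2Space M]
  [ChartedSpace (EuclideanSpace ℝ (Fin 3)) M] [IsManifold (𝓡 3) ∞ M]
  [RiemannianBundle (fun x : M ↦ TangentSpace (𝓡 3) x)]
  [IsContMDiffRiemannianBundle (𝓡 3) ∞ (EuclideanSpace ℝ (Fin 3))
    (fun x : M ↦ TangentSpace (𝓡 3) x)]
  {o : Π x : M, Orientation ℝ (TangentSpace (𝓡 3) x) (Fin 3)}
  {W : M → Type*} [TopologicalSpace (TotalSpace G W)]
  [∀ x, AddCommGroup (W x)] [∀ x, Module ℝ (W x)] [∀ x, TopologicalSpace (W x)]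
  [∀ x, IsTopologicalAddGroup (W x)] [∀ x, ContinuousSMul ℝ (W x)]
  [FiberBundle G W] [VectorBundle ℝ G W]

/-- The Hodge star of two-forms in dimension three is parallel. -/
theorem hodgeStarThree_parallel (ho : IsSmoothOrientation o) (c : CovariantDerivative (𝓡 3) G W)
    {β : Π x : M, TangentSpace (𝓡 3) x →L[ℝ] TangentSpace (𝓡 3) x →L[ℝ] W x} {x : M}
    (hβ : MDiffSecAt (𝓡 3) (EuclideanSpace ℝ (Fin 3) →L[ℝ] EuclideanSpace ℝ (Fin 3) →L[ℝ] G) β x) :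
    MDiffSecAt (𝓡 3) (EuclideanSpace ℝ (Fin 3) →L[ℝ] G) (fun y ↦ hodgeStarThree (o y) (β y)) x ∧
    ∀ u, oneFormConnection c (fun y ↦ hodgeStarThree (o y) (β y)) x u =
      hodgeStarThree (o x) (twoFormConnection c β x u) := by
  obtain ⟨b, -⟩ := exists_orthonormalBasis_of_orthonormal (EuclideanSpace ℝ (Fin 3))
    (V := fun x : M ↦ TangentSpace (𝓡 3) x) (y := x) (by simp)
    (((stdOrthonormalBasis ℝ (TangentSpace (𝓡 3) x)).reindex
      (finCongr (fact_finrank_tangentSpace (n := 3) x).out)).orthonormal)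
  obtain ⟨e, he, hex, hec, heo⟩ := exists_orthonormal_tangent_frame b.orthonormal
  have he1 (i) : MDiffSecAt (𝓡 3) (EuclideanSpace ℝ (Fin 3)) (e i) x := (he i).mdifferentiableAt (by simp)
  have hβe (i j) : MDiffSecAt (𝓡 3) G (fun y ↦ β y (e i y) (e j y)) x :=
    (hβ.clm_bundle_apply (he1 i)).clm_bundle_apply (he1 j)
  have hloc (X : Π y : M, TangentSpace (𝓡 3) y) : ∀ᶠ y in 𝓝 x,
      hodgeStarThree (o y) (β y) (X y) = (1 / 2 : ℝ) • ∑ i, ∑ j,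
        (o y).volumeForm ![e i y, e j y, X y] • β y (e i y) (e j y) := by
    filter_upwards [heo] with y hy
    obtain ⟨b', hb'⟩ := exists_orthonormalBasis_of_orthonormal (EuclideanSpace ℝ (Fin 3))
      (V := fun x : M ↦ TangentSpace (𝓡 3) x) (by simp) hy
    rw [hodgeStarThree_apply (o y) b', hb']
  have hmd : MDiffSecAt (𝓡 3) (EuclideanSpace ℝ (Fin 3) →L[ℝ] G)
      (fun y ↦ hodgeStarThree (o y) (β y)) x := by
    refine mdifferentiableAt_homSec fun X hX ↦ ?_
    refine mdifferentiableAt_congr_section ?_ (hloc X)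
    refine mdifferentiableAt_half_sum_sum (fun i j ↦ ?_) hβe
    have h := ho ![e i, e j, X] x fun k ↦ by
      fin_cases k
      exacts [he i, he j, hX x]
    refine (h.mdifferentiableAt (by simp)).congr_of_eventuallyEq (.of_forall fun y ↦ ?_)
    simp only
    congr 1
    ext k
    fin_cases k <;> rfl
  refine ⟨hmd, fun u ↦ ?_⟩
  refine ContinuousLinearMap.coe_injective (b.toBasis.ext fun k ↦ ?_)
  simp only [OrthonormalBasis.coe_toBasis, ContinuousLinearMap.coe_coe]
  rw [hodgeStarThree_apply (o x) b]
  simp only [← hex]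
  rw [oneFormConnection_apply c hmd (he1 k)]
  simp only [twoFormConnection_apply c hβ (he1 _) (he1 _), hec]
  simp only [zero_apply, map_zero, sub_zero]
  have hloc' : ∀ᶠ y in 𝓝 x, hodgeStarThree (o y) (β y) (e k y) = (1 / 2 : ℝ) • ∑ i, ∑ j,
      (o x).volumeForm ![e i x, e j x, e k x] • β y (e i y) (e j y) := by
    have h (i j : Fin 3) := volumeForm_eventually_eq ho he heo ![i, j, k]
    filter_upwards [hloc (e k), Filter.eventually_all.2 fun i ↦ Filter.eventually_all.2
      fun j ↦ h i j] with y hy hy'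
    rw [hy]
    congr 1
    refine Finset.sum_congr rfl fun i _ ↦ Finset.sum_congr rfl fun j _ ↦ ?_
    congr 1
    have e1 (z : M) : ![e i z, e j z, e k z] = fun m ↦ e (![i, j, k] m) z := by
      ext m
      fin_cases m <;> rfl
    rw [e1, e1]
    exact hy' i j
  rw [c.isCovariantDerivativeOnUniv.congr_of_eventuallyEq (hmd.clm_bundle_apply (he1 k))
    (mdifferentiableAt_half_sum_sum (fun i j ↦ mdifferentiableAt_const) hβe)
    Filter.univ_mem hloc', cov_half_sum_sum c _ hβe]
  simp

end Three
end StarParallel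
end GaugeKato

namespace GaugeKato

section SmoothSections
variable
  {E : Type*} [NormedAddCommGroup E] [NormedSpace ℝ E] [FiniteDimensional ℝ E]
  {H : Type*} [TopologicalSpace H] {I : ModelWithCorners ℝ E H}
  {M : Type*} [TopologicalSpace M] [ChartedSpace H M] [IsManifold I ∞ M]

/-- Smoothness of a section. -/
abbrev SmoothSec (I : ModelWithCorners ℝ E H) (G : Type*) [NormedAddCommGroup G]
    [NormedSpace ℝ G] {W : M → Type*} [TopologicalSpace (TotalSpace G W)]
    [∀ x, TopologicalSpace (W x)] [FiberBundle G W] (s : Π x, W x) : Prop :=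
  ContMDiff I (I.prod 𝓘(ℝ, G)) ∞ (fun y ↦ (⟨y, s y⟩ : TotalSpace G W))

theorem isManifold_minSmoothness (k : ℕ) : IsManifold I (minSmoothness ℝ k) M := by
  rw [minSmoothness_of_isRCLikeNormedField]
  exact IsManifold.of_le (n := ∞) (by exact_mod_cast (le_top : (k : ℕ∞) ≤ ⊤))

theorem contMDiff_mvfderiv_apply {f : M → ℝ} (hf : CMDiff ∞ f) {X : Π y : M, TangentSpace I y}
    (hX : SmoothSec I E X) : CMDiff ∞ (fun y ↦ mvfderiv I f y (X y)) := by
  have h1 := (hf.contMDiff_tangentMap (m := ∞) (by simp)).comp hX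
  exact (contMDiff_snd_tangentBundle_modelSpace ℝ 𝓘(ℝ, ℝ)).comp h1

theorem smoothSec_mlieBracket {X Y : Π y : M, TangentSpace I y}
    (hX : SmoothSec I E X) (hY : SmoothSec I E Y) :
    SmoothSec I E (VectorField.mlieBracket I X Y) := by
  have : IsManifold I (minSmoothness ℝ 2) M := isManifold_minSmoothness 2
  have : IsManifold I (((⊤ : ℕ∞) : WithTop ℕ∞) + 1) M := by simpa
  exact ContDiff.mlieBracket_vectorField (m := ⊤) (n := ⊤) hX hY (by simp)

theorem contMDiffAt_two_of_smoothSec {X : Π y : M, TangentSpace I y} (hX : SmoothSec I E X)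
    (x : M) : CMDiffAt (minSmoothness ℝ 2) (T% X) x :=
  (hX x).of_le (by
    simp only [minSmoothness_of_isRCLikeNormedField]
    exact ENat.LEInfty.out)

theorem exists_contMDiff_function_eventuallyEq [T2Space M] {f : M → ℝ} {x : M} {u : Set M}
    (hu : u ∈ 𝓝 x) (hf : CMDiff[u] ∞ f) :
    ∃ g : M → ℝ, CMDiff ∞ g ∧ ∀ᶠ y in 𝓝 x, g y = f y := by
  obtain ⟨t, htu, hto, hxt⟩ := mem_nhds_iff.1 hu
  obtain ⟨ψ, hψt, -⟩ := (SmoothBumpFunction.nhds_basis_support (I := I)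
    (hto.mem_nhds hxt)).mem_iff.1 (hto.mem_nhds hxt)
  refine ⟨fun y ↦ ψ y * f y, contMDiff_of_tsupport fun y hy ↦ ?_, ?_⟩
  · have hy' : y ∈ tsupport ψ :=
      closure_mono (fun z hz ↦ by contrapose! hz; simp_all) hy
    exact ψ.contMDiff.contMDiffAt.mul ((hf.mono htu).contMDiffAt (hto.mem_nhds (hψt hy')))
  · filter_upwards [ψ.eventuallyEq_one] with y hy
    simp [hy]

/-- The Lie bracket of two vector fields is the commutator of the associated derivations. -/
theorem mvfderiv_mlieBracket {f : M → ℝ} (hf : CMDiff ∞ f) {X Y : Π y : M, TangentSpace I y}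
    (hX : SmoothSec I E X) (hY : SmoothSec I E Y) (x : M) (Z : Π y : M, TangentSpace I y)
    (hZ : SmoothSec I E Z) :
    mvfderiv I f x (VectorField.mlieBracket I X Y x) • Z x =
      (mvfderiv I (fun y ↦ mvfderiv I f y (Y y)) x (X x) -
        mvfderiv I (fun y ↦ mvfderiv I f y (X y)) x (Y x)) • Z x := by
  have : IsManifold I (minSmoothness ℝ 3) M := isManifold_minSmoothness 3
  have hfm (y) : MDiffAt f y := (hf y).mdifferentiableAt (by simp)
  have md {X : Π y : M, TangentSpace I y} (hX : SmoothSec I E X) (y : M) : MDiffAt (T% X) y :=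
    (hX y).mdifferentiableAt (by simp)
  have hb {X : Π y : M, TangentSpace I y} (hX : SmoothSec I E X) :
      VectorField.mlieBracket I X (f • Z) =
        (fun y ↦ mvfderiv I f y (X y)) • Z + f • VectorField.mlieBracket I X Z := by
    ext y
    rw [VectorField.mlieBracket_smul_right (hfm y) (md hZ y)]
    simp
  have hd {X : Π y : M, TangentSpace I y} (hX : SmoothSec I E X) (y : M) :
      MDiffAt (fun y ↦ mvfderiv I f y (X y)) y :=
    (contMDiff_mvfderiv_apply hf hX y).mdifferentiableAt (by simp)
  have hXZ := smoothSec_mlieBracket hX hZ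
  have hYZ := smoothSec_mlieBracket hY hZ
  have key {X Y : Π y : M, TangentSpace I y} (hX : SmoothSec I E X) (hY : SmoothSec I E Y) :
      VectorField.mlieBracket I X (VectorField.mlieBracket I Y (f • Z)) x =
        mvfderiv I (fun y ↦ mvfderiv I f y (Y y)) x (X x) • Z x +
        mvfderiv I f x (Y x) • VectorField.mlieBracket I X Z x +
        mvfderiv I f x (X x) • VectorField.mlieBracket I Y Z x +
        f x • VectorField.mlieBracket I X (VectorField.mlieBracket I Y Z) x := by
    have hYZ := smoothSec_mlieBracket hY hZ
    rw [hb hY, VectorField.mlieBracket_add_right ((hd hY x).smul_section (md hZ x))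
      ((hfm x).smul_section (md hYZ x)), VectorField.mlieBracket_smul_right (hd hY x) (md hZ x),
      VectorField.mlieBracket_smul_right (hfm x) (md hYZ x)]
    abel
  have hfZ : SmoothSec I E (f • Z) := hf.smul_section hZ
  have hJ := VectorField.leibniz_identity_mlieBracket_apply (I := I)
    (contMDiffAt_two_of_smoothSec hX x) (contMDiffAt_two_of_smoothSec hY x)
    (contMDiffAt_two_of_smoothSec hfZ x)
  have hJ' := VectorField.leibniz_identity_mlieBracket_apply (I := I)
    (contMDiffAt_two_of_smoothSec hX x) (contMDiffAt_two_of_smoothSec hY x)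
    (contMDiffAt_two_of_smoothSec hZ x)
  rw [key hX hY, key hY hX, hb (smoothSec_mlieBracket hX hY)] at hJ
  simp only [Pi.add_apply, Pi.smul_apply', hJ', smul_add] at hJ
  rw [sub_smul, eq_sub_iff_add_eq, ← sub_eq_zero]
  rw [← sub_eq_zero] at hJ
  rw [← neg_eq_zero, ← hJ]
  abel

theorem mvfderiv_mlieBracket_eq [T2Space M] {f : M → ℝ} (hf : CMDiff ∞ f)
    {X Y : Π y : M, TangentSpace I y} (hX : SmoothSec I E X) (hY : SmoothSec I E Y) (x : M) :
    mvfderiv I f x (VectorField.mlieBracket I X Y x) =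
      mvfderiv I (fun y ↦ mvfderiv I f y (Y y)) x (X x) -
        mvfderiv I (fun y ↦ mvfderiv I f y (X y)) x (Y x) := by
  by_cases h : ∃ v : TangentSpace I x, v ≠ 0
  · obtain ⟨v, hv⟩ := h
    obtain ⟨Z, hZ, hZx, -⟩ := exists_contMDiff_extend (I := I) (F := E)
      (V := fun x : M ↦ TangentSpace I x) x v
    have := mvfderiv_mlieBracket hf hX hY x Z hZ
    rw [hZx] at this
    exact smul_left_injective ℝ hv this
  · push Not at h
    rw [h (VectorField.mlieBracket I X Y x), h (X x), h (Y x)]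
    simp

variable
  {F : Type*} [NormedAddCommGroup F] [NormedSpace ℝ F]
  {V : M → Type*} [TopologicalSpace (TotalSpace F V)]
  [∀ x, AddCommGroup (V x)] [∀ x, Module ℝ (V x)] [∀ x, TopologicalSpace (V x)]
  [∀ x, IsTopologicalAddGroup (V x)] [∀ x, ContinuousSMul ℝ (V x)]
  [FiberBundle F V] [VectorBundle ℝ F V]

theorem SmoothSec.mdiff {s : Π x, V x} (hs : SmoothSec I F s) (x : M) : MDiffSecAt I F s x :=
  (hs x).mdifferentiableAt (by simp)

variable [ContMDiffVectorBundle ∞ F V I]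

theorem smoothSec_cov (c : CovariantDerivative I F V) [c.ContMDiffCovariantDerivative ∞]
    {s : Π x, V x} (hs : SmoothSec I F s) : SmoothSec I (E →L[ℝ] F) (c s) := by
  have h := (CovariantDerivative.ContMDiffCovariantDerivative.contMDiff
    (cov := c) (k := ∞)).contMDiff (σ := s) (by simpa using ContMDiff.contMDiffOn hs)
  exact contMDiffOn_univ.1 h

theorem smoothSec_cov_apply (c : CovariantDerivative I F V) [c.ContMDiffCovariantDerivative ∞]
    {s : Π x, V x} (hs : SmoothSec I F s) {X : Π y : M, TangentSpace I y} (hX : SmoothSec I E X) :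
    SmoothSec I F (fun y ↦ c s y (X y)) :=
  (smoothSec_cov c hs).clm_bundle_apply hX

theorem cov_sub (c : CovariantDerivative I F V) {s t : Π x, V x} {x : M}
    (hs : MDiffSecAt I F s x) (ht : MDiffSecAt I F t x) (u : TangentSpace I x) :
    c (fun y ↦ s y - t y) x u = c s x u - c t x u := by
  have h1 : MDiffSecAt I F ((-1 : ℝ) • t) x := MDifferentiableAt.smul_const_section ht
  have h2 : (fun y ↦ s y - t y) = s + (-1 : ℝ) • t := by ext y; simp [sub_eq_add_neg]
  rw [h2, c.isCovariantDerivativeOn.add hs h1, c.isCovariantDerivativeOn.smul_const _ ht]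
  simp [sub_eq_add_neg]

/-- `∇_X ∇_Y (f s) - ∇_Y ∇_X (f s) - ∇_[X, Y] (f s)` is linear over functions. -/
theorem covExtDerivAux_cov_smul [T2Space M] (c : CovariantDerivative I F V)
    [c.ContMDiffCovariantDerivative ∞] {f : M → ℝ} (hf : CMDiff ∞ f) {s : Π x, V x}
    (hs : SmoothSec I F s) {X Y : Π y : M, TangentSpace I y} (hX : SmoothSec I E X)
    (hY : SmoothSec I E Y) (x : M) :
    covExtDerivAux c (c (fun y ↦ f y • s y)) x X Y = f x • covExtDerivAux c (c s) x X Y := by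
  have hfm (y) : MDiffAt f y := (hf y).mdifferentiableAt (by simp)
  have key {X Y : Π y : M, TangentSpace I y} (hX : SmoothSec I E X) (hY : SmoothSec I E Y) :
      c (fun y ↦ c (fun y ↦ f y • s y) y (Y y)) x (X x) =
        f x • c (fun y ↦ c s y (Y y)) x (X x) + mvfderiv I f x (X x) • c s x (Y x) +
        mvfderiv I f x (Y x) • c s x (X x) +
        mvfderiv I (fun y ↦ mvfderiv I f y (Y y)) x (X x) • s x := by
    have h1 : (fun y ↦ c (fun y ↦ f y • s y) y (Y y)) =
        (fun y ↦ f y • c s y (Y y)) + fun y ↦ mvfderiv I f y (Y y) • s y := by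
      ext y
      exact cov_smul_eq c (hfm y) (hs.mdiff y) (Y y)
    have h2 := smoothSec_cov_apply c hs hY
    have h3 : MDiffAt (fun y ↦ mvfderiv I f y (Y y)) x :=
      (contMDiff_mvfderiv_apply hf hY x).mdifferentiableAt (by simp)
    have h4 := c.isCovariantDerivativeOn.add (σ := fun y ↦ f y • c s y (Y y))
      (σ' := fun y ↦ mvfderiv I f y (Y y) • s y) ((hfm x).smul_section (h2.mdiff x))
      (h3.smul_section (hs.mdiff x))
    rw [h1, h4, add_apply, cov_smul_eq c (hfm x) (h2.mdiff x),
      cov_smul_eq c h3 (hs.mdiff x)]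
    abel
  simp only [covExtDerivAux]
  rw [key hX hY, key hY hX, cov_smul_eq c (hfm x) (hs.mdiff x), mvfderiv_mlieBracket_eq hf hX hY]
  module

variable [FiniteDimensional ℝ F]

theorem covExtDeriv_apply (c : CovariantDerivative I F V)
    {α : Π x : M, TangentSpace I x →L[ℝ] V x} {x : M}
    (hα : MDiffSecAt I (E →L[ℝ] F) α x) {X Y : Π y : M, TangentSpace I y}
    (hX : MDiffSecAt I E X x) (hY : MDiffSecAt I E Y x) :
    covExtDeriv c α x (X x) (Y x) = covExtDerivAux c α x X Y := by
  rw [covExtDeriv, dif_pos hα]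
  exact TensorialAt.mkHom₂_apply (fun Y _ ↦ covExtDerivAux_tensorial c hα Y)
    (fun X _ ↦ covExtDerivAux_tensorial' c hα X) hX hY

variable [T2Space M]

/-- A smooth section that vanishes at a point is near this point a linear combination of smooth
sections with smooth coefficients that vanish at the point. -/
theorem exists_eventually_eq_sum_smul {D : Π x, V x} (hD : SmoothSec I F D) {x : M}
    (hx : D x = 0) :
    ∃ (f : Fin (Module.finrank ℝ F) → M → ℝ) (e : Fin (Module.finrank ℝ F) → Π x, V x),
      (∀ i, CMDiff ∞ (f i)) ∧ (∀ i, SmoothSec I F (e i)) ∧ (∀ i, f i x = 0) ∧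
      ∀ᶠ y in 𝓝 x, D y = ∑ i, f i y • e i y := by
  set t := trivializationAt F V x
  have hxt : x ∈ t.baseSet := FiberBundle.mem_baseSet_trivializationAt F V x
  have htn := t.open_baseSet.mem_nhds hxt
  set b := Module.finBasis ℝ F
  choose f hf hfe using fun i ↦ exists_contMDiff_function_eventuallyEq (I := I) htn
    (contMDiffOn_baseSet_localFrameCoeff (e := t) (k := ∞) (I := I) b
      (s := D) (ContMDiff.contMDiffOn hD) i)
  choose e he hee using fun i ↦ exists_contMDiff_section_eventuallyEq (I := I) htn
    (t.contMDiffOn_localFrame_baseSet (n := ∞) (I := I) b i)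
  refine ⟨f, e, hf, he, fun i ↦ ?_, ?_⟩
  · rw [(hfe i).self_of_nhds]
    simp [hx]
  · filter_upwards [t.eventually_eq_localFrame_sum_coeff_smul (I := I) (s := D) b hxt,
      Filter.eventually_all.2 hfe, Filter.eventually_all.2 hee] with y hy hy' hy''
    rw [hy]
    exact Finset.sum_congr rfl fun i _ ↦ by rw [hy' i, hy'' i]; rfl

theorem covExtDeriv_cov_congr (c : CovariantDerivative I F V) [c.ContMDiffCovariantDerivative ∞]
    {s t : Π x, V x} {x : M} (hs : ∀ᶠ y in 𝓝 x, MDiffSecAt I F s y)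
    (hs' : MDiffSecAt I (E →L[ℝ] F) (c s) x) (ht : SmoothSec I F t)
    (h : ∀ᶠ y in 𝓝 x, s y = t y) : covExtDeriv c (c s) x = covExtDeriv c (c t) x := by
  refine covExtDeriv_congr c hs' ((smoothSec_cov c ht).mdiff x) ?_
  filter_upwards [hs, h.eventually_nhds] with y hy hy'
  exact c.isCovariantDerivativeOnUniv.congr_of_eventuallyEq hy (ht.mdiff y) Filter.univ_mem hy'

theorem covExtDeriv_cov_sum (c : CovariantDerivative I F V) [c.ContMDiffCovariantDerivative ∞]
    {ι : Type*} (A : Finset ι) {s : ι → Π x, V x} (hs : ∀ i, SmoothSec I F (s i)) (x : M) :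
    covExtDeriv c (c (fun y ↦ ∑ i ∈ A, s i y)) x = ∑ i ∈ A, covExtDeriv c (c (s i)) x := by
  classical
  induction A using Finset.induction_on with
  | empty =>
    have h1 : c (fun y ↦ ∑ i ∈ (∅ : Finset ι), s i y) = 0 := by
      simp only [Finset.sum_empty]
      exact c.zero
    have h2 := covExtDeriv_smul c (α := 0) (x := x) (I := I)
      (mdifferentiableAt_zeroSection ℝ (fun x : M ↦ TangentSpace I x →L[ℝ] V x)) 0
    rw [h1, Finset.sum_empty, ← zero_smul ℝ (covExtDeriv c 0 x), ← h2, smul_zero]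
  | insert a A ha ih =>
    have hA : SmoothSec I F (fun y ↦ ∑ i ∈ A, s i y) := ContMDiff.sum_section fun i _ ↦ hs i
    simp only [Finset.sum_insert ha]
    rw [← ih, ← covExtDeriv_add c ((smoothSec_cov c (hs a)).mdiff x) ((smoothSec_cov c hA).mdiff x)]
    congr 1
    ext1 y
    exact c.isCovariantDerivativeOn.add ((hs a).mdiff y) (hA.mdiff y)

theorem covExtDeriv_cov_eq_zero (c : CovariantDerivative I F V)
    [c.ContMDiffCovariantDerivative ∞] {D : Π x, V x} (hD : SmoothSec I F D) {x : M}
    (hx : D x = 0) : covExtDeriv c (c D) x = 0 := by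
  obtain ⟨f, e, hf, he, hfx, h⟩ := exists_eventually_eq_sum_smul hD hx
  have hfe (i) : SmoothSec I F (fun y ↦ f i y • e i y) := (hf i).smul_section (he i)
  rw [covExtDeriv_cov_congr c (.of_forall hD.mdiff) ((smoothSec_cov c hD).mdiff x)
    (ContMDiff.sum_section fun i _ ↦ hfe i) h, covExtDeriv_cov_sum c _ hfe]
  refine Finset.sum_eq_zero fun i _ ↦ ?_
  ext u v
  obtain ⟨X, hX, hXx, -⟩ := exists_contMDiff_extend (I := I) (F := E)
    (V := fun x : M ↦ TangentSpace I x) x u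
  obtain ⟨Y, hY, hYx, -⟩ := exists_contMDiff_extend (I := I) (F := E)
    (V := fun x : M ↦ TangentSpace I x) x v
  rw [← hXx, ← hYx, covExtDeriv_apply c ((smoothSec_cov c (hfe i)).mdiff x) (SmoothSec.mdiff hX x)
    (SmoothSec.mdiff hY x), covExtDerivAux_cov_smul c (hf i) (he i) hX hY, hfx]
  simp

theorem curvature_apply_smooth (c : CovariantDerivative I F V) [c.ContMDiffCovariantDerivative ∞]
    {s : Π x, V x} (hs : SmoothSec I F s) {X Y : Π y : M, TangentSpace I y}
    (hX : SmoothSec I E X) (hY : SmoothSec I E Y) (x : M) :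
    curvature c x (X x) (Y x) (s x) =
      c (fun y ↦ c s y (Y y)) x (X x) - c (fun y ↦ c s y (X y)) x (Y x) -
        c s x (VectorField.mlieBracket I X Y x) := by
  obtain ⟨S, hS, hSx, hSe⟩ := exists_contMDiff_extend (I := I) (F := F) x (s x)
  replace hS : SmoothSec I F S := hS
  have h1 : curvature c x (X x) (Y x) (s x) =
    covExtDeriv c (c (FiberBundle.extend F (s x))) x (X x) (Y x) := rfl
  have h2 := covExtDeriv_cov_congr c (eventually_mdifferentiableAt_extend (I := I) (F := F) (s x))
    (mdifferentiableAt_cov_extend c (s x)) hS (hSe.mono fun y hy ↦ hy.symm)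
  have hD : SmoothSec I F (s + (-1 : ℝ) • S) := hs.add_section (ContMDiff.const_smul_section hS)
  have h3 := covExtDeriv_cov_eq_zero c hD (x := x) (by simp [hSx])
  have h4 : c (s + (-1 : ℝ) • S) = c s + (-1 : ℝ) • c S := by
    ext1 y
    have hS' : MDiffSecAt I F ((-1 : ℝ) • S) y :=
      MDifferentiableAt.smul_const_section (hS.mdiff y)
    rw [c.isCovariantDerivativeOn.add (hs.mdiff y) hS',
      c.isCovariantDerivativeOn.smul_const _ (hS.mdiff y)]
    rfl
  have h5 := (smoothSec_cov c hs).mdiff x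
  have h6 := (smoothSec_cov c hS).mdiff x
  rw [h4, covExtDeriv_add c h5 (MDifferentiableAt.smul_const_section h6),
    covExtDeriv_smul c h6] at h3
  have h7 : covExtDeriv c (c s) x = covExtDeriv c (c S) x := by
    rw [← sub_eq_zero, ← h3]
    module
  rw [h1, h2, ← h7, covExtDeriv_apply c h5 (SmoothSec.mdiff hX x) (SmoothSec.mdiff hY x)]
  rfl

theorem mdiffSecAt_bilin {β : Π x : M, TangentSpace I x →L[ℝ] TangentSpace I x →L[ℝ] V x} {x : M}
    (h : ∀ X Y : Π y : M, TangentSpace I y, SmoothSec I E X → SmoothSec I E Y →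
      MDiffSecAt I F (fun y ↦ β y (X y) (Y y)) x) : MDiffSecAt I (E →L[ℝ] E →L[ℝ] F) β x :=
  mdifferentiableAt_homSec fun X hX ↦ mdifferentiableAt_homSec fun Y hY ↦ h X Y hX hY

set_option maxSynthPendingDepth 3 in
set_option maxHeartbeats 1000000 in
/-- The curvature is a differentiable section. -/
theorem mdiffSecAt_curvature (c : CovariantDerivative I F V) [c.ContMDiffCovariantDerivative ∞]
    (x : M) : MDiffSecAt I (E →L[ℝ] E →L[ℝ] F →L[ℝ] F) (curvature c) x := by
  refine mdiffSecAt_bilin fun X Y hX hY ↦ mdifferentiableAt_homSec fun s hs ↦ ?_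
  simp only [curvature_apply_smooth c hs hX hY]
  have h1 := smoothSec_cov_apply c (smoothSec_cov_apply c hs hY) hX
  have h2 := smoothSec_cov_apply c (smoothSec_cov_apply c hs hX) hY
  have h3 := smoothSec_cov_apply c hs (smoothSec_mlieBracket hX hY)
  exact mdifferentiableAt_sub_section (mdifferentiableAt_sub_section (h1.mdiff x) (h2.mdiff x))
    (h3.mdiff x)

theorem curvature_swap (c : CovariantDerivative I F V) [c.ContMDiffCovariantDerivative ∞]
    (x : M) (u v : TangentSpace I x) (s : V x) :
    curvature c x u v s = - curvature c x v u s := by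
  obtain ⟨X, hX, hXx, -⟩ := exists_contMDiff_extend (I := I) (F := E)
    (V := fun x : M ↦ TangentSpace I x) x u
  obtain ⟨Y, hY, hYx, -⟩ := exists_contMDiff_extend (I := I) (F := E)
    (V := fun x : M ↦ TangentSpace I x) x v
  obtain ⟨S, hS, hSx, -⟩ := exists_contMDiff_extend (I := I) (F := F) x s
  rw [← hXx, ← hYx, ← hSx, curvature_apply_smooth c hS hX hY,
    curvature_apply_smooth c hS hY hX, VectorField.mlieBracket_swap_apply, map_neg]
  abel
end SmoothSections
end GaugeKato

namespace GaugeKato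

section CurvatureIdentities
variable
  {E : Type*} [NormedAddCommGroup E] [NormedSpace ℝ E] [FiniteDimensional ℝ E]
  {H : Type*} [TopologicalSpace H] {I : ModelWithCorners ℝ E H}
  {M : Type*} [TopologicalSpace M] [ChartedSpace H M] [IsManifold I ∞ M] [T2Space M]
  {F : Type*} [NormedAddCommGroup F] [NormedSpace ℝ F] [FiniteDimensional ℝ F]
  {V : M → Type*} [TopologicalSpace (TotalSpace F V)]
  [∀ x, AddCommGroup (V x)] [∀ x, Module ℝ (V x)] [∀ x, TopologicalSpace (V x)]
  [∀ x, IsTopologicalAddGroup (V x)] [∀ x, ContinuousSMul ℝ (V x)]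
  [FiberBundle F V] [VectorBundle ℝ F V] [ContMDiffVectorBundle ∞ F V I]

theorem exists_smooth_vectorField (x : M) (u : TangentSpace I x) :
    ∃ X : Π y : M, TangentSpace I y, SmoothSec I E X ∧ X x = u := by
  obtain ⟨X, hX, hXx, -⟩ := exists_contMDiff_extend (I := I) (F := E)
    (V := fun x : M ↦ TangentSpace I x) x u
  exact ⟨X, hX, hXx⟩

theorem exists_smooth_section (x : M) (v : V x) :
    ∃ s : Π y : M, V y, SmoothSec I F s ∧ s x = v := by
  obtain ⟨X, hX, hXx, -⟩ := exists_contMDiff_extend (I := I) (F := F) x v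
  exact ⟨X, hX, hXx⟩

section HomConnection
variable (c : CovariantDerivative I F V) [c.ContMDiffCovariantDerivative ∞]
  {Φ : Π x : M, V x →L[ℝ] V x}

theorem homConnection_apply_smooth (hΦ : SmoothSec I (F →L[ℝ] F) Φ) {s : Π x, V x}
    (hs : SmoothSec I F s) (x : M) (u : TangentSpace I x) :
    homConnection c c Φ x u (s x) = c (fun y ↦ Φ y (s y)) x u - Φ x (c s x u) :=
  homConnection_apply c c (hΦ.mdiff x) (hs.mdiff x) u

theorem mdiffSecAt_homConnection (hΦ : SmoothSec I (F →L[ℝ] F) Φ) (x : M) :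
    MDiffSecAt I (E →L[ℝ] F →L[ℝ] F) (homConnection c c Φ) x := by
  refine mdifferentiableAt_homSec fun X hX ↦ mdifferentiableAt_homSec fun s hs ↦ ?_
  simp only [homConnection_apply_smooth c hΦ hs]
  have h1 := smoothSec_cov_apply c (hΦ.clm_bundle_apply hs) hX
  have h2 : SmoothSec I F (fun y ↦ Φ y (c s y (X y))) :=
    hΦ.clm_bundle_apply (smoothSec_cov_apply c hs hX)
  exact mdifferentiableAt_sub_section (h1.mdiff x) (h2.mdiff x)

/-- The Ricci identity `d^∇ d^∇ Φ = [F, Φ]`. -/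
theorem covExtDeriv_homConnection (hΦ : SmoothSec I (F →L[ℝ] F) Φ) (x : M)
    (u v : TangentSpace I x) :
    covExtDeriv (homConnection c c) (homConnection c c Φ) x u v =
      curvature c x u v ∘L Φ x - Φ x ∘L curvature c x u v := by
  obtain ⟨X, hX, rfl⟩ := exists_smooth_vectorField x u
  obtain ⟨Y, hY, rfl⟩ := exists_smooth_vectorField x v
  ext s
  obtain ⟨s, hs, rfl⟩ := exists_smooth_section (I := I) (F := F) x s
  have hΦs : SmoothSec I F (fun y ↦ Φ y (s y)) := hΦ.clm_bundle_apply hs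
  have key {X Y : Π y : M, TangentSpace I y} (hX : SmoothSec I E X) (hY : SmoothSec I E Y) :
      homConnection c c (fun y ↦ homConnection c c Φ y (Y y)) x (X x) (s x) =
        c (fun y ↦ c (fun y ↦ Φ y (s y)) y (Y y)) x (X x) -
        c (fun y ↦ Φ y (c s y (Y y))) x (X x) -
        (c (fun y ↦ Φ y (c s y (X y))) x (Y x) -
        Φ x (c (fun y ↦ c s y (X y)) x (Y x))) := by
    have h0 : MDiffSecAt I (F →L[ℝ] F) (fun y ↦ homConnection c c Φ y (Y y)) x :=
      (mdiffSecAt_homConnection c hΦ x).clm_bundle_apply (hY.mdiff x)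
    have hsX := smoothSec_cov_apply c hs hX
    have h1 : SmoothSec I F (fun y ↦ Φ y (c s y (Y y))) :=
      hΦ.clm_bundle_apply (smoothSec_cov_apply c hs hY)
    rw [homConnection_apply c c h0 (hs.mdiff x),
      homConnection_apply_smooth c hΦ hsX]
    simp only [homConnection_apply_smooth c hΦ hs]
    rw [cov_sub c ((smoothSec_cov_apply c hΦs hY).mdiff x) (h1.mdiff x)]
  rw [covExtDeriv_apply _ (mdiffSecAt_homConnection c hΦ x) (hX.mdiff x) (hY.mdiff x)]
  simp only [covExtDerivAux, sub_apply, ContinuousLinearMap.comp_apply]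
  rw [key hX hY, key hY hX, homConnection_apply_smooth c hΦ hs, curvature_apply_smooth c hs hX hY,
    curvature_apply_smooth c hΦs hX hY]
  simp only [map_sub]
  abel

end HomConnection

variable [RiemannianBundle (fun x : M ↦ TangentSpace I x)]
  [IsContMDiffRiemannianBundle I ∞ E (fun x : M ↦ TangentSpace I x)]

theorem leviCivita_sub {X Y : Π y : M, TangentSpace I y} {x : M} (hX : MDiffSecAt I E X x)
    (hY : MDiffSecAt I E Y x) :
    leviCivita I M Y x (X x) - leviCivita I M X x (Y x) = VectorField.mlieBracket I X Y x :=
  (CovariantDerivative.torsion_eq_zero_iff _).1 leviCivita_torsion hX hY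

/-- The exterior derivative of a one-form is its antisymmetrized covariant derivative. -/
theorem covExtDeriv_eq_oneFormConnection (c : CovariantDerivative I F V)
    {α : Π x : M, TangentSpace I x →L[ℝ] V x} {x : M} (hα : MDiffSecAt I (E →L[ℝ] F) α x)
    (u v : TangentSpace I x) :
    covExtDeriv c α x u v = oneFormConnection c α x u v - oneFormConnection c α x v u := by
  obtain ⟨X, hX, rfl⟩ := exists_smooth_vectorField x u
  obtain ⟨Y, hY, rfl⟩ := exists_smooth_vectorField x v
  rw [covExtDeriv_apply c hα (hX.mdiff x) (hY.mdiff x), covExtDerivAux,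
    oneFormConnection_apply c hα (hX.mdiff x), oneFormConnection_apply c hα (hY.mdiff x),
    ← leviCivita_sub (hX.mdiff x) (hY.mdiff x), map_sub]
  abel

set_option maxSynthPendingDepth 3 in
set_option maxHeartbeats 1000000 in
theorem twoFormConnection_curvature_apply (c : CovariantDerivative I F V)
    [c.ContMDiffCovariantDerivative ∞] {X Y Z : Π y : M, TangentSpace I y}
    (hX : SmoothSec I E X) (hY : SmoothSec I E Y) (hZ : SmoothSec I E Z) {s : Π y, V y}
    (hs : SmoothSec I F s) (x : M) :
    twoFormConnection (homConnection c c) (curvature c) x (X x) (Y x) (Z x) (s x) =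
      c (fun y ↦ c (fun y ↦ c s y (Z y)) y (Y y)) x (X x) -
      c (fun y ↦ c (fun y ↦ c s y (Y y)) y (Z y)) x (X x) -
      c (fun y ↦ c s y (VectorField.mlieBracket I Y Z y)) x (X x) -
      (c (fun y ↦ c (fun y ↦ c s y (X y)) y (Z y)) x (Y x) -
      c (fun y ↦ c (fun y ↦ c s y (X y)) y (Y y)) x (Z x) -
      c (fun y ↦ c s y (X y)) x (VectorField.mlieBracket I Y Z x)) -
      curvature c x (Y x) (leviCivita I M Z x (X x)) (s x) +
      curvature c x (Z x) (leviCivita I M Y x (X x)) (s x) := by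
  have h0 : MDiffSecAt I (F →L[ℝ] F) (fun y ↦ curvature c y (Y y) (Z y)) x :=
    ((mdiffSecAt_curvature c x).clm_bundle_apply (hY.mdiff x)).clm_bundle_apply (hZ.mdiff x)
  have hsX := smoothSec_cov_apply c hs hX
  have h1 := smoothSec_cov_apply c (smoothSec_cov_apply c hs hY) hZ
  have h2 := smoothSec_cov_apply c (smoothSec_cov_apply c hs hZ) hY
  have h3 := smoothSec_cov_apply c hs (smoothSec_mlieBracket hY hZ)
  have h4 : MDiffSecAt I F (fun y ↦ c (fun y ↦ c s y (Z y)) y (Y y) -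
      c (fun y ↦ c s y (Y y)) y (Z y)) x :=
    mdifferentiableAt_sub_section (h2.mdiff x) (h1.mdiff x)
  have h5 := twoFormConnection_apply (homConnection c c) (mdiffSecAt_curvature c x)
    (hY.mdiff x) (hZ.mdiff x) (X x)
  rw [h5, sub_apply, sub_apply, homConnection_apply c c h0 (hs.mdiff x),
    curvature_apply_smooth c hsX hY hZ, curvature_swap c x (leviCivita I M Y x (X x))]
  simp only [curvature_apply_smooth c hs hY hZ]
  rw [cov_sub c h4 (h3.mdiff x), cov_sub c (h2.mdiff x) (h1.mdiff x)]
  abel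

/-- The Bianchi identity. -/
theorem bianchi (c : CovariantDerivative I F V) [c.ContMDiffCovariantDerivative ∞] (x : M)
    (u v w : TangentSpace I x) :
    twoFormConnection (homConnection c c) (curvature c) x u v w +
      twoFormConnection (homConnection c c) (curvature c) x v w u +
      twoFormConnection (homConnection c c) (curvature c) x w u v = 0 := by
  obtain ⟨X, hX, rfl⟩ := exists_smooth_vectorField x u
  obtain ⟨Y, hY, rfl⟩ := exists_smooth_vectorField x v
  obtain ⟨Z, hZ, rfl⟩ := exists_smooth_vectorField x w
  ext s
  obtain ⟨s, hs, rfl⟩ := exists_smooth_section (I := I) (F := F) x s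
  rw [add_apply, add_apply, twoFormConnection_curvature_apply c hX hY hZ hs,
    twoFormConnection_curvature_apply c hY hZ hX hs,
    twoFormConnection_curvature_apply c hZ hX hY hs]
  have : IsManifold I (minSmoothness ℝ 3) M := isManifold_minSmoothness 3
  have hJ := VectorField.leibniz_identity_mlieBracket_apply (I := I)
    (contMDiffAt_two_of_smoothSec hX x) (contMDiffAt_two_of_smoothSec hY x)
    (contMDiffAt_two_of_smoothSec hZ x)
  have key {X Y Z : Π y : M, TangentSpace I y} (hX : SmoothSec I E X) (hY : SmoothSec I E Y)
      (hZ : SmoothSec I E Z) :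
      c (fun y ↦ c s y (VectorField.mlieBracket I Y Z y)) x (X x) =
        curvature c x (X x) (leviCivita I M Z x (Y x)) (s x) -
        curvature c x (X x) (leviCivita I M Y x (Z x)) (s x) +
        c (fun y ↦ c s y (X y)) x (VectorField.mlieBracket I Y Z x) +
        c s x (VectorField.mlieBracket I X (VectorField.mlieBracket I Y Z) x) := by
    have h := curvature_apply_smooth c hs hX (smoothSec_mlieBracket hY hZ) x
    rw [← leviCivita_sub (hY.mdiff x) (hZ.mdiff x), map_sub, sub_apply,
      leviCivita_sub (hY.mdiff x) (hZ.mdiff x)] at h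
    rw [h]
    abel
  have hJ2 : c s x (VectorField.mlieBracket I X (VectorField.mlieBracket I Y Z) x) +
      c s x (VectorField.mlieBracket I Y (VectorField.mlieBracket I Z X) x) +
      c s x (VectorField.mlieBracket I Z (VectorField.mlieBracket I X Y) x) = 0 := by
    have h1 : VectorField.mlieBracket I Z X = - VectorField.mlieBracket I X Z :=
      VectorField.mlieBracket_swap
    rw [hJ, VectorField.mlieBracket_swap_apply (V := Z), h1, ← map_add, ← map_add]
    have h2 : VectorField.mlieBracket I Y (-VectorField.mlieBracket I X Z) x =
        - VectorField.mlieBracket I Y (VectorField.mlieBracket I X Z) x := by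
      have := VectorField.mlieBracket_const_smul_right (I := I) (c := (-1 : ℝ)) (V := Y) (x := x)
        ((smoothSec_mlieBracket hX hZ).mdiff x)
      simpa using this
    rw [h2]
    convert (c s x).map_zero using 2
    abel
  rw [key hX hY hZ, key hY hZ hX, key hZ hX hY, zero_apply, ← neg_eq_zero, ← hJ2]
  abel

end CurvatureIdentities
end GaugeKato

namespace GaugeKato

section Kato
variable {n : ℕ} {M : Type*} [TopologicalSpace M]
  [ChartedSpace (EuclideanSpace ℝ (Fin n)) M] [IsManifold (𝓡 n) ∞ M]
  {G : Type*} [NormedAddCommGroup G] [NormedSpace ℝ G]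
  {W : M → Type*} [TopologicalSpace (TotalSpace G W)]
  [∀ x, AddCommGroup (W x)] [∀ x, Module ℝ (W x)] [∀ x, TopologicalSpace (W x)]
  [∀ x, IsTopologicalAddGroup (W x)] [∀ x, ContinuousSMul ℝ (W x)]
  [FiberBundle G W] [VectorBundle ℝ G W]

theorem mvfderiv_eq_zero_of_nonneg {N : M → ℝ} (hN : ∀ y, 0 ≤ N y) {x : M} (hx : N x = 0) :
    mvfderiv (𝓡 n) N x = 0 := by
  have h : mfderiv (𝓡 n) 𝓘(ℝ, ℝ) N x = 0 := by
    by_cases hd : MDifferentiableAt (𝓡 n) 𝓘(ℝ, ℝ) N x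
    · have h1 : fderivWithin ℝ (writtenInExtChartAt (𝓡 n) 𝓘(ℝ, ℝ) x N) (Set.range (𝓡 n))
          (extChartAt (𝓡 n) x x) = 0 := by
        rw [modelWithCornersSelf_coe, Set.range_id, fderivWithin_univ]
        refine IsLocalMin.fderiv_eq_zero (.of_forall fun y ↦ ?_)
        simpa [writtenInExtChartAt, chartAt_self_eq, hx] using hN _
      exact hd.mfderiv.trans h1
    · exact mfderiv_zero_of_not_mdifferentiableAt hd
  ext u
  exact congr($h u)

theorem IsParallelMetric.smul {c : CovariantDerivative (𝓡 n) G W}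
    {g : Π x, W x →ₗ[ℝ] W x →ₗ[ℝ] ℝ} (hg : IsParallelMetric c g) {k : ℝ} (hk : 0 < k) :
    IsParallelMetric c (fun x ↦ k • g x) where
  symm x s t := by simp [hg.symm x s t]
  pos x s hs := by simpa using mul_pos hk (hg.pos x s hs)
  mdifferentiableAt hs ht := mdifferentiableAt_const.mul (hg.mdifferentiableAt hs ht)
  mvfderiv_eq {x s t} hs ht u := by
    have h := mvfderiv_fun_mul (f := fun _ : M ↦ k) (x := x) mdifferentiableAt_const
      (hg.mdifferentiableAt hs ht)
    simp only [LinearMap.smul_apply, smul_eq_mul]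
    rw [h]
    simp [mvfderiv_const, hg.mvfderiv_eq hs ht, mul_add]

theorem sq_le_mul_of_pos {V : Type*} [AddCommGroup V] [Module ℝ V] {g : V →ₗ[ℝ] V →ₗ[ℝ] ℝ}
    (hs : ∀ s t, g s t = g t s) (hp : ∀ s, s ≠ 0 → 0 < g s s) (s t : V) :
    g s t ^ 2 ≤ g s s * g t t := by
  rcases eq_or_ne t 0 with rfl | ht
  · simp
  have h0 (s : V) : 0 ≤ g s s := by
    rcases eq_or_ne s 0 with rfl | h
    · simp
    · exact (hp s h).le
  have h1 := h0 (g t t • s - g s t • t)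
  simp only [map_sub, map_smul, LinearMap.sub_apply, LinearMap.smul_apply, smul_eq_mul,
    hs t s] at h1
  have h2 : 0 ≤ g t t * (g s s * g t t - g s t ^ 2) := by linarith
  linarith [nonneg_of_mul_nonneg_right h2 (hp t ht)]

variable {c : CovariantDerivative (𝓡 n) G W} {g : Π x, W x →ₗ[ℝ] W x →ₗ[ℝ] ℝ}

theorem IsParallelMetric.mdifferentiableAt_norm (hg : IsParallelMetric c g) {β : Π x, W x} {x : M}
    (hβ : MDiffSecAt (𝓡 n) G β x) (hx : β x ≠ 0) :
    MDifferentiableAt (𝓡 n) 𝓘(ℝ, ℝ) (fun y ↦ √(g y (β y) (β y))) x :=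
  DifferentiableAt.comp_mdifferentiableAt (I := 𝓡 n) (g := Real.sqrt)
    (f := fun y ↦ g y (β y) (β y)) (Real.hasDerivAt_sqrt (hg.pos x _ hx).ne').differentiableAt
    (hg.mdifferentiableAt hβ hβ)

/-- The Kato inequality `|d|β|(u)| ≤ |∇_u β|`. -/
theorem IsParallelMetric.sq_mvfderiv_norm_le (hg : IsParallelMetric c g) {β : Π x, W x} {x : M}
    (hβ : MDiffSecAt (𝓡 n) G β x)
    (hN : MDifferentiableAt (𝓡 n) 𝓘(ℝ, ℝ) (fun y ↦ √(g y (β y) (β y))) x)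
    (u : TangentSpace (𝓡 n) x) :
    mvfderiv (𝓡 n) (fun y ↦ √(g y (β y) (β y))) x u ^ 2 ≤ g x (c β x u) (c β x u) := by
  have h0 (y : M) (s : W y) : 0 ≤ g y s s := by
    rcases eq_or_ne s 0 with rfl | h
    · simp
    · exact (hg.pos y s h).le
  rcases eq_or_ne (β x) 0 with hx | hx
  · rw [mvfderiv_eq_zero_of_nonneg (fun y ↦ Real.sqrt_nonneg _) (by simp [hx])]
    simpa using h0 x (c β x u)
  have h1 := mvfderiv_fun_mul hN hN
  simp only [Real.mul_self_sqrt (h0 _ _)] at h1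
  have h2 := congr($h1 u)
  rw [hg.mvfderiv_eq hβ hβ, hg.symm x (β x)] at h2
  simp only [add_apply, smul_apply, smul_eq_mul] at h2
  set N := √(g x (β x) (β x))
  set d := mvfderiv (𝓡 n) (fun y ↦ √(g y (β y) (β y))) x u
  have h3 : N * d = g x (c β x u) (β x) := by linarith
  have h4 := sq_le_mul_of_pos (hg.symm x) (hg.pos x) (c β x u) (β x)
  have h5 : N ^ 2 = g x (β x) (β x) := Real.sq_sqrt (h0 _ _)
  rw [← h3, ← h5, mul_pow, mul_comm] at h4
  exact le_of_mul_le_mul_right h4 (by rw [h5]; exact hg.pos x _ hx)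

/-- A linear form on a Euclidean space is concentrated on one vector of some orthonormal basis. -/
theorem exists_orthonormalBasis_frobSq_eq {T : Type*} [NormedAddCommGroup T]
    [InnerProductSpace ℝ T] [FiniteDimensional ℝ T] (hT : Module.finrank ℝ T = n) (i₀ : Fin n)
    (φ : T →L[ℝ] ℝ) :
    ∃ b : OrthonormalBasis (Fin n) ℝ T, frobSq (· ^ 2) φ = φ (b i₀) ^ 2 := by
  obtain ⟨w, rfl⟩ := (InnerProductSpace.toDual ℝ T).surjective φ
  obtain ⟨b, r, hb⟩ : ∃ (b : OrthonormalBasis (Fin n) ℝ T) (r : ℝ), w = r • b i₀ := by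
    rcases eq_or_ne w 0 with rfl | hw
    · exact ⟨(stdOrthonormalBasis ℝ T).reindex (finCongr hT), 0, by simp⟩
    · obtain ⟨b, hb⟩ := Orthonormal.exists_orthonormalBasis_extension_of_card_eq (𝕜 := ℝ)
        (v := fun _ : Fin n ↦ ‖w‖⁻¹ • w) (s := {i₀}) (by simpa using hT)
        ⟨fun i ↦ by simp [norm_smul, hw], fun i j hij ↦ (hij (Subsingleton.elim i j)).elim⟩
      exact ⟨b, ‖w‖, by rw [hb i₀ rfl, smul_inv_smul₀ (norm_ne_zero_iff.2 hw)]⟩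
  refine ⟨b, ?_⟩
  have h1 : frobSq (· ^ 2) (InnerProductSpace.toDual ℝ T w) =
      homForm T (LinearMap.mul ℝ ℝ) (InnerProductSpace.toDual ℝ T w)
        (InnerProductSpace.toDual ℝ T w) := by
    rw [← frobSq_eq_homForm]
    simp [frobSq, sq]
  rw [h1, homForm_apply b, Finset.sum_eq_single i₀]
  · simp [sq]
  · intro i _ hi
    simp [hb, b.inner_eq_zero hi.symm]
  · simp

theorem IsParallelMetric.exists_orthonormalBasis
    [RiemannianBundle (fun x : M ↦ TangentSpace (𝓡 n) x)]
    [IsContMDiffRiemannianBundle (𝓡 n) ∞ (EuclideanSpace ℝ (Fin n))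
      (fun x : M ↦ TangentSpace (𝓡 n) x)]
    (hg : IsParallelMetric c g) {β : Π x, W x} {x : M}
    (hβ : MDiffSecAt (𝓡 n) G β x)
    (hN : MDifferentiableAt (𝓡 n) 𝓘(ℝ, ℝ) (fun y ↦ √(g y (β y) (β y))) x) (i₀ : Fin n) :
    ∃ b : OrthonormalBasis (Fin n) ℝ (TangentSpace (𝓡 n) x),
      frobSq (· ^ 2) (mvfderiv (𝓡 n) (fun y ↦ √(g y (β y) (β y))) x) ≤
        g x (c β x (b i₀)) (c β x (b i₀)) := by
  obtain ⟨b, hb⟩ := exists_orthonormalBasis_frobSq_eq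
    (fact_finrank_tangentSpace (n := n) x).out i₀
    (mvfderiv (𝓡 n) (fun y ↦ √(g y (β y) (β y))) x)
  exact ⟨b, hb.trans_le (hg.sq_mvfderiv_norm_le hβ hN (b i₀))⟩

end Kato
end GaugeKato

namespace GaugeKato

section PointwiseAlgebra
variable {T : Type*} [NormedAddCommGroup T] [InnerProductSpace ℝ T] [FiniteDimensional ℝ T]
  {W : Type*} [AddCommGroup W] [Module ℝ W] [TopologicalSpace W]
  [IsTopologicalAddGroup W] [ContinuousSMul ℝ W]

section Bilinear
variable {g : W →ₗ[ℝ] W →ₗ[ℝ] ℝ}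

theorem form_nonneg (hp : ∀ s, s ≠ 0 → 0 < g s s) (s : W) : 0 ≤ g s s := by
  rcases eq_or_ne s 0 with rfl | h
  · simp
  · exact (hp s h).le

theorem form_sub_le (hs : ∀ s t, g s t = g t s) (hp : ∀ s, s ≠ 0 → 0 < g s s) (s t : W) :
    g (s - t) (s - t) ≤ 2 * (g s s + g t t) := by
  have h := form_nonneg hp (s + t)
  simp only [map_sub, map_add, LinearMap.sub_apply, LinearMap.add_apply, hs t s] at h ⊢
  linarith

theorem form_weighted_le (hs : ∀ s t, g s t = g t s) (hp : ∀ s, s ≠ 0 → 0 < g s s) {a : ℝ}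
    (ha : 0 < a) (s t : W) :
    a / (1 + a) * g s s - a * g (s - t) (s - t) ≤ g t t := by
  have h := form_nonneg hp (a • s - (1 + a) • t)
  simp only [map_sub, map_smul, LinearMap.sub_apply, LinearMap.smul_apply, smul_eq_mul,
    hs t s] at h ⊢
  have h1 : a / (1 + a) * g s s - a * (g s s - g s t - (g s t - g t t)) - g t t =
      - ((a * (a * g s s - (1 + a) * g s t) - (1 + a) * (a * g s t - (1 + a) * g t t)) /
        (1 + a)) := by
    field_simp
    ring
  have h2 := div_nonneg h (by positivity : 0 ≤ 1 + a)
  linarith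

end Bilinear

theorem sign_mul_volumeForm {n : ℕ} [Fact (Module.finrank ℝ T = n)] (o : Orientation ℝ T (Fin n))
    (b : OrthonormalBasis (Fin n) ℝ T) {ε : ℝ} (hε : ε = 1 ∨ ε = -1) :
    ε * o.volumeForm b = 1 ∨ ε * o.volumeForm b = -1 := by
  have h := o.abs_volumeForm_apply_of_orthonormal b
  rcases hε with rfl | rfl <;> rcases (abs_eq one_pos.le).1 h with h | h <;> simp [h]

section Four
variable [Fact (Module.finrank ℝ T = 4)] (o : Orientation ℝ T (Fin 4))
  (b : OrthonormalBasis (Fin 4) ℝ T)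

theorem hodgeStarFour_basis {β : T →L[ℝ] T →L[ℝ] W} (hβ : ∀ u v, β u v = - β v u) :
    hodgeStarFour o β (b 0) (b 1) = o.volumeForm b • β (b 2) (b 3) ∧
    hodgeStarFour o β (b 0) (b 2) = - o.volumeForm b • β (b 1) (b 3) ∧
    hodgeStarFour o β (b 0) (b 3) = o.volumeForm b • β (b 1) (b 2) ∧
    hodgeStarFour o β (b 1) (b 2) = o.volumeForm b • β (b 0) (b 3) ∧
    hodgeStarFour o β (b 1) (b 3) = - o.volumeForm b • β (b 0) (b 2) ∧
    hodgeStarFour o β (b 2) (b 3) = o.volumeForm b • β (b 0) (b 1) := by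
  have key (f f' : Fin 4 → Fin 4) (h1 : ∀ i, f' (f i) = i) (h2 : ∀ i, f (f' i) = i) {k : ℤ}
      (hk : (Equiv.Perm.sign (⟨f, f', h1, h2⟩ : Equiv.Perm (Fin 4)) : ℤ) = k) :
      hodgeStarFour o β (b (f 2)) (b (f 3)) = (k : ℝ) • o.volumeForm b • β (b (f 0)) (b (f 1)) :=
    hk ▸ hodgeStarFour_perm o b hβ ⟨f, f', h1, h2⟩
  refine ⟨?_, ?_, ?_, ?_, ?_, ?_⟩
  · simpa using key ![2, 3, 0, 1] ![2, 3, 0, 1] (by decide) (by decide) (k := 1) (by decide)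
  · simpa using key ![1, 3, 0, 2] ![2, 0, 3, 1] (by decide) (by decide) (k := -1) (by decide)
  · simpa using key ![1, 2, 0, 3] ![2, 0, 1, 3] (by decide) (by decide) (k := 1) (by decide)
  · simpa using key ![0, 3, 1, 2] ![0, 2, 3, 1] (by decide) (by decide) (k := 1) (by decide)
  · simpa using key ![0, 2, 1, 3] ![0, 2, 1, 3] (by decide) (by decide) (k := -1) (by decide)
  · simpa using key ![0, 1, 2, 3] ![0, 1, 2, 3] (by decide) (by decide) (k := 1) (by decide)

theorem hodgeStarFour_swap (β : T →L[ℝ] T →L[ℝ] W) (u v : T) :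
    hodgeStarFour o β u v = - hodgeStarFour o β v u := by
  have h (x y : T) : o.volumeForm ![x, y, u, v] = - o.volumeForm ![x, y, v, u] := by
    have := o.volumeForm.map_swap ![x, y, v, u] (i := 2) (j := 3) (by decide)
    rw [← this]
    congr 1
    ext i
    fin_cases i <;> rfl
  rw [hodgeStarFour_apply o (stdOrthonormalBasis ℝ T |>.reindex (finCongr Fact.out)) β u v,
    hodgeStarFour_apply o (stdOrthonormalBasis ℝ T |>.reindex (finCongr Fact.out)) β v u]
  simp only [h, neg_smul, Finset.sum_neg_distrib, smul_neg]

/-- The squared norm of a self-dual or anti-self-dual two-form. -/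
theorem homForm_homForm_dual (g : W →ₗ[ℝ] W →ₗ[ℝ] ℝ) {β : T →L[ℝ] T →L[ℝ] W} {s : ℝ}
    (hs : s = 1 ∨ s = -1) (hβ : ∀ u v, β u v = - β v u)
    (h12 : β (b 1) (b 2) = s • β (b 0) (b 3)) (h13 : β (b 1) (b 3) = - s • β (b 0) (b 2))
    (h23 : β (b 2) (b 3) = s • β (b 0) (b 1)) :
    homForm T (homForm T g) β β =
      4 * (g (β (b 0) (b 1)) (β (b 0) (b 1)) + g (β (b 0) (b 2)) (β (b 0) (b 2)) +
        g (β (b 0) (b 3)) (β (b 0) (b 3))) := by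
  have h0 (u : T) : β u u = 0 := by
    have := hβ u u
    rwa [eq_neg_iff_add_eq_zero, ← two_smul ℝ, smul_eq_zero_iff_right two_ne_zero] at this
  simp only [homForm_apply b, Fin.sum_univ_four, h0, hβ (b 1) (b 0), hβ (b 2) (b 0),
    hβ (b 2) (b 1), hβ (b 3) (b 0), hβ (b 3) (b 1), hβ (b 3) (b 2), h12, h13, h23]
  rcases hs with rfl | rfl <;> simp <;> ring

/-- The refined Kato inequality for the covariant derivative `D` of a Yang-Mills field. -/
theorem refined_kato_four {g : W →ₗ[ℝ] W →ₗ[ℝ] ℝ} (hs : ∀ s t, g s t = g t s)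
    (hp : ∀ s, s ≠ 0 → 0 < g s s) {D : T →L[ℝ] T →L[ℝ] T →L[ℝ] W}
    (hD : ∀ u v w, D u v w = - D u w v) (hdiv : ∑ i, D (b i) (b i) = 0)
    (hcyc : ∀ u v w, D u v w + D v w u + D w u v = 0) {ε : ℝ} (hε : ε = 1 ∨ ε = -1)
    {B : T → T →L[ℝ] T →L[ℝ] W} (hB : ∀ u, B u = dualPart o ε (D u)) :
    3 / 2 * homForm T (homForm T g) (B (b 0)) (B (b 0)) ≤
      ∑ i, homForm T (homForm T g) (B (b i)) (B (b i)) := by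
  set s := ε * o.volumeForm b with hs_def
  have hs1 : s = 1 ∨ s = -1 := sign_mul_volumeForm o b hε
  have hBapp (u v w : T) : B u v w = (1 / 2 : ℝ) • (D u v w + ε • hodgeStarFour o (D u) v w) := by
    rw [hB]; rfl
  have hBs (u v w : T) : B u v w = - B u w v := by
    rw [hBapp, hBapp, hD, hodgeStarFour_swap]
    module
  have hD0 (u v : T) : D u v v = 0 := by
    have := hD u v v
    rwa [eq_neg_iff_add_eq_zero, ← two_smul ℝ, smul_eq_zero_iff_right two_ne_zero] at this
  have hcomp (u : T) :
      B u (b 0) (b 1) = (1 / 2 : ℝ) • (D u (b 0) (b 1) + s • D u (b 2) (b 3)) ∧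
      B u (b 0) (b 2) = (1 / 2 : ℝ) • (D u (b 0) (b 2) - s • D u (b 1) (b 3)) ∧
      B u (b 0) (b 3) = (1 / 2 : ℝ) • (D u (b 0) (b 3) + s • D u (b 1) (b 2)) ∧
      B u (b 1) (b 2) = (1 / 2 : ℝ) • (D u (b 1) (b 2) + s • D u (b 0) (b 3)) ∧
      B u (b 1) (b 3) = (1 / 2 : ℝ) • (D u (b 1) (b 3) - s • D u (b 0) (b 2)) ∧
      B u (b 2) (b 3) = (1 / 2 : ℝ) • (D u (b 2) (b 3) + s • D u (b 0) (b 1)) := by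
    obtain ⟨h1, h2, h3, h4, h5, h6⟩ := hodgeStarFour_basis o b (hD u)
    simp only [hBapp, h1, h2, h3, h4, h5, h6, hs_def]
    refine ⟨?_, ?_, ?_, ?_, ?_, ?_⟩ <;> module
  have hnorm (u : T) := by
    obtain ⟨h1, h2, h3, h4, h5, h6⟩ := hcomp u
    refine homForm_homForm_dual b g (β := B u) hs1 (hBs u) ?_ ?_ ?_
    · rw [h4, h3]
      rcases hs1 with h | h <;> rw [h] <;> module
    · rw [h5, h2]
      rcases hs1 with h | h <;> rw [h] <;> module
    · rw [h6, h1]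
      rcases hs1 with h | h <;> rw [h] <;> module
  have hdiv' (j : Fin 4) : D (b 0) (b 0) (b j) + D (b 1) (b 1) (b j) + D (b 2) (b 2) (b j) +
      D (b 3) (b 3) (b j) = 0 := by
    simpa [Fin.sum_univ_four] using congr($hdiv (b j))
  have e1 : B (b 0) (b 0) (b 1) = s • (B (b 2) (b 0) (b 3) - B (b 3) (b 0) (b 2)) := by
    have h1 := hdiv' 1
    have h2 := hcyc (b 0) (b 2) (b 3)
    rw [hD0, hD _ (b 2) (b 1), hD _ (b 3) (b 1)] at h1
    rw [hD (b 2) (b 3) (b 0)] at h2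
    rw [(hcomp _).1, (hcomp _).2.2.1, (hcomp _).2.1]
    rcases hs1 with h | h <;> rw [h]
    · linear_combination (norm := module) (1 / 2 : ℝ) • h1 + (1 / 2 : ℝ) • h2
    · linear_combination (norm := module) (1 / 2 : ℝ) • h1 - (1 / 2 : ℝ) • h2
  have e2 : B (b 0) (b 0) (b 2) = s • (B (b 3) (b 0) (b 1) - B (b 1) (b 0) (b 3)) := by
    have h1 := hdiv' 2
    have h2 := hcyc (b 0) (b 1) (b 3)
    rw [hD0, hD _ (b 3) (b 2)] at h1
    rw [hD (b 1) (b 3) (b 0)] at h2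
    rw [(hcomp _).2.1, (hcomp _).2.2.1, (hcomp _).1]
    rcases hs1 with h | h <;> rw [h]
    · linear_combination (norm := module) (1 / 2 : ℝ) • h1 - (1 / 2 : ℝ) • h2
    · linear_combination (norm := module) (1 / 2 : ℝ) • h1 + (1 / 2 : ℝ) • h2
  have e3 : B (b 0) (b 0) (b 3) = s • (B (b 1) (b 0) (b 2) - B (b 2) (b 0) (b 1)) := by
    have h1 := hdiv' 3
    have h2 := hcyc (b 0) (b 1) (b 2)
    rw [hD0] at h1
    rw [hD (b 1) (b 2) (b 0)] at h2
    rw [(hcomp _).2.2.1, (hcomp _).2.1, (hcomp _).1]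
    rcases hs1 with h | h <;> rw [h]
    · linear_combination (norm := module) (1 / 2 : ℝ) • h1 + (1 / 2 : ℝ) • h2
    · linear_combination (norm := module) (1 / 2 : ℝ) • h1 - (1 / 2 : ℝ) • h2
  have hsq (w w' : W) : g (s • (w - w')) (s • (w - w')) ≤ 2 * (g w w + g w' w') := by
    refine le_trans (le_of_eq ?_) (form_sub_le hs hp w w')
    rcases hs1 with h | h
    · simp [h]
    · simp [h]
      ring
  have f1 := hsq (B (b 2) (b 0) (b 3)) (B (b 3) (b 0) (b 2))
  have f2 := hsq (B (b 3) (b 0) (b 1)) (B (b 1) (b 0) (b 3))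
  have f3 := hsq (B (b 1) (b 0) (b 2)) (B (b 2) (b 0) (b 1))
  rw [← e1] at f1
  rw [← e2] at f2
  rw [← e3] at f3
  simp only [Fin.sum_univ_four, hnorm]
  linarith [form_nonneg hp (B (b 1) (b 0) (b 1)), form_nonneg hp (B (b 2) (b 0) (b 2)),
    form_nonneg hp (B (b 3) (b 0) (b 3))]

end Four

section Three
variable [Fact (Module.finrank ℝ T = 3)] (o : Orientation ℝ T (Fin 3))
  (b : OrthonormalBasis (Fin 3) ℝ T)

theorem hodgeStarThree_basis {β : T →L[ℝ] T →L[ℝ] W} (hβ : ∀ u v, β u v = - β v u) :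
    hodgeStarThree o β (b 0) = o.volumeForm b • β (b 1) (b 2) ∧
    hodgeStarThree o β (b 1) = o.volumeForm b • β (b 2) (b 0) ∧
    hodgeStarThree o β (b 2) = o.volumeForm b • β (b 0) (b 1) := by
  have key (f f' : Fin 3 → Fin 3) (h1 : ∀ i, f' (f i) = i) (h2 : ∀ i, f (f' i) = i) {k : ℤ}
      (hk : (Equiv.Perm.sign (⟨f, f', h1, h2⟩ : Equiv.Perm (Fin 3)) : ℤ) = k) :
      hodgeStarThree o β (b (f 2)) = (k : ℝ) • o.volumeForm b • β (b (f 0)) (b (f 1)) :=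
    hk ▸ hodgeStarThree_perm o b hβ ⟨f, f', h1, h2⟩
  refine ⟨?_, ?_, ?_⟩
  · simpa using key ![1, 2, 0] ![2, 0, 1] (by decide) (by decide) (k := 1) (by decide)
  · simpa using key ![2, 0, 1] ![1, 2, 0] (by decide) (by decide) (k := 1) (by decide)
  · simpa using key ![0, 1, 2] ![0, 1, 2] (by decide) (by decide) (k := 1) (by decide)

/-- The squared norm of an antisymmetric bilinear form in dimension three. -/
theorem homForm_homForm_three (g : W →ₗ[ℝ] W →ₗ[ℝ] ℝ) {β : T →L[ℝ] T →L[ℝ] W}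
    (hβ : ∀ u v, β u v = - β v u) :
    homForm T (homForm T g) β β =
      2 * (g (β (b 0) (b 1)) (β (b 0) (b 1)) + g (β (b 0) (b 2)) (β (b 0) (b 2)) +
        g (β (b 1) (b 2)) (β (b 1) (b 2))) := by
  have h0 (u : T) : β u u = 0 := by
    have := hβ u u
    rwa [eq_neg_iff_add_eq_zero, ← two_smul ℝ, smul_eq_zero_iff_right two_ne_zero] at this
  simp only [homForm_apply b, Fin.sum_univ_three, h0, hβ (b 1) (b 0), hβ (b 2) (b 0),
    hβ (b 2) (b 1)]
  simp
  ring

/-- The refined Kato inequality for a one-form with covariant derivative `t` that is divergence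
free and has exterior derivative `d`. -/
theorem refined_kato_three {g : W →ₗ[ℝ] W →ₗ[ℝ] ℝ} (hs : ∀ s t, g s t = g t s)
    (hp : ∀ s, s ≠ 0 → 0 < g s s) {t d : T →L[ℝ] T →L[ℝ] W}
    (hd : ∀ u v, d u v = t u v - t v u) (hdiv : ∑ i, t (b i) (b i) = 0) {a : ℝ} (ha : 0 < a) :
    (1 + min (1 / 2) (a / (1 + a))) * homForm T g (t (b 0)) (t (b 0)) -
      a * (1 / 2 * homForm T (homForm T g) d d) ≤ homForm T (homForm T g) t t := by
  rw [homForm_homForm_three b g (fun u v ↦ by rw [hd, hd]; abel)]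
  simp only [homForm_apply b, Fin.sum_univ_three] at hdiv ⊢
  set κ := min (1 / 2) (a / (1 + a))
  have e0 : t (b 0) (b 0) = -t (b 1) (b 1) - t (b 2) (b 2) := by
    linear_combination (norm := module) hdiv
  have h0 := form_sub_le hs hp (-t (b 1) (b 1)) (t (b 2) (b 2))
  rw [← e0] at h0
  simp only [map_neg, LinearMap.neg_apply, neg_neg] at h0
  have h1 := form_weighted_le hs hp ha (t (b 0) (b 1)) (t (b 1) (b 0))
  have h2 := form_weighted_le hs hp ha (t (b 0) (b 2)) (t (b 2) (b 0))
  rw [← hd] at h1 h2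
  have hk1 : κ ≤ 1 / 2 := min_le_left _ _
  have hk2 : κ ≤ a / (1 + a) := min_le_right _ _
  have n (u v : T) := form_nonneg hp (t u v)
  have m0 := mul_le_mul_of_nonneg_right hk1 (n (b 0) (b 0))
  have m1 := mul_le_mul_of_nonneg_right hk2 (n (b 0) (b 1))
  have m2 := mul_le_mul_of_nonneg_right hk2 (n (b 0) (b 2))
  have m3 := mul_nonneg ha.le (form_nonneg hp (d (b 1) (b 2)))
  linarith [n (b 1) (b 2), n (b 2) (b 1)]

end Three
end PointwiseAlgebra
end GaugeKato

namespace GaugeKato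

theorem sum_clm_orthonormalBasis {T : Type*} [NormedAddCommGroup T] [InnerProductSpace ℝ T]
    {W : Type*} [AddCommGroup W] [Module ℝ W] [TopologicalSpace W]
    [IsTopologicalAddGroup W] [ContinuousSMul ℝ W] {ι κ : Type*} [Fintype ι] [Fintype κ]
    (b : OrthonormalBasis ι ℝ T) (b' : OrthonormalBasis κ ℝ T) (B : T →L[ℝ] T →L[ℝ] W) :
    ∑ i, B (b i) (b i) = ∑ j, B (b' j) (b' j) :=
  sum_bilin_orthonormalBasis b b' (LinearMap.mk₂ ℝ (fun u v ↦ B u v) (fun _ _ _ ↦ by simp)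
    (fun _ _ _ ↦ by simp) (fun _ _ _ ↦ by simp) (fun _ _ _ ↦ by simp))

section PointwiseThree
variable {T : Type*} [NormedAddCommGroup T] [InnerProductSpace ℝ T] [FiniteDimensional ℝ T]
  {W : Type*} [AddCommGroup W] [Module ℝ W] [TopologicalSpace W]
  [IsTopologicalAddGroup W] [ContinuousSMul ℝ W]
  [Fact (Module.finrank ℝ T = 3)] (o : Orientation ℝ T (Fin 3))
  (b : OrthonormalBasis (Fin 3) ℝ T)

theorem sum_starAdd_eq_zero {D : T →L[ℝ] T →L[ℝ] T →L[ℝ] W}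
    (hD : ∀ u v w, D u v w = - D u w v)
    (hcyc : ∀ u v w, D u v w + D v w u + D w u v = 0) {H : T →L[ℝ] T →L[ℝ] W}
    (hH : ∑ i, H (b i) (b i) = 0) (ε : ℝ) :
    ∑ i, starAdd o ε (D (b i)) (H (b i)) (b i) = 0 := by
  simp only [Fin.sum_univ_three, starAdd, add_apply, smul_apply] at hH ⊢
  rw [(hodgeStarThree_basis o b (hD _)).1, (hodgeStarThree_basis o b (hD _)).2.1,
    (hodgeStarThree_basis o b (hD _)).2.2]
  linear_combination (norm := module) ε • hH + o.volumeForm b • hcyc (b 0) (b 1) (b 2)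

theorem starAdd_sub_eq {D : T →L[ℝ] T →L[ℝ] T →L[ℝ] W} (hD : ∀ u v w, D u v w = - D u w v)
    {R : T →L[ℝ] T →L[ℝ] W} (hR : ∀ u v, R u v = - R v u) {α : T →L[ℝ] W}
    {H : T →L[ℝ] T →L[ℝ] W} {L : W →ₗ[ℝ] W}
    (hdiv : ∀ v, -∑ i, D (b i) (b i) v = L (α v))
    (hH : ∀ u v, H u v - H v u = L (R u v)) {ε : ℝ} (hε : ε = 1 ∨ ε = -1)
    {t d : T → T → W} (ht : ∀ u, t u = starAdd o ε (D u) (H u))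
    (hd : ∀ u v, d u v = t u v - t v u) :
    d (b 0) (b 1) = (ε * o.volumeForm b) • L (starAdd o ε R α (b 2)) ∧
    d (b 0) (b 2) = - (ε * o.volumeForm b) • L (starAdd o ε R α (b 1)) ∧
    d (b 1) (b 2) = (ε * o.volumeForm b) • L (starAdd o ε R α (b 0)) := by
  have hD0 (u v : T) : D u v v = 0 := by
    have := hD u v v
    rwa [eq_neg_iff_add_eq_zero, ← two_smul ℝ, smul_eq_zero_iff_right two_ne_zero] at this
  have hσ : o.volumeForm b = 1 ∨ o.volumeForm b = -1 :=
    (abs_eq one_pos.le).1 (o.abs_volumeForm_apply_of_orthonormal b)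
  have hD1 (u : T) := hodgeStarThree_basis o b (hD u)
  have hR1 := hodgeStarThree_basis o b hR
  simp only [Fin.sum_univ_three] at hdiv
  simp only [hd, ht, starAdd, add_apply, smul_apply, map_add, map_smul,
    hD1, hR1, ← hdiv, ← hH, hD0, hD _ (b 2) (b 1), hD _ (b 1) (b 0), hD _ (b 2) (b 0)]
  rcases hε with rfl | rfl <;> rcases hσ with h | h <;> rw [h] <;> refine ⟨?_, ?_, ?_⟩ <;> module

theorem homForm_homForm_eq_sum (g : W →ₗ[ℝ] W →ₗ[ℝ] ℝ) {s : ℝ} (hs : s = 1 ∨ s = -1)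
    {d : T →L[ℝ] T →L[ℝ] W} (hd : ∀ u v, d u v = - d v u) {f : Fin 3 → W}
    (h01 : d (b 0) (b 1) = s • f 2) (h02 : d (b 0) (b 2) = - s • f 1)
    (h12 : d (b 1) (b 2) = s • f 0) :
    1 / 2 * homForm T (homForm T g) d d = ∑ i, g (f i) (f i) := by
  rw [homForm_homForm_three b g hd, h01, h02, h12, Fin.sum_univ_three]
  rcases hs with rfl | rfl <;> simp <;> ring

end PointwiseThree

section Bundle
variable {G : Type*} [NormedAddCommGroup G] [NormedSpace ℝ G]

section General
variable {n : ℕ} {M : Type*} [TopologicalSpace M]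
  [ChartedSpace (EuclideanSpace ℝ (Fin n)) M] [IsManifold (𝓡 n) ∞ M]
  [RiemannianBundle (fun x : M ↦ TangentSpace (𝓡 n) x)]
  [IsContMDiffRiemannianBundle (𝓡 n) ∞ (EuclideanSpace ℝ (Fin n))
    (fun x : M ↦ TangentSpace (𝓡 n) x)]
  {W : M → Type*} [TopologicalSpace (TotalSpace G W)]
  [∀ x, AddCommGroup (W x)] [∀ x, Module ℝ (W x)] [∀ x, TopologicalSpace (W x)]
  [∀ x, IsTopologicalAddGroup (W x)] [∀ x, ContinuousSMul ℝ (W x)]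
  [FiberBundle G W] [VectorBundle ℝ G W] {c : CovariantDerivative (𝓡 n) G W}

theorem IsParallelMetric.oneForm {g : Π x, W x →ₗ[ℝ] W x →ₗ[ℝ] ℝ} (hg : IsParallelMetric c g) :
    IsParallelMetric (oneFormConnection c) (fun x : M ↦ homForm (TangentSpace (𝓡 n) x) (g x)) :=
  IsParallelMetric.homConnection (V := fun x : M ↦ TangentSpace (𝓡 n) x)
    leviCivita_isMetricCompatible hg

theorem IsParallelMetric.twoForm {g : Π x, W x →ₗ[ℝ] W x →ₗ[ℝ] ℝ} (hg : IsParallelMetric c g) :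
    IsParallelMetric (twoFormConnection c) (fun x : M ↦ homForm (TangentSpace (𝓡 n) x)
      (homForm (TangentSpace (𝓡 n) x) (g x))) :=
  IsParallelMetric.homConnection (V := fun x : M ↦ TangentSpace (𝓡 n) x)
    leviCivita_isMetricCompatible hg.oneForm

theorem twoFormConnection_swap [T2Space M]
    {β : Π x : M, TangentSpace (𝓡 n) x →L[ℝ] TangentSpace (𝓡 n) x →L[ℝ] W x} {x : M}
    (hβ : MDiffSecAt (𝓡 n)
      (EuclideanSpace ℝ (Fin n) →L[ℝ] EuclideanSpace ℝ (Fin n) →L[ℝ] G) β x)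
    (hs : ∀ (y : M) (u v : TangentSpace (𝓡 n) y), β y u v = - β y v u)
    (u v w : TangentSpace (𝓡 n) x) :
    twoFormConnection c β x u v w = - twoFormConnection c β x u w v := by
  obtain ⟨X, hX, rfl⟩ := exists_smooth_vectorField x v
  obtain ⟨Y, hY, rfl⟩ := exists_smooth_vectorField x w
  have h0 : MDiffSecAt (𝓡 n) G (fun y ↦ β y (Y y) (X y)) x :=
    (hβ.clm_bundle_apply (hY.mdiff x)).clm_bundle_apply (hX.mdiff x)
  have h1 : (fun y ↦ β y (X y) (Y y)) = (-1 : ℝ) • fun y ↦ β y (Y y) (X y) := by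
    ext y
    simp [hs y (X y)]
  rw [twoFormConnection_apply c hβ (hX.mdiff x) (hY.mdiff x),
    twoFormConnection_apply c hβ (hY.mdiff x) (hX.mdiff x), h1,
    c.isCovariantDerivativeOn.smul_const _ h0, hs x (X x), hs x _ (Y x)]
  simp
  abel

theorem codiffTwo_eq {x : M} (b : OrthonormalBasis (Fin n) ℝ (TangentSpace (𝓡 n) x))
    (β : Π x : M, TangentSpace (𝓡 n) x →L[ℝ] TangentSpace (𝓡 n) x →L[ℝ] W x) :
    codiffTwo c β x = -∑ i, twoFormConnection c β x (b i) (b i) :=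
  congrArg Neg.neg (sum_clm_orthonormalBasis _ b _)

theorem codiffOne_eq {x : M} (b : OrthonormalBasis (Fin n) ℝ (TangentSpace (𝓡 n) x))
    (α : Π x : M, TangentSpace (𝓡 n) x →L[ℝ] W x) :
    codiffOne c α x = -∑ i, oneFormConnection c α x (b i) (b i) :=
  congrArg Neg.neg (sum_clm_orthonormalBasis _ b _)

end General
end Bundle
end GaugeKato

namespace GaugeKato
variable {G : Type*} [NormedAddCommGroup G] [NormedSpace ℝ G]

section Four
variable {M : Type*} [TopologicalSpace M] [T2Space M]
  [ChartedSpace (EuclideanSpace ℝ (Fin 4)) M] [IsManifold (𝓡 4) ∞ M]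
  [RiemannianBundle (fun x : M ↦ TangentSpace (𝓡 4) x)]
  [IsContMDiffRiemannianBundle (𝓡 4) ∞ (EuclideanSpace ℝ (Fin 4))
    (fun x : M ↦ TangentSpace (𝓡 4) x)]
  {o : Π x : M, Orientation ℝ (TangentSpace (𝓡 4) x) (Fin 4)}
  {W : M → Type*} [TopologicalSpace (TotalSpace G W)]
  [∀ x, AddCommGroup (W x)] [∀ x, Module ℝ (W x)] [∀ x, TopologicalSpace (W x)]
  [∀ x, IsTopologicalAddGroup (W x)] [∀ x, ContinuousSMul ℝ (W x)]
  [FiberBundle G W] [VectorBundle ℝ G W] {c : CovariantDerivative (𝓡 4) G W}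
  {β : Π x : M, TangentSpace (𝓡 4) x →L[ℝ] TangentSpace (𝓡 4) x →L[ℝ] W x} {x : M}

theorem dualPart_parallel (ho : IsSmoothOrientation o)
    (hβ : MDiffSecAt (𝓡 4)
      (EuclideanSpace ℝ (Fin 4) →L[ℝ] EuclideanSpace ℝ (Fin 4) →L[ℝ] G) β x) (ε : ℝ) :
    MDiffSecAt (𝓡 4) (EuclideanSpace ℝ (Fin 4) →L[ℝ] EuclideanSpace ℝ (Fin 4) →L[ℝ] G)
      (fun y ↦ dualPart (o y) ε (β y)) x ∧
    ∀ u, twoFormConnection c (fun y ↦ dualPart (o y) ε (β y)) x u =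
      dualPart (o x) ε (twoFormConnection c β x u) := by
  obtain ⟨h1, h2⟩ := hodgeStarFour_parallel ho c hβ
  have h3 := MDifferentiableAt.smul_const_section (a := ε) h1
  have h4 := mdifferentiableAt_add_section hβ h3
  refine ⟨MDifferentiableAt.smul_const_section (a := (1 / 2 : ℝ)) h4, fun u ↦ ?_⟩
  have h5 := (twoFormConnection c).isCovariantDerivativeOn.smul_const (1 / 2 : ℝ) h4
  have h6 := (twoFormConnection c).isCovariantDerivativeOn.add hβ h3
  have h7 := (twoFormConnection c).isCovariantDerivativeOn.smul_const ε h1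
  rw [h6, h7] at h5
  refine congr($h5 u).trans ?_
  rw [smul_apply, add_apply, smul_apply, h2]
  rfl

set_option maxHeartbeats 400000 in
/-- The refined Kato inequality for the (anti-)self-dual part of a harmonic two-form. -/
theorem refined_kato_dualPart (ho : IsSmoothOrientation o) {g : Π x, W x →ₗ[ℝ] W x →ₗ[ℝ] ℝ}
    (hg : IsParallelMetric c g)
    (hβ : MDiffSecAt (𝓡 4)
      (EuclideanSpace ℝ (Fin 4) →L[ℝ] EuclideanSpace ℝ (Fin 4) →L[ℝ] G) β x)
    (hs : ∀ (y : M) (u v : TangentSpace (𝓡 4) y), β y u v = - β y v u)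
    (hdiv : codiffTwo c β x = 0)
    (hcyc : ∀ u v w, twoFormConnection c β x u v w + twoFormConnection c β x v w u +
      twoFormConnection c β x w u v = 0) {ε : ℝ} (hε : ε = 1 ∨ ε = -1) {N : M → ℝ}
    (hN : N = fun y ↦ √(((1 / 2 : ℝ) • homForm (TangentSpace (𝓡 4) y)
      (homForm (TangentSpace (𝓡 4) y) (g y))) (dualPart (o y) ε (β y)) (dualPart (o y) ε (β y)))) :
    (dualPart (o x) ε (β x) ≠ 0 → MDifferentiableAt (𝓡 4) 𝓘(ℝ, ℝ) N x) ∧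
    (MDifferentiableAt (𝓡 4) 𝓘(ℝ, ℝ) N x →
      (1 + 1 / 2) * frobSq (· ^ 2) (mvfderiv (𝓡 4) N x) ≤
        homForm (TangentSpace (𝓡 4) x) ((1 / 2 : ℝ) • homForm (TangentSpace (𝓡 4) x)
          (homForm (TangentSpace (𝓡 4) x) (g x)))
          (twoFormConnection c (fun y ↦ dualPart (o y) ε (β y)) x)
          (twoFormConnection c (fun y ↦ dualPart (o y) ε (β y)) x)) := by
  have h1 := (dualPart_parallel (c := c) ho hβ ε).1
  have h2 := (dualPart_parallel (c := c) ho hβ ε).2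
  have hg2 := hg.twoForm.smul one_half_pos
  subst hN
  refine ⟨fun hx ↦ hg2.mdifferentiableAt_norm (β := fun y ↦ dualPart (o y) ε (β y)) h1 hx, fun hd ↦ ?_⟩
  have hb1 := hg2.exists_orthonormalBasis (β := fun y ↦ dualPart (o y) ε (β y)) (x := x)
    h1 hd 0
  obtain ⟨b, hb⟩ := hb1
  have hdiv' := neg_eq_zero.1 ((codiffTwo_eq b β).symm.trans hdiv)
  have hsw := twoFormConnection_swap (c := c) hβ hs
  have key := refined_kato_four (o x) b (hg.symm x) (hg.pos x)
    (D := twoFormConnection c β x)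
    (B := twoFormConnection c (fun y ↦ dualPart (o y) ε (β y)) x) hsw hdiv' hcyc hε h2
  rw [homForm_apply b]
  simp only [LinearMap.smul_apply, smul_eq_mul] at hb ⊢
  rw [← Finset.mul_sum]
  linarith

end Four

section Three
variable {M : Type*} [TopologicalSpace M] [T2Space M]
  [ChartedSpace (EuclideanSpace ℝ (Fin 3)) M] [IsManifold (𝓡 3) ∞ M]
  [RiemannianBundle (fun x : M ↦ TangentSpace (𝓡 3) x)]
  [IsContMDiffRiemannianBundle (𝓡 3) ∞ (EuclideanSpace ℝ (Fin 3))
    (fun x : M ↦ TangentSpace (𝓡 3) x)]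
  {o : Π x : M, Orientation ℝ (TangentSpace (𝓡 3) x) (Fin 3)}
  {W : M → Type*} [TopologicalSpace (TotalSpace G W)]
  [∀ x, AddCommGroup (W x)] [∀ x, Module ℝ (W x)] [∀ x, TopologicalSpace (W x)]
  [∀ x, IsTopologicalAddGroup (W x)] [∀ x, ContinuousSMul ℝ (W x)]
  [FiberBundle G W] [VectorBundle ℝ G W] {c : CovariantDerivative (𝓡 3) G W}
  {β : Π x : M, TangentSpace (𝓡 3) x →L[ℝ] TangentSpace (𝓡 3) x →L[ℝ] W x}
  {α : Π x : M, TangentSpace (𝓡 3) x →L[ℝ] W x} {x : M}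

theorem starAdd_parallel (ho : IsSmoothOrientation o)
    (hβ : MDiffSecAt (𝓡 3)
      (EuclideanSpace ℝ (Fin 3) →L[ℝ] EuclideanSpace ℝ (Fin 3) →L[ℝ] G) β x)
    (hα : MDiffSecAt (𝓡 3) (EuclideanSpace ℝ (Fin 3) →L[ℝ] G) α x) (ε : ℝ) :
    MDiffSecAt (𝓡 3) (EuclideanSpace ℝ (Fin 3) →L[ℝ] G)
      (fun y ↦ starAdd (o y) ε (β y) (α y)) x ∧
    ∀ u, oneFormConnection c (fun y ↦ starAdd (o y) ε (β y) (α y)) x u =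
      starAdd (o x) ε (twoFormConnection c β x u) (oneFormConnection c α x u) := by
  obtain ⟨h1, h2⟩ := hodgeStarThree_parallel ho c hβ
  have h3 := MDifferentiableAt.smul_const_section (a := ε) hα
  refine ⟨mdifferentiableAt_add_section h1 h3, fun u ↦ ?_⟩
  have h6 := (oneFormConnection c).isCovariantDerivativeOn.add h1 h3
  have h7 := (oneFormConnection c).isCovariantDerivativeOn.smul_const ε hα
  rw [h7] at h6
  refine congr($h6 u).trans ?_
  rw [add_apply, smul_apply, h2]
  rfl

variable [FiniteDimensional ℝ G] [ContMDiffVectorBundle ∞ G W (𝓡 3)]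

/-- The exterior derivative of `*β ± α` for a solution of the Yang-Mills-Higgs equations. -/
theorem covExtDeriv_starAdd (ho : IsSmoothOrientation o)
    (hβ : MDiffSecAt (𝓡 3)
      (EuclideanSpace ℝ (Fin 3) →L[ℝ] EuclideanSpace ℝ (Fin 3) →L[ℝ] G) β x)
    (hα : MDiffSecAt (𝓡 3) (EuclideanSpace ℝ (Fin 3) →L[ℝ] G) α x)
    (hs : ∀ (y : M) (u v : TangentSpace (𝓡 3) y), β y u v = - β y v u)
    {L : W x →ₗ[ℝ] W x} (hdivβ : ∀ v, codiffTwo c β x v = L (α x v))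
    (hdα : ∀ u v, oneFormConnection c α x u v - oneFormConnection c α x v u = L (β x u v))
    {ε : ℝ} (hε : ε = 1 ∨ ε = -1) (b : OrthonormalBasis (Fin 3) ℝ (TangentSpace (𝓡 3) x)) :
    covExtDeriv c (fun y ↦ starAdd (o y) ε (β y) (α y)) x (b 0) (b 1) =
      (ε * (o x).volumeForm b) • L (starAdd (o x) ε (β x) (α x) (b 2)) ∧
    covExtDeriv c (fun y ↦ starAdd (o y) ε (β y) (α y)) x (b 0) (b 2) =
      -(ε * (o x).volumeForm b) • L (starAdd (o x) ε (β x) (α x) (b 1)) ∧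
    covExtDeriv c (fun y ↦ starAdd (o y) ε (β y) (α y)) x (b 1) (b 2) =
      (ε * (o x).volumeForm b) • L (starAdd (o x) ε (β x) (α x) (b 0)) := by
  have h1 := (starAdd_parallel (c := c) ho hβ hα ε).1
  have h2 := (starAdd_parallel (c := c) ho hβ hα ε).2
  have h3 (v) : -∑ i, twoFormConnection c β x (b i) (b i) v = L (α x v) := by
    rw [← hdivβ, codiffTwo_eq b β, neg_apply, sum_apply]
  exact starAdd_sub_eq (o x) b (D := twoFormConnection c β x) (H := oneFormConnection c α x)
    (t := fun u v ↦ oneFormConnection c (fun y ↦ starAdd (o y) ε (β y) (α y)) x u v)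
    (d := fun u v ↦ covExtDeriv c (fun y ↦ starAdd (o y) ε (β y) (α y)) x u v)
    (twoFormConnection_swap (c := c) hβ hs) (hs x) h3 hdα hε (fun u ↦ by rw [h2])
    (covExtDeriv_eq_oneFormConnection c h1)

theorem norm_covExtDeriv_starAdd (ho : IsSmoothOrientation o) (g : W x →ₗ[ℝ] W x →ₗ[ℝ] ℝ)
    (hβ : MDiffSecAt (𝓡 3)
      (EuclideanSpace ℝ (Fin 3) →L[ℝ] EuclideanSpace ℝ (Fin 3) →L[ℝ] G) β x)
    (hα : MDiffSecAt (𝓡 3) (EuclideanSpace ℝ (Fin 3) →L[ℝ] G) α x)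
    (hs : ∀ (y : M) (u v : TangentSpace (𝓡 3) y), β y u v = - β y v u)
    {L : W x →ₗ[ℝ] W x} (hdivβ : ∀ v, codiffTwo c β x v = L (α x v))
    (hdα : ∀ u v, oneFormConnection c α x u v - oneFormConnection c α x v u = L (β x u v))
    {ε : ℝ} (hε : ε = 1 ∨ ε = -1) (b : OrthonormalBasis (Fin 3) ℝ (TangentSpace (𝓡 3) x)) :
    1 / 2 * homForm (TangentSpace (𝓡 3) x) (homForm (TangentSpace (𝓡 3) x) g)
      (covExtDeriv c (fun y ↦ starAdd (o y) ε (β y) (α y)) x)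
      (covExtDeriv c (fun y ↦ starAdd (o y) ε (β y) (α y)) x) =
    ∑ i, g (L (starAdd (o x) ε (β x) (α x) (b i))) (L (starAdd (o x) ε (β x) (α x) (b i))) := by
  have h1 := (starAdd_parallel (c := c) ho hβ hα ε).1
  have h2 := covExtDeriv_starAdd ho hβ hα hs hdivβ hdα hε b
  refine homForm_homForm_eq_sum b g (sign_mul_volumeForm (o x) b hε) (fun u v ↦ ?_)
    (f := fun i ↦ L (starAdd (o x) ε (β x) (α x) (b i))) h2.1 h2.2.1 h2.2.2
  rw [covExtDeriv_eq_oneFormConnection c h1, covExtDeriv_eq_oneFormConnection c h1]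
  abel

/-- The refined Kato inequality for the one-form `*β ± α`. -/
theorem refined_kato_starAdd (ho : IsSmoothOrientation o) {g : Π x, W x →ₗ[ℝ] W x →ₗ[ℝ] ℝ}
    (hg : IsParallelMetric c g)
    (hβ : MDiffSecAt (𝓡 3)
      (EuclideanSpace ℝ (Fin 3) →L[ℝ] EuclideanSpace ℝ (Fin 3) →L[ℝ] G) β x)
    (hα : MDiffSecAt (𝓡 3) (EuclideanSpace ℝ (Fin 3) →L[ℝ] G) α x)
    (hs : ∀ (y : M) (u v : TangentSpace (𝓡 3) y), β y u v = - β y v u)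
    (hcyc : ∀ u v w, twoFormConnection c β x u v w + twoFormConnection c β x v w u +
      twoFormConnection c β x w u v = 0)
    (hdivα : codiffOne c α x = 0) (ε : ℝ) {a : ℝ} (ha : 0 < a) {N : M → ℝ}
    (hN : N = fun y ↦ √(homForm (TangentSpace (𝓡 3) y) (g y)
      (starAdd (o y) ε (β y) (α y)) (starAdd (o y) ε (β y) (α y)))) :
    (starAdd (o x) ε (β x) (α x) ≠ 0 → MDifferentiableAt (𝓡 3) 𝓘(ℝ, ℝ) N x) ∧
    (MDifferentiableAt (𝓡 3) 𝓘(ℝ, ℝ) N x →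
      (1 + min (1 / 2) (a / (1 + a))) * frobSq (· ^ 2) (mvfderiv (𝓡 3) N x) -
        a * (1 / 2 * homForm (TangentSpace (𝓡 3) x) (homForm (TangentSpace (𝓡 3) x) (g x))
          (covExtDeriv c (fun y ↦ starAdd (o y) ε (β y) (α y)) x)
          (covExtDeriv c (fun y ↦ starAdd (o y) ε (β y) (α y)) x)) ≤
        homForm (TangentSpace (𝓡 3) x) (homForm (TangentSpace (𝓡 3) x) (g x))
          (oneFormConnection c (fun y ↦ starAdd (o y) ε (β y) (α y)) x)
          (oneFormConnection c (fun y ↦ starAdd (o y) ε (β y) (α y)) x)) := by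
  have h1 := (starAdd_parallel (c := c) ho hβ hα ε).1
  have h2 := (starAdd_parallel (c := c) ho hβ hα ε).2
  have hg2 := hg.oneForm
  subst hN
  refine ⟨fun hx ↦ hg2.mdifferentiableAt_norm (β := fun y ↦ starAdd (o y) ε (β y) (α y)) h1 hx,
    fun hd ↦ ?_⟩
  have hb1 := hg2.exists_orthonormalBasis (β := fun y ↦ starAdd (o y) ε (β y) (α y)) (x := x)
    h1 hd 0
  obtain ⟨b, hb⟩ := hb1
  have hdiv' := neg_eq_zero.1 ((codiffOne_eq b α).symm.trans hdivα)
  have hsw := twoFormConnection_swap (c := c) hβ hs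
  have hdiv2 : ∑ i, oneFormConnection c (fun y ↦ starAdd (o y) ε (β y) (α y)) x (b i) (b i) = 0 := by
    simp only [h2]
    exact sum_starAdd_eq_zero (o x) b hsw hcyc hdiv' ε
  have key := refined_kato_three b (hg.symm x) (hg.pos x)
    (t := oneFormConnection c (fun y ↦ starAdd (o y) ε (β y) (α y)) x)
    (d := covExtDeriv c (fun y ↦ starAdd (o y) ε (β y) (α y)) x)
    (covExtDeriv_eq_oneFormConnection c h1) hdiv2 ha
  refine le_trans (sub_le_sub_right (mul_le_mul_of_nonneg_left hb ?_) _) key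
  have : 0 ≤ a / (1 + a) := by positivity
  have : 0 ≤ min (1 / 2) (a / (1 + a)) := le_min (by norm_num) this
  linarith

end Three
end GaugeKato

namespace GaugeKato

section EndNorms
variable
  {E : Type*} [NormedAddCommGroup E] [NormedSpace ℝ E] [FiniteDimensional ℝ E]
  {H : Type*} [TopologicalSpace H] {I : ModelWithCorners ℝ E H}
  {M : Type*} [TopologicalSpace M] [ChartedSpace H M] [IsManifold I ∞ M]
  {F : Type*} [NormedAddCommGroup F] [NormedSpace ℝ F] [FiniteDimensional ℝ F]
  {V : M → Type*} [TopologicalSpace (TotalSpace F V)]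
  [∀ x, NormedAddCommGroup (V x)] [∀ x, InnerProductSpace ℝ (V x)]
  [∀ x, FiniteDimensional ℝ (V x)]
  [FiberBundle F V] [VectorBundle ℝ F V]

/-- The inner product `tr (Aᵀ B)` on the endomorphisms of a fibre. -/
noncomputable abbrev endForm (V : M → Type*) [∀ x, NormedAddCommGroup (V x)]
    [∀ x, InnerProductSpace ℝ (V x)] [∀ x, FiniteDimensional ℝ (V x)] (x : M) :
    (V x →L[ℝ] V x) →ₗ[ℝ] (V x →L[ℝ] V x) →ₗ[ℝ] ℝ :=
  homForm (V x) (innerₗ (V x))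

theorem endNormSq_eq {x : M} : endNormSq F (V := V) (x := x) = fun A ↦ endForm V x A A := by
  ext A
  simp [endNormSq, homForm, frobSq]

theorem isParallelMetric_endForm [ContMDiffVectorBundle ∞ F V I]
    [IsContMDiffRiemannianBundle I ∞ F V] {A : CovariantDerivative I F V}
    (hA : A.IsMetricCompatible) : IsParallelMetric (endConnection A) (endForm V) :=
  (isParallelMetric_inner hA).homConnection hA

/-- The commutator with an endomorphism. -/
noncomputable def commutator {x : M} (Φ : V x →L[ℝ] V x) :
    (V x →L[ℝ] V x) →ₗ[ℝ] (V x →L[ℝ] V x) where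
  toFun B := B ∘L Φ - Φ ∘L B
  map_add' B C := by ext s; simp; abel
  map_smul' r B := by ext s; simp [smul_sub]

end EndNorms

section FormNorms
variable
  {E : Type*} [NormedAddCommGroup E] [NormedSpace ℝ E] [FiniteDimensional ℝ E]
  {H : Type*} [TopologicalSpace H] {I : ModelWithCorners ℝ E H}
  {M : Type*} [TopologicalSpace M] [ChartedSpace H M]
  [RiemannianBundle (fun x : M ↦ TangentSpace I x)] {x : M}
  {W : Type*} [AddCommGroup W] [Module ℝ W] [TopologicalSpace W]
  [IsTopologicalAddGroup W] [ContinuousSMul ℝ W] (g : W →ₗ[ℝ] W →ₗ[ℝ] ℝ)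

theorem oneFormNormSq_eq_sum {ι : Type*} [Fintype ι]
    (b : OrthonormalBasis ι ℝ (TangentSpace I x)) (α : TangentSpace I x →ₗ[ℝ] W) :
    oneFormNormSq (I := I) (fun w ↦ g w w) α = ∑ i, g (α (b i)) (α (b i)) :=
  sum_bilin_orthonormalBasis (stdOrthonormalBasis ℝ (TangentSpace I x)) b (g.compl₁₂ α α)

end FormNorms

section Dual
variable {T : Type*} [NormedAddCommGroup T] [InnerProductSpace ℝ T] [FiniteDimensional ℝ T]
  {W : Type*} [AddCommGroup W] [Module ℝ W] [TopologicalSpace W]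
  [IsTopologicalAddGroup W] [ContinuousSMul ℝ W]

theorem isDual_iff_dualPart_eq_zero [Fact (Module.finrank ℝ T = 4)] (o : Orientation ℝ T (Fin 4))
    {ε : ℝ} (hε : ε = 1 ∨ ε = -1) (β : T →L[ℝ] T →L[ℝ] W) :
    IsDual o (-ε) β ↔ dualPart o ε β = 0 := by
  refine ⟨fun h ↦ ?_, fun h ↦ ?_⟩
  · ext u v
    have h1 : hodgeStarFour o β u v = -ε • β u v := congr($h u v)
    change (1 / 2 : ℝ) • (β u v + ε • hodgeStarFour o β u v) = 0
    rw [h1]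
    rcases hε with rfl | rfl <;> module
  · change hodgeStarFour o β = -ε • β
    ext u v
    have h1 : (1 / 2 : ℝ) • (β u v + ε • hodgeStarFour o β u v) = 0 := congr($h u v)
    change hodgeStarFour o β u v = -ε • β u v
    rcases hε with rfl | rfl
    · linear_combination (norm := module) (2 : ℝ) • h1
    · linear_combination (norm := module) (-2 : ℝ) • h1

theorem isBogomolny_iff_starAdd_eq_zero [Fact (Module.finrank ℝ T = 3)]
    (o : Orientation ℝ T (Fin 3)) (ε : ℝ) (β : T →L[ℝ] T →L[ℝ] W) (α : T →L[ℝ] W) :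
    IsBogomolny o (-ε) β α ↔ starAdd o ε β α = 0 := by
  rw [IsBogomolny, starAdd, neg_smul, eq_neg_iff_add_eq_zero]

end Dual

end GaugeKato

namespace GaugeKato

section YangMills
variable {M : Type*} [TopologicalSpace M] [T2Space M]
  [ChartedSpace (EuclideanSpace ℝ (Fin 4)) M] [IsManifold (𝓡 4) ∞ M]
  [RiemannianBundle (fun x : M ↦ TangentSpace (𝓡 4) x)]
  [IsContMDiffRiemannianBundle (𝓡 4) ∞ (EuclideanSpace ℝ (Fin 4))
    (fun x : M ↦ TangentSpace (𝓡 4) x)]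
  {o : Π x : M, Orientation ℝ (TangentSpace (𝓡 4) x) (Fin 4)}
  {F : Type*} [NormedAddCommGroup F] [NormedSpace ℝ F] [FiniteDimensional ℝ F]
  {V : M → Type*} [TopologicalSpace (TotalSpace F V)]
  [∀ x, NormedAddCommGroup (V x)] [∀ x, InnerProductSpace ℝ (V x)]
  [FiberBundle F V] [VectorBundle ℝ F V] [ContMDiffVectorBundle ∞ F V (𝓡 4)]
  [IsContMDiffRiemannianBundle (𝓡 4) ∞ F V]
  {A : CovariantDerivative (𝓡 4) F V} [A.ContMDiffCovariantDerivative ∞]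

/-- The refined Kato inequality for Yang-Mills fields. -/
theorem IsYangMills.refined_kato [∀ x, FiniteDimensional ℝ (V x)] (ho : IsSmoothOrientation o)
    (hA : A.IsMetricCompatible)
    (hYM : IsYangMills A) {ε : ℝ} (hε : ε = 1 ∨ ε = -1) {N : M → ℝ}
    (hN : N = fun y ↦ √(((1 / 2 : ℝ) • homForm (TangentSpace (𝓡 4) y)
      (homForm (TangentSpace (𝓡 4) y) (endForm V y))) (dualPart (o y) ε (curvature A y))
        (dualPart (o y) ε (curvature A y)))) (x : M) :
    (dualPart (o x) ε (curvature A x) ≠ 0 → MDifferentiableAt (𝓡 4) 𝓘(ℝ, ℝ) N x) ∧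
    (MDifferentiableAt (𝓡 4) 𝓘(ℝ, ℝ) N x →
      (1 + 1 / 2) * frobSq (· ^ 2) (mvfderiv (𝓡 4) N x) ≤
        frobSq (twoFormNormSq (fun B ↦ endForm V x B B))
          (fun u v w ↦ twoFormConnection (endConnection A)
            (fun y ↦ dualPart (o y) ε (curvature A y)) x u v w)) :=
  refined_kato_dualPart ho (isParallelMetric_endForm hA) (mdiffSecAt_curvature A x)
    (fun y u v ↦ by ext s; exact curvature_swap A y u v s) (hYM x) (bianchi A x) hε hN

end YangMills

section Higgs
variable {M : Type*} [TopologicalSpace M] [T2Space M]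
  [ChartedSpace (EuclideanSpace ℝ (Fin 3)) M] [IsManifold (𝓡 3) ∞ M]
  [RiemannianBundle (fun x : M ↦ TangentSpace (𝓡 3) x)]
  [IsContMDiffRiemannianBundle (𝓡 3) ∞ (EuclideanSpace ℝ (Fin 3))
    (fun x : M ↦ TangentSpace (𝓡 3) x)]
  {o : Π x : M, Orientation ℝ (TangentSpace (𝓡 3) x) (Fin 3)}
  {F : Type*} [NormedAddCommGroup F] [NormedSpace ℝ F] [FiniteDimensional ℝ F]
  {V : M → Type*} [TopologicalSpace (TotalSpace F V)]
  [∀ x, NormedAddCommGroup (V x)] [∀ x, InnerProductSpace ℝ (V x)]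
  [FiberBundle F V] [VectorBundle ℝ F V] [ContMDiffVectorBundle ∞ F V (𝓡 3)]
  [IsContMDiffRiemannianBundle (𝓡 3) ∞ F V]
  {A : CovariantDerivative (𝓡 3) F V} [A.ContMDiffCovariantDerivative ∞]

theorem curvature_antisymm (y : M) (u v : TangentSpace (𝓡 3) y) :
    curvature A y u v = - curvature A y v u := by
  ext s
  exact curvature_swap A y u v s

variable [∀ x, FiniteDimensional ℝ (V x)] {Φ : Π x : M, V x →L[ℝ] V x}

/-- The refined Kato inequality for Yang-Mills-Higgs fields. -/
theorem IsYangMillsHiggs.refined_kato (ho : IsSmoothOrientation o)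
    (hA : A.IsMetricCompatible) (hYM : IsYangMillsHiggs A Φ) (ε : ℝ) {a : ℝ} (ha : 0 < a)
    {N : M → ℝ}
    (hN : N = fun y ↦ √(homForm (TangentSpace (𝓡 3) y) (endForm V y)
      (starAdd (o y) ε (curvature A y) (endConnection A Φ y))
        (starAdd (o y) ε (curvature A y) (endConnection A Φ y)))) (x : M) :
    (starAdd (o x) ε (curvature A x) (endConnection A Φ x) ≠ 0 →
      MDifferentiableAt (𝓡 3) 𝓘(ℝ, ℝ) N x) ∧
    (MDifferentiableAt (𝓡 3) 𝓘(ℝ, ℝ) N x →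
      (1 + min (1 / 2) (a / (1 + a))) * frobSq (· ^ 2) (mvfderiv (𝓡 3) N x) -
        a * twoFormNormSq (fun B ↦ endForm V x B B) (fun u v ↦ covExtDeriv (endConnection A)
          (fun y ↦ starAdd (o y) ε (curvature A y) (endConnection A Φ y)) x u v) ≤
        frobSq (oneFormNormSq (fun B ↦ endForm V x B B))
          (fun u v ↦ oneFormConnection (endConnection A)
            (fun y ↦ starAdd (o y) ε (curvature A y) (endConnection A Φ y)) x u v)) :=
  refined_kato_starAdd ho (isParallelMetric_endForm hA)
    (mdiffSecAt_curvature A x) (mdiffSecAt_homConnection A hYM.smooth x) curvature_antisymm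
    (bianchi A x) (hYM.codiff_higgs x) ε ha hN

theorem IsYangMillsHiggs.norm_covExtDeriv (ho : IsSmoothOrientation o)
    (hYM : IsYangMillsHiggs A Φ) {ε : ℝ} (hε : ε = 1 ∨ ε = -1) (x : M) :
    twoFormNormSq (fun B ↦ endForm V x B B) (fun u v ↦ covExtDeriv (endConnection A)
        (fun y ↦ starAdd (o y) ε (curvature A y) (endConnection A Φ y)) x u v) =
      oneFormNormSq (fun B ↦ endForm V x B B)
        (bracketOne (starAdd (o x) ε (curvature A x) (endConnection A Φ x)) (Φ x)) := by
  have hα := mdiffSecAt_homConnection A hYM.smooth x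
  have hdα (u v : TangentSpace (𝓡 3) x) :
      oneFormConnection (endConnection A) (endConnection A Φ) x u v -
        oneFormConnection (endConnection A) (endConnection A Φ) x v u =
      commutator (Φ x) (curvature A x u v) :=
    (covExtDeriv_eq_oneFormConnection _ hα u v).symm.trans
      (covExtDeriv_homConnection A hYM.smooth x u v)
  let b := (stdOrthonormalBasis ℝ (TangentSpace (𝓡 3) x)).reindex
    (finCongr (fact_finrank_tangentSpace (n := 3) x).out)
  have h1 := norm_covExtDeriv_starAdd ho (endForm V x)
    (mdiffSecAt_curvature A x) hα curvature_antisymm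
    (L := commutator (Φ x)) (hYM.codiff_curvature x) hdα hε b
  have h2 := oneFormNormSq_eq_sum (endForm V x) b
    ((commutator (Φ x)).comp
      (starAdd (o x) ε (curvature A x) (endConnection A Φ x) : TangentSpace (𝓡 3) x →ₗ[ℝ] _))
  exact h1.trans h2.symm

end Higgs
end GaugeKato

theorem mainTheorem7 :
    (∀ (M : Type u) [TopologicalSpace M] [T2Space M]
      [ChartedSpace (EuclideanSpace ℝ (Fin 4)) M] [IsManifold (𝓡 4) ∞ M]
      [RiemannianBundle (fun x : M ↦ TangentSpace (𝓡 4) x)]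
      [IsContMDiffRiemannianBundle (𝓡 4) ∞ (EuclideanSpace ℝ (Fin 4))
        (fun x : M ↦ TangentSpace (𝓡 4) x)]
      (o : Π x : M, Orientation ℝ (TangentSpace (𝓡 4) x) (Fin 4))
      (F : Type v) [NormedAddCommGroup F] [NormedSpace ℝ F] [FiniteDimensional ℝ F]
      (V : M → Type w) [TopologicalSpace (TotalSpace F V)]
      [∀ x, NormedAddCommGroup (V x)] [∀ x, InnerProductSpace ℝ (V x)]
      [FiberBundle F V] [VectorBundle ℝ F V] [ContMDiffVectorBundle ∞ F V (𝓡 4)]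
      [IsContMDiffRiemannianBundle (𝓡 4) ∞ F V]
      (A : CovariantDerivative (𝓡 4) F V) [A.ContMDiffCovariantDerivative ∞] (ε : ℝ),
      GaugeKato.IsSmoothOrientation o → A.IsMetricCompatible → GaugeKato.IsYangMills A →
      (ε = 1 ∨ ε = -1) →
      let Fε : Π x : M, TangentSpace (𝓡 4) x →L[ℝ] TangentSpace (𝓡 4) x →L[ℝ] V x →L[ℝ] V x :=
        fun x ↦ GaugeKato.dualPart (o x) ε (GaugeKato.curvature A x)
      let normF : M → ℝ := fun x ↦
        √(GaugeKato.twoFormNormSq (GaugeKato.endNormSq F) (fun u v ↦ Fε x u v))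
      ((∀ x, GaugeKato.IsDual (o x) (-ε) (GaugeKato.curvature A x)) ↔ ∀ x, Fε x = 0) ∧
      ∀ x : M,
        (Fε x ≠ 0 → MDifferentiableAt (𝓡 4) 𝓘(ℝ, ℝ) normF x) ∧
        (MDifferentiableAt (𝓡 4) 𝓘(ℝ, ℝ) normF x →
          GaugeKato.frobSq (GaugeKato.twoFormNormSq (GaugeKato.endNormSq F))
              (fun u v w ↦ GaugeKato.twoFormConnection (GaugeKato.endConnection A) Fε x u v w) ≥
            (1 + 1 / 2) * GaugeKato.frobSq (· ^ 2) (mvfderiv (𝓡 4) normF x)))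
    ∧
    (∀ (M : Type u) [TopologicalSpace M] [T2Space M]
      [ChartedSpace (EuclideanSpace ℝ (Fin 3)) M] [IsManifold (𝓡 3) ∞ M]
      [RiemannianBundle (fun x : M ↦ TangentSpace (𝓡 3) x)]
      [IsContMDiffRiemannianBundle (𝓡 3) ∞ (EuclideanSpace ℝ (Fin 3))
        (fun x : M ↦ TangentSpace (𝓡 3) x)]
      (o : Π x : M, Orientation ℝ (TangentSpace (𝓡 3) x) (Fin 3))
      (F : Type v) [NormedAddCommGroup F] [NormedSpace ℝ F] [FiniteDimensional ℝ F]
      (V : M → Type w) [TopologicalSpace (TotalSpace F V)]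
      [∀ x, NormedAddCommGroup (V x)] [∀ x, InnerProductSpace ℝ (V x)]
      [FiberBundle F V] [VectorBundle ℝ F V] [ContMDiffVectorBundle ∞ F V (𝓡 3)]
      [IsContMDiffRiemannianBundle (𝓡 3) ∞ F V]
      (A : CovariantDerivative (𝓡 3) F V) [A.ContMDiffCovariantDerivative ∞]
      (Φ : Π x : M, V x →L[ℝ] V x) (ε a : ℝ),
      GaugeKato.IsSmoothOrientation o → A.IsMetricCompatible →
      GaugeKato.IsYangMillsHiggs A Φ → (ε = 1 ∨ ε = -1) → 0 < a →
      let ωε : Π x : M, TangentSpace (𝓡 3) x →L[ℝ] V x →L[ℝ] V x :=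
        fun x ↦ GaugeKato.starAdd (o x) ε (GaugeKato.curvature A x)
          (GaugeKato.endConnection A Φ x)
      let dω : Π x : M, TangentSpace (𝓡 3) x →L[ℝ] TangentSpace (𝓡 3) x →L[ℝ] V x →L[ℝ] V x :=
        GaugeKato.covExtDeriv (GaugeKato.endConnection A) ωε
      let normω : M → ℝ := fun x ↦
        √(GaugeKato.oneFormNormSq (GaugeKato.endNormSq F) (fun u ↦ ωε x u))
      ((∀ x, GaugeKato.IsBogomolny (o x) (-ε) (GaugeKato.curvature A x)
          (GaugeKato.endConnection A Φ x)) ↔ ∀ x, ωε x = 0) ∧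
      ∀ x : M,
        (ωε x ≠ 0 → MDifferentiableAt (𝓡 3) 𝓘(ℝ, ℝ) normω x) ∧
        (MDifferentiableAt (𝓡 3) 𝓘(ℝ, ℝ) normω x →
          GaugeKato.frobSq (GaugeKato.oneFormNormSq (GaugeKato.endNormSq F))
              (fun u v ↦ GaugeKato.oneFormConnection (GaugeKato.endConnection A) ωε x u v) ≥
            (1 + min (1 / 2) (a / (1 + a))) *
                GaugeKato.frobSq (· ^ 2) (mvfderiv (𝓡 3) normω x) -
              a * GaugeKato.twoFormNormSq (GaugeKato.endNormSq F) (fun u v ↦ dω x u v)) ∧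
        √(GaugeKato.twoFormNormSq (GaugeKato.endNormSq F) (fun u v ↦ dω x u v)) =
          √(GaugeKato.oneFormNormSq (GaugeKato.endNormSq F)
            (GaugeKato.bracketOne (ωε x) (Φ x)))) := by
  constructor
  · intro M _ _ _ _ _ _ o F _ _ _ V _ _ _ _ _ _ _ A _ ε ho hA hYM hε Fε normF
    have hfd (x : M) : FiniteDimensional ℝ (V x) := VectorBundle.finiteDimensional ℝ F V x
    have hN : normF = fun y ↦ √(((1 / 2 : ℝ) • GaugeKato.homForm (TangentSpace (𝓡 4) y)
        (GaugeKato.homForm (TangentSpace (𝓡 4) y) (GaugeKato.endForm V y))) (Fε y) (Fε y)) := by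
      ext y
      simp only [normF, GaugeKato.endNormSq_eq]
      rfl
    refine ⟨forall_congr' fun x ↦ GaugeKato.isDual_iff_dualPart_eq_zero (o x) hε _, fun x ↦ ?_⟩
    have key := hYM.refined_kato ho hA hε hN x
    refine ⟨key.1, fun hd ↦ ?_⟩
    rw [GaugeKato.endNormSq_eq]
    exact key.2 hd
  · intro M _ _ _ _ _ _ o F _ _ _ V _ _ _ _ _ _ _ A _ Φ ε a ho hA hYM hε ha ωε dω normω
    have hfd (x : M) : FiniteDimensional ℝ (V x) := VectorBundle.finiteDimensional ℝ F V x
    have hN : normω = fun y ↦ √(GaugeKato.homForm (TangentSpace (𝓡 3) y)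
        (GaugeKato.endForm V y) (ωε y) (ωε y)) := by
      ext y
      simp only [normω, GaugeKato.endNormSq_eq]
      rfl
    refine ⟨forall_congr' fun x ↦ GaugeKato.isBogomolny_iff_starAdd_eq_zero (o x) ε _ _,
      fun x ↦ ?_⟩
    have key := hYM.refined_kato ho hA ε ha hN x
    rw [GaugeKato.endNormSq_eq]
    exact ⟨key.1, key.2, congrArg Real.sqrt (hYM.norm_covExtDeriv ho hε x)⟩
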